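/- **Kripke models and CTL.** A finite rooted Kripke model is $\mathcal M=(W,R,\eta,r)$ with $W$ a finite non-empty set of worlds, $R\subseteq W\times W$ total (every world has an $R$-successor), $\eta$ assigning to each world a finite set of propositions (from a countably infinite set), and $r\in W$ the root. CTL formulas are built from $\top$, propositions, $\lnot,\lor,\land$ and the ten operators $\mathsf{EX},\mathsf{AX},\mathsf{EF},\mathsf{AF},\mathsf{EG},\mathsf{AG},\mathsf{EU},\mathsf{AU},\mathsf{ER},\mathsf{AR}$, with the usual semantics over infinite $R$-paths; $\mathcal M\models\varphi$ means that $\varphi$ holds at the root. A *connected submodel* of $\mathcal M$ is a Kripke model $\mathcal M'=(W',R',\eta\!\upharpoonright_{W'},r)$ with $W'\subseteq W$, $R'\subseteq R$, $R'$ total on $W'$, in which every world of $W'$ lies on an infinite $R'$-path starting in $r$. **Enumeration.** An enumeration problem over a finite alphabet $\Sigma$ consists of a set $I\subseteq\Sigma^*$ of instances and, for each $x\in I$, a set $\mathrm{Sol}(x)\subseteq\Sigma^*$ of solutions whose lengths are bounded by a polynomial in $|x|$. It belongs to $\mathsf{DelNP}$ if there are a language $L\in\mathsf{NP}$, a random access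 machine with oracle $L$ (with logarithmic cost for its instructions; an oracle call is one step of unit cost) and a polynomial $p$ such that, on every $x\in I$, the machine terminates and outputs exactly the elements of $\mathrm{Sol}(x)$, each once; the time before the first output, the time between any two consecutive outputs, and the time from the last output to termination are each at most $p(|x|)$ (if there are no solutions, it terminates within time $p(|x|)$); and every oracle call has size at most $p(|x|)$. **Theorem.** Let E-Submodels be the enumeration problem whose instances are pairs $(\mathcal M,\varphi)$ of a finite rooted Kripke model and an arbitrary CTL formula, and whose solutions are all connected submodels $\mathcal M'$ of $\mathcal M$ with $\mathcal M'\models\varphi$, under a standard encoding by words (worlds are named by numbers below some $n$ and given with an $n\times n$ adjacency matrix, propositions are numbers in binary, formulas are in prefix notation; models in the input and in the output are encoded in the same way). Then E-Submodels is in $\mathsf{DelNP}$. -/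

import Mathlib

/-! ### Computation tree logic -/

/-- Path quantifiers: `E` (some path) and `A` (all paths). -/
inductive PathQuant
  | E
  | A

/-- Unary temporal operators. -/
inductive UnOp
  | X
  | F
  | G

/-- Binary temporal operators. -/
inductive BinOp
  | U
  | R

/-- CTL formulas; the countably infinite set of propositions is `ℕ`. -/
inductive CTL
  | top : CTL
  | prop : ℕ → CTL
  | neg : CTL → CTL
  | or : CTL → CTL → CTL
  | and : CTL → CTL → CTL
  | un : PathQuant → UnOp → CTL → CTL
  | bin : PathQuant → BinOp → CTL → CTL → CTL

/-- A finite rooted Kripke model whose worlds are natural numbers below `n`.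
Worlds and labels are finite sets because models are inputs and outputs of algorithms.
The assignment `η` only matters on `worlds`; it has the default value `∅` elsewhere. -/
@[ext]
structure Kripke (n : ℕ) where
  worlds : Finset (Fin n)
  R : Finset (Fin n × Fin n)
  η : Fin n → Finset ℕ
  root : Fin n
  root_mem : root ∈ worlds
  R_sub : ∀ e ∈ R, e.1 ∈ worlds ∧ e.2 ∈ worlds
  total : ∀ w ∈ worlds, ∃ v, (w, v) ∈ R
  η_off : ∀ w, w ∉ worlds → η w = ∅

namespace Kripke

variable {n : ℕ}

/-- The infinite paths that start in `w`; the first world of a path has index `0`. -/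
def paths (M : Kripke n) (w : Fin n) : Set (ℕ → Fin n) :=
  {π | π 0 = w ∧ ∀ i, (π i, π (i + 1)) ∈ M.R}

end Kripke

/-- Some, respectively every, path in `S` has property `P`. -/
def PathQuant.Holds {α : Type} (S : Set α) (P : α → Prop) : PathQuant → Prop
  | .E => ∃ π ∈ S, P π
  | .A => ∀ π ∈ S, P π

/-- Unary temporal operators along a path: `s i` says that the argument holds at position `i`. -/
def UnOp.Holds (s : ℕ → Prop) : UnOp → Prop
  | .X => s 1
  | .F => ∃ k, s k
  | .G => ∀ k, s k

/-- Binary temporal operators along a path: `s i`, `t i` say that the left, respectively right,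
argument holds at position `i`. -/
def BinOp.Holds (s t : ℕ → Prop) : BinOp → Prop
  | .U => ∃ k, t k ∧ ∀ i < k, s i
  | .R => ∀ k, t k ∨ ∃ i < k, s i

namespace Kripke

variable {n : ℕ}

/-- `M, w ⊨ φ`. -/
def Sat (M : Kripke n) : CTL → Fin n → Prop
  | .top, _ => True
  | .prop p, w => p ∈ M.η w
  | .neg φ, w => ¬ M.Sat φ w
  | .or φ ψ, w => M.Sat φ w ∨ M.Sat ψ w
  | .and φ ψ, w => M.Sat φ w ∧ M.Sat ψ w
  | .un Q T φ, w => Q.Holds (M.paths w) (fun π => T.Holds (fun i => M.Sat φ (π i)))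
  | .bin Q T φ ψ, w => Q.Holds (M.paths w)
      (fun π => T.Holds (fun i => M.Sat φ (π i)) (fun i => M.Sat ψ (π i)))

/-- `M ⊨ φ`: satisfaction at the root. -/
def Models (M : Kripke n) (φ : CTL) : Prop := M.Sat φ M.root

/-- `M'` is a submodel of `M` with the restricted assignment and the same root
(totality of the smaller relation is part of `M'` being a Kripke model). -/
structure IsSubmodel (M' M : Kripke n) : Prop where
  worlds_sub : M'.worlds ⊆ M.worlds
  R_sub : M'.R ⊆ M.R
  η_eq : ∀ w ∈ M'.worlds, M'.η w = M.η w
  root_eq : M'.root = M.root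

/-- `M'` is a connected submodel of `M`: every world of `M'` lies on a path of `M'` that starts
in the root. -/
structure IsConnectedSubmodel (M' M : Kripke n) : Prop extends IsSubmodel M' M where
  connected : ∀ w ∈ M'.worlds, ∃ π ∈ M'.paths M'.root, ∃ i, π i = w

end Kripke

/-! ### Words for models and formulas -/

/-- The alphabet of the problem. -/
abbrev Letter : Type := Fin 24

namespace Letter

def zero : Letter := 0
def one : Letter := 1
def endNum : Letter := 2
def absent : Letter := 3
def world : Letter := 4
def root : Letter := 5
def noEdge : Letter := 6
def edge : Letter := 7
def endWorld : Letter := 8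
def top : Letter := 9
def prop : Letter := 10
def neg : Letter := 11
def or : Letter := 12
def and : Letter := 13

/-- The symbol of a unary CTL operator. -/
def un : PathQuant → UnOp → Letter
  | .E, .X => 14
  | .A, .X => 15
  | .E, .F => 16
  | .A, .F => 17
  | .E, .G => 18
  | .A, .G => 19

/-- The symbol of a binary CTL operator. -/
def bin : PathQuant → BinOp → Letter
  | .E, .U => 20
  | .A, .U => 21
  | .E, .R => 22
  | .A, .R => 23

end Letter

/-- Binary representation (least significant bit first) with an end marker. -/
def encodeNum (k : ℕ) : List Letter :=
  k.bits.map (fun b => if b then Letter.one else Letter.zero) ++ [Letter.endNum]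

/-- Formulas in prefix notation. -/
def CTL.encode : CTL → List Letter
  | .top => [Letter.top]
  | .prop p => Letter.prop :: encodeNum p
  | .neg φ => Letter.neg :: φ.encode
  | .or φ ψ => Letter.or :: (φ.encode ++ ψ.encode)
  | .and φ ψ => Letter.and :: (φ.encode ++ ψ.encode)
  | .un Q T φ => Letter.un Q T :: φ.encode
  | .bin Q T φ ψ => Letter.bin Q T :: (φ.encode ++ ψ.encode)

namespace Kripke

variable {n : ℕ}

/-- The part of the word of a model that describes `w`: a symbol saying whether `w` is the root,
another world, or not a world; the row of `w` in the adjacency matrix; the propositions that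
label `w`, in increasing order; an end marker. -/
def encodeWorld (M : Kripke n) (w : Fin n) : List Letter :=
  (if w = M.root then Letter.root else if w ∈ M.worlds then Letter.world else Letter.absent) ::
    ((List.finRange n).map (fun v => if (w, v) ∈ M.R then Letter.edge else Letter.noEdge) ++
      (((M.η w).sort (· ≤ ·)).flatMap encodeNum ++ [Letter.endWorld]))

/-- The word that describes a model. -/
def encode (M : Kripke n) : List Letter := (List.finRange n).flatMap M.encodeWorld

end Kripke

/-- The word that describes the instance `(M, φ)`. -/
def encodeInstance {n : ℕ} (M : Kripke n) (φ : CTL) : List Letter := M.encode ++ φ.encode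

/-! Distinct instances have distinct words, so the solutions of a word are those of one
instance. -/

theorem encodeNum_append {a b : ℕ} {s t : List Letter}
    (h : encodeNum a ++ s = encodeNum b ++ t) : a = b ∧ s = t := by
  have key : ∀ (l l' : List Bool) (s t : List Letter),
      l.map (fun b => if b then Letter.one else Letter.zero) ++ Letter.endNum :: s =
        l'.map (fun b => if b then Letter.one else Letter.zero) ++ Letter.endNum :: t → l = l' ∧ s = t := by
    intro l
    induction l with
    | nil =>
      intro l' s t h
      cases l' with
      | nil => simpa using h
      | cons b l' => cases b <;> simp [Letter.one, Letter.zero, Letter.endNum] at h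
    | cons a l ih =>
      intro l' s t h
      cases l' with
      | nil => cases a <;> simp [Letter.one, Letter.zero, Letter.endNum] at h
      | cons b l' =>
        simp only [List.map_cons, List.cons_append, List.cons.injEq] at h
        obtain ⟨h1, h2⟩ := ih l' s t h.2
        refine ⟨?_, h2⟩
        have h3 := h.1
        cases a <;> cases b <;> simp [Letter.one, Letter.zero] at h3 <;> rw [h1]
  obtain ⟨h1, h2⟩ := key a.bits b.bits s t (by simpa [encodeNum] using h)
  refine ⟨?_, h2⟩
  have := congrArg (fun l => List.foldr Nat.bit 0 l) h1
  have hb : ∀ n : ℕ, n.bits.foldr Nat.bit 0 = n := by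
    intro n
    induction n using Nat.binaryRec' with
    | zero => simp
    | bit b n hn ih => rw [Nat.bits_append_bit n b hn, List.foldr_cons, ih]
  simpa [hb] using this

theorem encodeNum_head (a : ℕ) : ∃ (b : Letter) (l : List Letter), encodeNum a = b :: l ∧ b.val ≤ 2 := by
  unfold encodeNum
  cases a.bits with
  | nil => exact ⟨_, _, rfl, by decide⟩
  | cons b l => cases b <;> exact ⟨_, _, rfl, by decide⟩

theorem labels_append (l : List ℕ) : ∀ (l' : List ℕ) {s t : List Letter},
    l.flatMap encodeNum ++ Letter.endWorld :: s = l'.flatMap encodeNum ++ Letter.endWorld :: t →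
      l = l' ∧ s = t := by
  induction l with
  | nil =>
    intro l' s t h
    cases l' with
    | nil => simpa using h
    | cons a l' =>
      obtain ⟨b, l, hb, hl⟩ := encodeNum_head a
      simp only [List.flatMap_nil, List.flatMap_cons, hb, List.cons_append, List.nil_append,
        List.cons.injEq] at h
      rw [← h.1] at hl
      exact absurd hl (by decide)
  | cons a l ih =>
    intro l' s t h
    cases l' with
    | nil =>
      obtain ⟨b, l, hb, hl⟩ := encodeNum_head a
      simp only [List.flatMap_nil, List.flatMap_cons, hb, List.cons_append, List.nil_append,
        List.cons.injEq] at h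
      rw [h.1] at hl
      exact absurd hl (by decide)
    | cons a' l' =>
      simp only [List.flatMap_cons, List.append_assoc] at h
      obtain ⟨h1, h2⟩ := encodeNum_append h
      obtain ⟨h3, h4⟩ := ih l' h2
      exact ⟨by rw [h1, h3], h4⟩

theorem labels_head (l : List ℕ) (s : List Letter) : ∃ (b : Letter) (r : List Letter),
    l.flatMap encodeNum ++ Letter.endWorld :: s = b :: r ∧ b ≠ Letter.edge ∧ b ≠ Letter.noEdge := by
  cases l with
  | nil => exact ⟨_, _, rfl, by decide, by decide⟩
  | cons a l =>
    obtain ⟨b, r, hb, hl⟩ := encodeNum_head a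
    refine ⟨b, r ++ (l.flatMap encodeNum ++ Letter.endWorld :: s), by simp [hb], ?_, ?_⟩ <;>
      · rintro rfl
        exact absurd hl (by decide)

theorem row_append {b c : Letter} {s t : List Letter} (hb : b ≠ Letter.edge ∧ b ≠ Letter.noEdge)
    (hc : c ≠ Letter.edge ∧ c ≠ Letter.noEdge) (l : List Letter) :
    ∀ (l' : List Letter), (∀ a ∈ l, a = Letter.edge ∨ a = Letter.noEdge) →
      (∀ a ∈ l', a = Letter.edge ∨ a = Letter.noEdge) → l ++ b :: s = l' ++ c :: t →
      l = l' ∧ b :: s = c :: t := by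
  induction l with
  | nil =>
    intro l' _ h' h
    cases l' with
    | nil => exact ⟨rfl, h⟩
    | cons a l' =>
      simp only [List.nil_append, List.cons_append, List.cons.injEq] at h
      rcases h' a (by simp) with h'' | h''
      · exact absurd (h.1.trans h'') hb.1
      · exact absurd (h.1.trans h'') hb.2
  | cons a l ih =>
    intro l' h1 h2 h
    cases l' with
    | nil =>
      simp only [List.nil_append, List.cons_append, List.cons.injEq] at h
      rcases h1 a (by simp) with h'' | h''
      · exact absurd (h.1.symm.trans h'') hc.1
      · exact absurd (h.1.symm.trans h'') hc.2
    | cons a' l' =>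
      simp only [List.cons_append, List.cons.injEq] at h
      obtain ⟨h3, h4⟩ := ih l' (fun x hx => h1 x (by simp [hx])) (fun x hx => h2 x (by simp [hx])) h.2
      exact ⟨by rw [h.1, h3], h4⟩

theorem Letter.un_injective {Q Q' : PathQuant} {T T' : UnOp} (h : Letter.un Q T = Letter.un Q' T') :
    Q = Q' ∧ T = T' := by
  cases Q <;> cases Q' <;> cases T <;> cases T' <;> simp_all [Letter.un]

theorem Letter.bin_injective {Q Q' : PathQuant} {T T' : BinOp} (h : Letter.bin Q T = Letter.bin Q' T') :
    Q = Q' ∧ T = T' := by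
  cases Q <;> cases Q' <;> cases T <;> cases T' <;> simp_all [Letter.bin]

theorem Letter.un_val (Q : PathQuant) (T : UnOp) : 14 ≤ (Letter.un Q T).val ∧ (Letter.un Q T).val ≤ 19 := by
  cases Q <;> cases T <;> decide

theorem Letter.bin_val (Q : PathQuant) (T : BinOp) : 20 ≤ (Letter.bin Q T).val := by
  cases Q <;> cases T <;> decide

theorem CTL.encode_append (φ : CTL) : ∀ (ψ : CTL) {s t : List Letter},
    φ.encode ++ s = ψ.encode ++ t → φ = ψ ∧ s = t := by
  induction φ with
  | top =>
    intro ψ s t h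
    cases ψ
    case top => simpa [CTL.encode] using h
    case un Q T _ | bin Q T _ _ =>
      cases Q <;> cases T <;> simp [CTL.encode, Letter.top, Letter.un, Letter.bin] at h
    all_goals simp [CTL.encode, Letter.top, Letter.prop, Letter.neg, Letter.or, Letter.and] at h
  | prop p =>
    intro ψ s t h
    cases ψ
    case prop q =>
      simp only [CTL.encode, List.cons_append, List.cons.injEq, true_and] at h
      obtain ⟨rfl, h1⟩ := encodeNum_append h
      exact ⟨rfl, h1⟩
    case un Q T _ | bin Q T _ _ =>
      cases Q <;> cases T <;> simp [CTL.encode, Letter.prop, Letter.un, Letter.bin] at h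
    all_goals simp [CTL.encode, Letter.top, Letter.prop, Letter.neg, Letter.or, Letter.and] at h
  | neg φ ih =>
    intro ψ s t h
    cases ψ
    case neg ψ =>
      simp only [CTL.encode, List.cons_append, List.cons.injEq, true_and] at h
      obtain ⟨rfl, h1⟩ := ih _ h
      exact ⟨rfl, h1⟩
    case un Q T _ | bin Q T _ _ =>
      cases Q <;> cases T <;> simp [CTL.encode, Letter.neg, Letter.un, Letter.bin] at h
    all_goals simp [CTL.encode, Letter.top, Letter.prop, Letter.neg, Letter.or, Letter.and] at h
  | or φ₁ φ₂ ih₁ ih₂ =>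
    intro ψ s t h
    cases ψ
    case or ψ₁ ψ₂ =>
      simp only [CTL.encode, List.cons_append, List.append_assoc, List.cons.injEq, true_and] at h
      obtain ⟨rfl, h1⟩ := ih₁ _ h
      obtain ⟨rfl, h2⟩ := ih₂ _ h1
      exact ⟨rfl, h2⟩
    case un Q T _ | bin Q T _ _ =>
      cases Q <;> cases T <;> simp [CTL.encode, Letter.or, Letter.un, Letter.bin] at h
    all_goals simp [CTL.encode, Letter.top, Letter.prop, Letter.neg, Letter.or, Letter.and] at h
  | and φ₁ φ₂ ih₁ ih₂ =>
    intro ψ s t h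
    cases ψ
    case and ψ₁ ψ₂ =>
      simp only [CTL.encode, List.cons_append, List.append_assoc, List.cons.injEq, true_and] at h
      obtain ⟨rfl, h1⟩ := ih₁ _ h
      obtain ⟨rfl, h2⟩ := ih₂ _ h1
      exact ⟨rfl, h2⟩
    case un Q T _ | bin Q T _ _ =>
      cases Q <;> cases T <;> simp [CTL.encode, Letter.and, Letter.un, Letter.bin] at h
    all_goals simp [CTL.encode, Letter.top, Letter.prop, Letter.neg, Letter.or, Letter.and] at h
  | un Q T φ ih =>
    intro ψ s t h
    have hv := Letter.un_val Q T
    cases ψ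
    case un Q' T' ψ =>
      simp only [CTL.encode, List.cons_append, List.cons.injEq] at h
      obtain ⟨rfl, rfl⟩ := Letter.un_injective h.1
      obtain ⟨rfl, h1⟩ := ih _ h.2
      exact ⟨rfl, h1⟩
    case bin Q' T' _ _ =>
      have hv' := Letter.bin_val Q' T'
      simp only [CTL.encode, List.cons_append, List.cons.injEq] at h
      rw [h.1] at hv
      omega
    all_goals
      simp only [CTL.encode, List.cons_append, List.cons.injEq] at h
      rw [h.1] at hv
      exact absurd hv (by decide)
  | bin Q T φ₁ φ₂ ih₁ ih₂ =>
    intro ψ s t h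
    have hv := Letter.bin_val Q T
    cases ψ
    case bin Q' T' ψ₁ ψ₂ =>
      simp only [CTL.encode, List.cons_append, List.append_assoc, List.cons.injEq] at h
      obtain ⟨rfl, rfl⟩ := Letter.bin_injective h.1
      obtain ⟨rfl, h1⟩ := ih₁ _ h.2
      obtain ⟨rfl, h2⟩ := ih₂ _ h1
      exact ⟨rfl, h2⟩
    case un Q' T' _ =>
      have hv' := Letter.un_val Q' T'
      simp only [CTL.encode, List.cons_append, List.cons.injEq] at h
      rw [h.1] at hv
      omega
    all_goals
      simp only [CTL.encode, List.cons_append, List.cons.injEq] at h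
      rw [h.1] at hv
      exact absurd hv (by decide)

namespace Kripke

theorem row_sym {n : ℕ} (M : Kripke n) (w : Fin n) :
    ∀ a ∈ (List.finRange n).map (fun v => if (w, v) ∈ M.R then Letter.edge else Letter.noEdge),
      a = Letter.edge ∨ a = Letter.noEdge := by
  intro a ha
  obtain ⟨v, -, rfl⟩ := List.mem_map.1 ha
  split_ifs <;> simp

theorem encodeWorld_parts {n n' : ℕ} (M : Kripke n) (M' : Kripke n') (w : Fin n) (w' : Fin n')
    {s t : List Letter} (h : M.encodeWorld w ++ s = M'.encodeWorld w' ++ t) :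
    (if w = M.root then Letter.root else if w ∈ M.worlds then Letter.world else Letter.absent) =
        (if w' = M'.root then Letter.root else if w' ∈ M'.worlds then Letter.world else Letter.absent) ∧
      (List.finRange n).map (fun v => if (w, v) ∈ M.R then Letter.edge else Letter.noEdge) =
        (List.finRange n').map (fun v => if (w', v) ∈ M'.R then Letter.edge else Letter.noEdge) ∧
      M.η w = M'.η w' ∧ s = t := by
  simp only [encodeWorld, List.cons_append, List.append_assoc, List.cons.injEq,
    List.nil_append] at h
  obtain ⟨h0, h⟩ := h
  obtain ⟨b, r, hb, hb'⟩ := labels_head ((M.η w).sort (· ≤ ·)) s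
  obtain ⟨c, r', hc, hc'⟩ := labels_head ((M'.η w').sort (· ≤ ·)) t
  rw [hb, hc] at h
  obtain ⟨h1, h2⟩ := row_append hb' hc' _ _ (M.row_sym w) (M'.row_sym w') h
  rw [← hb, ← hc] at h2
  obtain ⟨h3, h4⟩ := labels_append _ _ h2
  refine ⟨h0, h1, ?_, h4⟩
  rw [← Finset.sort_toFinset (M.η w) (· ≤ ·), h3, Finset.sort_toFinset]

theorem encode_append {n n' : ℕ} (M : Kripke n) (M' : Kripke n') {s t : List Letter}
    (h : M.encode ++ s = M'.encode ++ t) :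
    (⟨n, M⟩ : (n : ℕ) × Kripke n) = ⟨n', M'⟩ ∧ s = t := by
  have hn : n = n' := by
    rcases n with _ | n
    · exact M.root.elim0
    rcases n' with _ | n'
    · exact M'.root.elim0
    unfold encode at h
    rw [List.finRange_succ, List.finRange_succ, List.flatMap_cons, List.flatMap_cons,
      List.append_assoc, List.append_assoc] at h
    simpa using congrArg List.length (encodeWorld_parts M M' 0 0 h).2.1
  subst hn
  have key : ∀ (l : List (Fin n)) {s t : List Letter},
      l.flatMap M.encodeWorld ++ s = l.flatMap M'.encodeWorld ++ t →
      (∀ w ∈ l, ((w = M.root ↔ w = M'.root) ∧ (w ∈ M.worlds ↔ w ∈ M'.worlds)) ∧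
        (∀ v, (w, v) ∈ M.R ↔ (w, v) ∈ M'.R) ∧ M.η w = M'.η w) ∧ s = t := by
    intro l
    induction l with
    | nil => intro s t h; simpa using h
    | cons w l ih =>
      intro s t h
      rw [List.flatMap_cons, List.flatMap_cons, List.append_assoc, List.append_assoc] at h
      obtain ⟨h1, h2, h3, h4⟩ := encodeWorld_parts M M' w w h
      obtain ⟨h5, h6⟩ := ih h4
      refine ⟨?_, h6⟩
      intro u hu
      rcases List.mem_cons.1 hu with rfl | hu
      · refine ⟨?_, ?_, h3⟩
        · have := M.root_mem
          have := M'.root_mem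
          by_cases hr : u = M.root <;> by_cases hr' : u = M'.root <;>
            by_cases hw : u ∈ M.worlds <;> by_cases hw' : u ∈ M'.worlds <;>
            simp [hr, hr', hw, hw', Letter.root, Letter.world, Letter.absent] at h1 ⊢ <;> simp_all
        · intro v
          have := (List.map_inj_left.1 h2) v (List.mem_finRange v)
          by_cases hv : (u, v) ∈ M.R <;> by_cases hv' : (u, v) ∈ M'.R <;>
            simp [hv, hv', Letter.edge, Letter.noEdge] at this ⊢
      · exact h5 u hu
  obtain ⟨h1, h2⟩ := key _ h
  refine ⟨?_, h2⟩
  have hM : M = M' := by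
    apply Kripke.ext
    · ext w; exact (h1 w (List.mem_finRange w)).1.2
    · ext ⟨w, v⟩; exact (h1 w (List.mem_finRange w)).2.1 v
    · funext w; exact (h1 w (List.mem_finRange w)).2.2
    · exact (h1 M.root (List.mem_finRange _)).1.1.1 rfl
  rw [hM]

end Kripke

theorem encodeInstance_injective {n n' : ℕ} {M : Kripke n} {M' : Kripke n'} {φ φ' : CTL}
    (h : encodeInstance M φ = encodeInstance M' φ') :
    (⟨n, M, φ⟩ : (n : ℕ) × Kripke n × CTL) = ⟨n', M', φ'⟩ := by
  obtain ⟨h1, h2⟩ := Kripke.encode_append M M' h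
  cases h1
  obtain ⟨rfl, -⟩ := CTL.encode_append φ φ' (s := []) (t := []) (by simpa using h2)
  rfl

/-! ### Enumeration problems -/

/-- An enumeration problem over the alphabet `Fin k`. -/
structure EnumProblem (k : ℕ) where
  /-- the instances -/
  I : Set (List (Fin k))
  /-- the solutions (only relevant for words in `I`) -/
  Sol : List (Fin k) → Set (List (Fin k))
  /-- solutions have polynomial size -/
  bound : ∃ p : Polynomial ℕ, ∀ x ∈ I, ∀ y ∈ Sol x, y.length ≤ p.eval x.length

theorem Kripke.IsSubmodel.length_encode_le {n : ℕ} {M' M : Kripke n} (h : M'.IsSubmodel M) :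
    M'.encode.length ≤ M.encode.length := by
  unfold Kripke.encode
  rw [List.length_flatMap, List.length_flatMap]
  apply List.sum_le_sum
  intro w _
  by_cases hw : w ∈ M'.worlds
  · simp [Kripke.encodeWorld, h.η_eq w hw]
  · simp [Kripke.encodeWorld, M'.η_off w hw]

/-- The problem E-Submodels: given a Kripke model `M` and a CTL formula `φ`, output all connected
submodels of `M` that satisfy `φ`. -/
def eSubmodels : EnumProblem 24 where
  I := {x | ∃ (n : ℕ) (M : Kripke n) (φ : CTL), x = encodeInstance M φ}
  Sol x := {y | ∃ (n : ℕ) (M : Kripke n) (φ : CTL), x = encodeInstance M φ ∧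
    ∃ M' : Kripke n, M'.IsConnectedSubmodel M ∧ M'.Models φ ∧ y = M'.encode}
  bound := by
    refine ⟨Polynomial.X, ?_⟩
    rintro x - y ⟨n, M, φ, rfl, M', h, -, rfl⟩
    have := h.toIsSubmodel.length_encode_le
    simp only [encodeInstance, List.length_append, Polynomial.eval_X]
    omega

theorem mem_eSubmodels_Sol {n : ℕ} {M : Kripke n} {φ : CTL} {y : List Letter} :
    y ∈ eSubmodels.Sol (encodeInstance M φ) ↔
      ∃ M' : Kripke n, M'.IsConnectedSubmodel M ∧ M'.Models φ ∧ y = M'.encode := by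
  constructor
  · rintro ⟨n', N, ψ, h, hy⟩
    cases encodeInstance_injective h
    exact hy
  · exact fun hy => ⟨n, M, φ, rfl, hy⟩

/-! ### Decision complexity classes -/

/-- A complexity class of decision problems: for each finite alphabet `Fin m`, a set of
languages. -/
abbrev DecisionClass : Type := (m : ℕ) → Set (Set (List (Fin m)))

/-- The word that presents an input and a certificate to a verifier. -/
def encodePair {m : ℕ} (a : List (Fin m) × List Bool) : List (Fin m ⊕ Bool) :=
  a.1.map Sum.inl ++ a.2.map Sum.inr

/-- The class NP: languages with certificates of polynomial length that are verified by a
(multi-stack) Turing machine in polynomial time. -/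
def NP : DecisionClass := fun m => {L |
  ∃ (V : List (Fin m) × List Bool → Bool) (q : Polynomial ℕ),
    Nonempty (Turing.TM2ComputableInPolyTime encodePair (fun b : Bool => [b]) V) ∧
    ∀ x, x ∈ L ↔ ∃ w : List Bool, w.length ≤ q.eval x.length ∧ V (x, w) = true}

/-! ### Random access machines with a decision oracle -/

namespace RAM

/-- Instructions. There are work registers `R 0, R 1, …`, read-only input registers
`In 0, In 1, …`, and write-only oracle registers `O 0, O 1, …`; all hold natural numbers. -/
inductive Instr
  /-- `R i ← c` -/
  | const (i c : ℕ)
  /-- `R i ← R j + R k` -/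
  | add (i j k : ℕ)
  /-- `R i ← R j - R k`, or `0` if this is negative -/
  | sub (i j k : ℕ)
  /-- `R i ← R (R j)` -/
  | load (i j : ℕ)
  /-- `R (R i) ← R j` -/
  | store (i j : ℕ)
  /-- `R i ← In (R j)` -/
  | read (i j : ℕ)
  /-- `O (R i) ← R j` -/
  | setOracle (i j : ℕ)
  /-- go to instruction `l` -/
  | jump (l : ℕ)
  /-- go to instruction `l` if `R i = 0` -/
  | jumpZero (i l : ℕ)
  /-- append the symbol held by `R i` to the word that is being printed -/
  | print (i : ℕ)
  /-- complete the printed word, which makes it the next output, and start a new one -/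
  | output
  /-- ask the oracle; go to instruction `l` if the answer is yes -/
  | query (l : ℕ)
  /-- stop -/
  | halt

/-- A program; the machine also stops when the program counter leaves the program. -/
abbrev Program : Type := List Instr

/-- Configurations. -/
structure Cfg where
  /-- program counter -/
  pc : ℕ
  /-- work registers -/
  reg : ℕ → ℕ
  /-- oracle registers -/
  orc : ℕ → ℕ
  /-- the part of the current output word printed so far -/
  out : List ℕ

/-- The initial configuration: all registers are empty. -/
def start : Cfg := ⟨0, fun _ => 0, fun _ => 0, []⟩

/-- Symbols in registers: the symbol `a` is held as `a + 1`, since `0` is the empty register. -/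
def code {k : ℕ} (x : List (Fin k)) : List ℕ := x.map (fun a => a.val + 1)

/-- The input registers for the input word `x`. -/
def input {k : ℕ} (x : List (Fin k)) (i : ℕ) : ℕ := (code x).getD i 0

/-- The registers `f 0, f 1, …`, up to the first empty one, hold the word `w`. -/
def HoldsWord {m : ℕ} (f : ℕ → ℕ) (w : List (Fin m)) : Prop :=
  ∀ i ≤ w.length, f i = (code w).getD i 0

section

variable {m : ℕ} (P : Program) (L : Set (List (Fin m))) (inp : ℕ → ℕ)

open Classical in
/-- The effect of one instruction, for the oracle language `L` and the input registers `inp`. -/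
noncomputable def exec (c : Cfg) : Instr → Option Cfg
  | .const i a => some { c with pc := c.pc + 1, reg := Function.update c.reg i a }
  | .add i j k =>
      some { c with pc := c.pc + 1, reg := Function.update c.reg i (c.reg j + c.reg k) }
  | .sub i j k =>
      some { c with pc := c.pc + 1, reg := Function.update c.reg i (c.reg j - c.reg k) }
  | .load i j =>
      some { c with pc := c.pc + 1, reg := Function.update c.reg i (c.reg (c.reg j)) }
  | .store i j =>
      some { c with pc := c.pc + 1, reg := Function.update c.reg (c.reg i) (c.reg j) }
  | .read i j =>
      some { c with pc := c.pc + 1, reg := Function.update c.reg i (inp (c.reg j)) }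
  | .setOracle i j =>
      some { c with pc := c.pc + 1, orc := Function.update c.orc (c.reg i) (c.reg j) }
  | .jump l => some { c with pc := l }
  | .jumpZero i l => some { c with pc := if c.reg i = 0 then l else c.pc + 1 }
  | .print i => some { c with pc := c.pc + 1, out := c.out ++ [c.reg i] }
  | .output => some { c with pc := c.pc + 1, out := [] }
  | .query l =>
      some { c with pc := if ∃ w ∈ L, HoldsWord c.orc w then l else c.pc + 1 }
  | .halt => none

/-- Logarithmic cost of an instruction: one plus the bit lengths of the numbers and addresses
that it handles. An oracle call costs one unit. -/
def instrCost (c : Cfg) : Instr → ℕ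
  | .const _ a => 1 + a.size
  | .add _ j k => 1 + (c.reg j).size + (c.reg k).size
  | .sub _ j k => 1 + (c.reg j).size + (c.reg k).size
  | .load _ j => 1 + (c.reg j).size + (c.reg (c.reg j)).size
  | .store i j => 1 + (c.reg i).size + (c.reg j).size
  | .read _ j => 1 + (c.reg j).size + (inp (c.reg j)).size
  | .setOracle i j => 1 + (c.reg i).size + (c.reg j).size
  | .jump _ => 1
  | .jumpZero i _ => 1 + (c.reg i).size
  | .print i => 1 + (c.reg i).size
  | .output => 1
  | .query _ => 1
  | .halt => 1

/-- One step; `none` if the machine has stopped. -/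
noncomputable def step (c : Cfg) : Option Cfg := P[c.pc]?.bind (exec L inp c)

/-- The cost of the next step. -/
def cost (c : Cfg) : ℕ := P[c.pc]?.elim 0 (instrCost inp c)

/-- `Silent P L inp c t c'`: the machine gets from `c` to `c'` in time `t` without completing
an output. -/
inductive Silent : Cfg → ℕ → Cfg → Prop
  | refl (c : Cfg) : Silent c 0 c
  | step {c c' c'' : Cfg} {t : ℕ} (h : P[c.pc]? ≠ some .output)
      (hs : step P L inp c = some c') (hr : Silent c' t c'') :
      Silent c (cost P inp c + t) c''

/-- `EnumDelay P L inp d c ys`: started in `c`, the machine outputs the words `ys`, in this order,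
and stops; the times before the first output, between consecutive outputs and after the last
output are all at most `d`. -/
inductive EnumDelay (d : ℕ) : Cfg → List (List ℕ) → Prop
  | finish {c c' : Cfg} {t : ℕ} (hr : Silent P L inp c t c') (hs : step P L inp c' = none)
      (ht : t ≤ d) : EnumDelay d c []
  | next {c c' c'' : Cfg} {t : ℕ} {ys : List (List ℕ)} (hr : Silent P L inp c t c')
      (ho : P[c'.pc]? = some .output) (hs : step P L inp c' = some c'')
      (ht : t + cost P inp c' ≤ d) (hy : EnumDelay d c'' ys) : EnumDelay d c (c'.out :: ys)

/-- Every oracle call in the run is about a word over the oracle alphabet of length at most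
`b`. -/
def OracleBounded (b : ℕ) : Prop :=
  ∀ c, Relation.ReflTransGen (fun c c' => step P L inp c = some c') start c →
    ∀ l, P[c.pc]? = some (.query l) → ∃ w : List (Fin m), w.length ≤ b ∧ HoldsWord c.orc w

end

end RAM

/-! ### Enumeration with a decision oracle -/

/-- The class `Del C`: some random access machine with an oracle in `C` outputs, on every
instance `x`, exactly the solutions of `x`, without duplicates, with delay `p |x|` and oracle calls
of size at most `p |x|`, for some polynomial `p`. -/
def Del (C : DecisionClass) (k : ℕ) : Set (EnumProblem k) := {E |
  ∃ (m : ℕ) (L : Set (List (Fin m))), L ∈ C m ∧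
  ∃ (P : RAM.Program) (p : Polynomial ℕ), ∀ x ∈ E.I,
    (∃ ys : List (List (Fin k)), ys.Nodup ∧ (∀ y, y ∈ ys ↔ y ∈ E.Sol x) ∧
      RAM.EnumDelay P L (RAM.input x) (p.eval x.length) RAM.start (ys.map RAM.code)) ∧
    RAM.OracleBounded P L (RAM.input x) (p.eval x.length)}

/-- The class `DelNP`. -/
def DelNP (k : ℕ) : Set (EnumProblem k) := Del NP k

/-! The enumeration is a backtracking search over yes/no decisions, one for each letter of the input
word, steered by an NP oracle that says whether a prefix of decisions can be completed to a
solution.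

Deciding `true` about a letter suppresses it: a world becomes a non-world, an edge a non-edge, any
other letter disappears. Most decisions are forced: labels vanish exactly when their world does, the
formula always vanishes, and all other letters that are neither worlds nor edges stay. The automaton
`emit` checks these local rules and also that a kept edge starts in a kept world. Whenever both
decisions about a letter are allowed, both print a letter and the two letters differ. Hence the
decisions can be recovered from the output (`scan_injective`), and enumerating decisions without
repetition enumerates solutions without repetition.

A query is the input word over an alphabet of 72 = 3 * 24 letters, each letter carrying the decision
`false`, `true` or "missing". The random access machine does a depth-first search in the binary tree
of prefixes. It enters only nodes that have a solution below them, so between two outputs it climbs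
at most `|x|` levels, descends at most `|x|` levels and prints one word. Moving along an edge of the
tree changes one letter of the query, hence one oracle register. All numbers stay linear in `|x|`,
which gives a polynomial delay (`enum_fill`, `enumDelay_of_query`).

For the oracle language, the missing decisions are guessed, the resulting word is written down, and
it is checked that this word describes a connected submodel satisfying the formula. The local rules
leave open whether edges end in kept worlds, whether the relation is total and whether every world
is reachable. One reachability computation settles all three: kept worlds must be reachable and have
a reachable successor, and removed worlds must not be reachable (`exists_submodel`,
`accepts_subData_iff`). Totality makes every finite path from the root extendable, so reachability
is the same as lying on an infinite path.

CTL is evaluated by fixed point iteration on vectors of truth values, with `n` rounds for `n` worlds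
(`Monotone.iterate_bot_fixed`, `until_apply_iff`). Release and globally are reduced to until by
duality (`release_apply`, `always_apply`). On stacks, one round is one pass over the adjacency
matrix in which the two ends of each edge exchange a bit (`runs_step`). A formula in prefix
notation, read backwards, is in postfix order, so a stack of vectors suffices (`rounds_evalBody`).

Membership in NP is proved for a small language of nondeterministic stack programs, compiled to
multi-stack Turing machines. The certificate is both the source of guesses and a clock: each loop
test and each guess consumes one bit, and the machine rejects when none is left. So every program
yields a verifier of linear running time, and only accepting runs need a polynomial bound
(`exists_steps`, `exec_mem_NP`). For soundness, parts without guesses have unique outcomes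
(`Exec.det`), so every accepting run passes through the states computed for the intended run. -/

set_option linter.unusedSimpArgs false

/-! ### Nondeterministic stack programs -/

/-- Nondeterministic programs that work on `r` stacks with symbols in `G`. -/
inductive StackProg (r : ℕ) (G : Type) : Type
  | skip
  | fail
  | push (k : Fin r) (g : G)
  /-- pop a symbol and branch -/
  | case (k : Fin r) (f : Option G → StackProg r G)
  | seq (p q : StackProg r G)
  /-- pop a symbol; end or run the body, and repeat -/
  | loop (k : Fin r) (ends : Option G → Bool) (body : Option G → StackProg r G)
  | guess (f : Bool → StackProg r G)

namespace StackProg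

open Function Turing

variable {r m : ℕ} {G : Type}

/-- `Exec p S t S'`: some run of `p` leads from `S` to `S'`, with `t` loop tests and guesses. -/
inductive Exec : StackProg r G → (Fin r → List G) → ℕ → (Fin r → List G) → Prop
  | skip (S) : Exec skip S 0 S
  | push (k g S) : Exec (push k g) S 0 (update S k (g :: S k))
  | case {k f S t S'} (h : Exec (f (S k).head?) (update S k (S k).tail) t S') :
      Exec (case k f) S t S'
  | seq {p q S t S' t' S''} (h : Exec p S t S') (h' : Exec q S' t' S'') :
      Exec (seq p q) S (t + t') S''
  | ends {k ends body S} (hs : ends (S k).head? = true) :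
      Exec (loop k ends body) S 1 (update S k (S k).tail)
  | step {k ends body S t S' t' S''} (hs : ends (S k).head? = false)
      (h : Exec (body (S k).head?) (update S k (S k).tail) t S')
      (h' : Exec (loop k ends body) S' t' S'') : Exec (loop k ends body) S (1 + t + t') S''
  | guess {f S t S'} (b : Bool) (h : Exec (f b) S t S') : Exec (guess f) S (t + 1) S'

/-! #### Compilation to multi-stack Turing machines -/

/-- The labels of the compiled program. -/
def Label : StackProg r G → Type
  | skip => Unit
  | fail => Unit
  | push _ _ => Unit
  | case _ f => Option (Σ o, Label (f o))
  | seq p q => Label p ⊕ Label q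
  | loop _ _ body => Option (Σ o, Label (body o))
  | guess f => Option (Σ b, Label (f b))

@[reducible]
noncomputable def fintypeLabel [Fintype G] : ∀ p : StackProg r G, Fintype (Label p)
  | skip => inferInstanceAs (Fintype Unit)
  | fail => inferInstanceAs (Fintype Unit)
  | push _ _ => inferInstanceAs (Fintype Unit)
  | case _ f =>
    have := fun o => fintypeLabel (f o)
    inferInstanceAs (Fintype (Option (Σ o, Label (f o))))
  | seq p q =>
    have := fintypeLabel p
    have := fintypeLabel q
    inferInstanceAs (Fintype (Label p ⊕ Label q))
  | loop _ _ body =>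
    have := fun o => fintypeLabel (body o)
    inferInstanceAs (Fintype (Option (Σ o, Label (body o))))
  | guess f =>
    have := fun b => fintypeLabel (f b)
    inferInstanceAs (Fintype (Option (Σ b, Label (f b))))

def entry : ∀ p : StackProg r G, Label p
  | skip => ()
  | fail => ()
  | push _ _ => ()
  | case _ _ => none
  | seq p _ => Sum.inl (entry p)
  | loop _ _ _ => none
  | guess _ => none

/-- The stacks of the machine: the input stack, the output stack, and the config of the
program. -/
abbrev Stk (m r : ℕ) (G : Type) : Option (Option (Fin r)) → Type
  | none => Fin m ⊕ Bool
  | some none => Bool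
  | some (some _) => G

/-- The machine remembers the last symbols popped from a program stack and from the input
stack. -/
abbrev Var (m : ℕ) (G : Type) : Type := Option G × Option (Fin m ⊕ Bool)

def isTick : Option (Fin m ⊕ Bool) → Option Bool
  | some (Sum.inr b) => some b
  | _ => none

/-- The statements of the compiled program. The input stack holds the certificate, which serves
as a clock and as the source of guesses; if it is exhausted, the program is aborted. -/
def compile {Λ : Type} : ∀ (p : StackProg r G), (Label p → Λ) → Λ → Λ → Label p →
    TM2.Stmt (Stk m r G) Λ (Var m G)
  | skip, _, ex, _, _ => .goto fun _ => ex
  | fail, _, _, ab, _ => .goto fun _ => ab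
  | push k g, _, ex, _, _ => .push (some (some k)) (fun _ => g) (.goto fun _ => ex)
  | case k f, ι, ex, ab, l =>
    match l with
    | none => .pop (some (some k)) (fun v o => (o, v.2))
        (.goto fun v => ι (some ⟨v.1, entry (f v.1)⟩))
    | some ⟨o, l⟩ => compile (f o) (fun l => ι (some ⟨o, l⟩)) ex ab l
  | seq p q, ι, ex, ab, l =>
    match l with
    | Sum.inl l => compile p (fun l => ι (Sum.inl l)) (ι (Sum.inr (entry q))) ab l
    | Sum.inr l => compile q (fun l => ι (Sum.inr l)) ex ab l
  | loop k ends body, ι, ex, ab, l =>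
    match l with
    -- The clock bit is popped before the test, so every round of a loop is paid for by the
    -- certificate; an exhausted clock leads to `ab`.
    | none => .pop none (fun v o => (v.1, o)) (.pop (some (some k)) (fun v o => (o, v.2))
        (.goto fun v => (isTick v.2).elim ab fun _ =>
          bif ends v.1 then ex else ι (some ⟨v.1, entry (body v.1)⟩)))
    | some ⟨o, l⟩ => compile (body o) (fun l => ι (some ⟨o, l⟩)) (ι none) ab l
  | guess f, ι, ex, ab, l =>
    match l with
    | none => .pop none (fun v o => (v.1, o))
        (.goto fun v => (isTick v.2).elim ab fun b => ι (some ⟨b, entry (f b)⟩))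
    | some ⟨o, l⟩ => compile (f o) (fun l => ι (some ⟨o, l⟩)) ex ab l

theorem compile_case {Λ : Type} (k f ex ab) (ι : Label (case k f) → Λ) :
    compile (m := m) (G := G) (r := r) (case k f) ι ex ab (entry (case k f)) =
      .pop (some (some k)) (fun v o => (o, v.2))
        (.goto fun v => ι (some ⟨v.1, entry (f v.1)⟩)) := rfl

theorem compile_loop {Λ : Type} (k ends body ex ab) (ι : Label (loop k ends body) → Λ) :
    compile (m := m) (G := G) (r := r) (loop k ends body) ι ex ab (entry (loop k ends body)) =
      .pop none (fun v o => (v.1, o)) (.pop (some (some k)) (fun v o => (o, v.2))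
        (.goto fun v => (isTick v.2).elim ab fun _ =>
          bif ends v.1 then ex else ι (some ⟨v.1, entry (body v.1)⟩))) := rfl

theorem compile_guess {Λ : Type} (f ex ab) (ι : Label (guess f) → Λ) :
    compile (m := m) (G := G) (r := r) (guess f) ι ex ab (entry (guess f)) =
      .pop none (fun v o => (v.1, o))
        (.goto fun v => (isTick v.2).elim ab fun b => ι (some ⟨b, entry (f b)⟩)) := rfl

/-- The input stack of the machine with certificate `w`. -/
def certificate (m r : ℕ) (G : Type) (w : List Bool) : List (Stk m r G none) := w.map Sum.inr

/-- The stacks of the machine with certificate `w` and program stacks `S`. -/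
def config (w : List Bool) (S : Fin r → List G) : ∀ k, List (Stk m r G k)
  | none => certificate m r G w
  | some none => []
  | some (some k) => S k

@[simp] theorem config_none (w : List Bool) (S : Fin r → List G) :
    config (m := m) w S none = certificate m r G w := rfl

@[simp] theorem config_some (w : List Bool) (S : Fin r → List G) (k : Fin r) :
    config (m := m) w S (some (some k)) = S k := rfl

@[simp] theorem update_config_none (w w' : List Bool) (S : Fin r → List G) :
    update (config w S) none (certificate m r G w') = config w' S := by
  funext k
  rcases k with _ | _ | k <;> simp [config, update]

@[simp] theorem update_config_some (w : List Bool) (S : Fin r → List G) (k : Fin r) (l : List G) :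
    update (config (m := m) w S) (some (some k)) l = config w (update S k l) := by
  funext j
  rcases j with _ | _ | j
  · simp [config, update]
  · simp [config, update]
  · by_cases h : j = k
    · subst h; simp [config]
    · simp [config, update, h]

/-- `n` steps lead from `c` to `c'`. -/
def Steps {α : Type*} (f : α → Option α) (n : ℕ) (c c' : α) : Prop :=
  (flip bind f)^[n] (some c) = some c'

theorem Steps.refl {α : Type*} {f : α → Option α} (c : α) : Steps f 0 c c := rfl

theorem Steps.trans {α : Type*} {f : α → Option α} {n n' : ℕ} {a b c : α} (h : Steps f n a b)
    (h' : Steps f n' b c) : Steps f (n + n') a c := by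
  unfold Steps at *
  rw [add_comm, Function.iterate_add_apply, h, h']

theorem Steps.one {α : Type*} {f : α → Option α} {a b : α} (h : f a = some b) :
    Steps f 1 a b := h

theorem Steps.one_iff {α : Type*} {f : α → Option α} {a b : α} :
    Steps f 1 a b ↔ f a = some b := Iff.rfl

/-- A halted configuration has no successor, so of two halting runs from one configuration neither
can be longer. This is how the answer of the machine is read off from any run that is exhibited. -/
theorem Steps.unique {α : Type*} {f : α → Option α} {n n' : ℕ} {a b c : α} (h : Steps f n a b)
    (h' : Steps f n' a c) (hb : f b = none) (hc : f c = none) : b = c := by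
  have aux : ∀ n (c : Option α), c.bind f = none → (flip bind f)^[n + 1] c = none := by
    intro n
    induction n with
    | zero => intro c hc; exact hc
    | succ n ih =>
      intro c hc
      rw [Function.iterate_succ_apply]
      apply ih
      change ((c.bind f).bind f) = none
      rw [hc]; rfl
  rcases lt_trichotomy n n' with hn | hn | hn
  · obtain ⟨k, rfl⟩ := Nat.exists_eq_add_of_lt hn
    unfold Steps at h h'
    rw [add_assoc, add_comm, Function.iterate_add_apply, h, aux k (some b) hb] at h'
    cases h'
  · subst hn
    exact Option.some.inj (h.symm.trans h')
  · obtain ⟨k, rfl⟩ := Nat.exists_eq_add_of_lt hn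
    unfold Steps at h h'
    rw [add_assoc, add_comm, Function.iterate_add_apply, h', aux k (some c) hc] at h
    cases h

/-! ### Correctness and running time of compiled programs -/

section Correct

variable {Λ : Type} (M : Λ → TM2.Stmt (Stk m r G) Λ (Var m G))

theorem step_case {k : Fin r} {f : Option G → StackProg r G} {ι : Label (case k f) → Λ} {ex ab : Λ}
    (hM : ∀ l, M (ι l) = compile (case k f) ι ex ab l) (w S v) :
    TM2.step M ⟨some (ι (entry (case k f))), v, config w S⟩ =
      some ⟨some (ι (some ⟨(S k).head?, entry _⟩)), ((S k).head?, v.2),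
        config w (update S k (S k).tail)⟩ := by
  simp [TM2.step, hM, compile_case]

theorem step_loop_cons {k : Fin r} {ends : Option G → Bool} {body : Option G → StackProg r G}
    {ι : Label (loop k ends body) → Λ} {ex ab : Λ}
    (hM : ∀ l, M (ι l) = compile (loop k ends body) ι ex ab l) (b w S v) :
    TM2.step M ⟨some (ι (entry (loop k ends body))), v, config (b :: w) S⟩ =
      some ⟨some (bif ends (S k).head? then ex else ι (some ⟨(S k).head?, entry _⟩)),
        ((S k).head?, some (Sum.inr b)), config w (update S k (S k).tail)⟩ := by
  rw [TM2.step, hM, compile_loop, ← update_config_some, ← update_config_none (b :: w) w S]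
  rfl

theorem step_loop_nil {k : Fin r} {ends : Option G → Bool} {body : Option G → StackProg r G}
    {ι : Label (loop k ends body) → Λ} {ex ab : Λ}
    (hM : ∀ l, M (ι l) = compile (loop k ends body) ι ex ab l) (S v) :
    TM2.step M ⟨some (ι (entry (loop k ends body))), v, config [] S⟩ =
      some ⟨some ab, ((S k).head?, none), config [] (update S k (S k).tail)⟩ := by
  rw [TM2.step, hM, compile_loop, ← update_config_some]
  conv_rhs => rw [← update_config_none [] [] S]
  rfl

theorem step_guess_cons {f : Bool → StackProg r G} {ι : Label (guess f) → Λ} {ex ab : Λ}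
    (hM : ∀ l, M (ι l) = compile (guess f) ι ex ab l) (b w S v) :
    TM2.step M ⟨some (ι (entry (guess f))), v, config (b :: w) S⟩ =
      some ⟨some (ι (some ⟨b, entry _⟩)), (v.1, some (Sum.inr b)), config w S⟩ := by
  rw [TM2.step, hM, compile_guess, ← update_config_none (b :: w) w S]
  rfl

theorem step_guess_nil {f : Bool → StackProg r G} {ι : Label (guess f) → Λ} {ex ab : Λ}
    (hM : ∀ l, M (ι l) = compile (guess f) ι ex ab l) (S v) :
    TM2.step M ⟨some (ι (entry (guess f))), v, config [] S⟩ =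
      some ⟨some ab, (v.1, none), config [] S⟩ := by
  rw [TM2.step, hM, compile_guess]
  conv_rhs => rw [← update_config_none [] [] S]
  rfl

/-- The certificate lists the guessed bits in order, with an arbitrary bit `true` for each loop
test. It is consumed exactly, and whatever follows it is left untouched, so certificates of
consecutive parts can be concatenated. -/
theorem Exec.steps {p : StackProg r G} {S S' : Fin r → List G} {t : ℕ} (h : Exec p S t S') :
    ∀ (ι : Label p → Λ) (ex ab : Λ), (∀ l, M (ι l) = compile p ι ex ab l) →
    ∃ w : List Bool, w.length = t ∧ ∀ w' v, ∃ v' n,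
      Steps (TM2.step M) n ⟨some (ι (entry p)), v, config (w ++ w') S⟩
        ⟨some ex, v', config w' S'⟩ := by
  induction h with
  | skip S =>
    intro ι ex ab hM
    refine ⟨[], rfl, fun w' v => ⟨v, 1, ?_⟩⟩
    simp [Steps.one_iff, TM2.step, hM, compile]
  | push k g S =>
    intro ι ex ab hM
    refine ⟨[], rfl, fun w' v => ⟨v, 1, ?_⟩⟩
    simp [Steps.one_iff, TM2.step, hM, compile]
  | @case k f S t S' h ih =>
    intro ι ex ab hM
    obtain ⟨w, hw, hs⟩ := ih (fun l => ι (some ⟨_, l⟩)) ex ab (fun l => hM _)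
    refine ⟨w, hw, fun w' v => ?_⟩
    obtain ⟨v', n, hn⟩ := hs w' ((S k).head?, v.2)
    refine ⟨v', 1 + n, Steps.trans (Steps.one ?_) hn⟩
    simp [Steps.one_iff, step_case M hM]
  | seq h h' ih ih' =>
    intro ι ex ab hM
    obtain ⟨w, hw, hs⟩ := ih (fun l => ι (Sum.inl l)) _ ab (fun l => hM _)
    obtain ⟨w₂, hw₂, hs₂⟩ := ih' (fun l => ι (Sum.inr l)) ex ab (fun l => hM _)
    refine ⟨w ++ w₂, by simp [hw, hw₂], fun w' v => ?_⟩
    obtain ⟨v', n, hn⟩ := hs (w₂ ++ w') v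
    obtain ⟨v'', n', hn'⟩ := hs₂ w' v'
    rw [List.append_assoc]
    exact ⟨v'', n + n', hn.trans hn'⟩
  | @ends k ends body S hs =>
    intro ι ex ab hM
    refine ⟨[true], rfl, fun w' v => ⟨((S k).head?, some (Sum.inr true)), 1, ?_⟩⟩
    simp [Steps.one_iff, step_loop_cons M hM, hs]
  | @step k ends body S t S' t' S'' hs h h' ih ih' =>
    intro ι ex ab hM
    obtain ⟨w, hw, hr⟩ := ih (fun l => ι (some ⟨_, l⟩)) (ι none) ab (fun l => hM _)
    obtain ⟨w₂, hw₂, hr₂⟩ := ih' ι ex ab hM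
    refine ⟨true :: (w ++ w₂), by simp [hw, hw₂]; ring, fun w' v => ?_⟩
    obtain ⟨v', n, hn⟩ := hr (w₂ ++ w') ((S k).head?, some (Sum.inr true))
    obtain ⟨v'', n', hn'⟩ := hr₂ w' v'
    refine ⟨v'', 1 + n + n', (Steps.trans (Steps.one ?_) hn).trans hn'⟩
    simp [Steps.one_iff, step_loop_cons M hM, hs]
  | @guess f S t S' b h ih =>
    intro ι ex ab hM
    obtain ⟨w, hw, hr⟩ := ih (fun l => ι (some ⟨_, l⟩)) ex ab (fun l => hM _)
    refine ⟨b :: w, by simp [hw], fun w' v => ?_⟩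
    obtain ⟨v', n, hn⟩ := hr w' (v.1, some (Sum.inr b))
    refine ⟨v', 1 + n, Steps.trans (Steps.one ?_) hn⟩
    simp [Steps.one_iff, step_guess_cons M hM]

/-- Between two ticks a compiled program makes boundedly many steps. With any certificate it
therefore leaves through `ex`, having followed a run of the program, or through `ab`, in time linear
in the ticks used or available. This needs no knowledge about the termination of the program. -/
theorem exists_steps [Fintype G] (p : StackProg r G) : ∀ (ι : Label p → Λ) (ex ab : Λ),
    (∀ l, M (ι l) = compile p ι ex ab l) → ∃ C : ℕ, ∀ w S v,
    (∃ S' v' w' t n, t + w'.length = w.length ∧ Exec p S t S' ∧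
      Steps (TM2.step M) n ⟨some (ι (entry p)), v, config w S⟩ ⟨some ex, v', config w' S'⟩ ∧
      n ≤ C * (t + 1)) ∨
    (∃ S' v' w' n, w'.length ≤ w.length ∧
      Steps (TM2.step M) n ⟨some (ι (entry p)), v, config w S⟩ ⟨some ab, v', config w' S'⟩ ∧
      n ≤ C * (w.length + 1)) := by
  induction p with
  | skip =>
    intro ι ex ab hM
    refine ⟨1, fun w S v => Or.inl ⟨S, v, w, 0, 1, by simp, .skip S, ?_, by simp⟩⟩
    simp [Steps.one_iff, TM2.step, hM, compile]
  | fail =>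
    intro ι ex ab hM
    refine ⟨1, fun w S v => Or.inr ⟨S, v, w, 1, le_rfl, ?_, by simp⟩⟩
    simp [Steps.one_iff, TM2.step, hM, compile]
  | push k g =>
    intro ι ex ab hM
    refine ⟨1, fun w S v => Or.inl ⟨_, v, w, 0, 1, by simp, .push k g S, ?_, by simp⟩⟩
    simp [Steps.one_iff, TM2.step, hM, compile]
  | case k f ih =>
    intro ι ex ab hM
    choose C hC using fun o => ih o (fun l => ι (some ⟨o, l⟩)) ex ab (fun l => hM _)
    -- The alphabet is finite, so the sum dominates the constant of whichever branch is taken; the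
    -- extra one pays for the pop.
    refine ⟨(∑ o, C o) + 1, fun w S v => ?_⟩
    have hle : C (S k).head? ≤ ∑ o, C o := Finset.single_le_sum (by simp) (Finset.mem_univ _)
    have h1 : Steps (TM2.step M) 1 ⟨some (ι (entry (case k f))), v, config w S⟩
        ⟨some (ι (some ⟨(S k).head?, entry _⟩)), ((S k).head?, v.2),
          config w (update S k (S k).tail)⟩ := by
      simp [Steps.one_iff, step_case M hM]
    rcases hC (S k).head? w (update S k (S k).tail) ((S k).head?, v.2) with
      ⟨S', v', w', t, n, hw, he, hs, hn⟩ | ⟨S', v', w', n, hw, hs, hn⟩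
    · exact Or.inl ⟨S', v', w', t, 1 + n, hw, .case he, h1.trans hs, by nlinarith⟩
    · exact Or.inr ⟨S', v', w', 1 + n, hw, h1.trans hs, by nlinarith⟩
  | seq p q ihp ihq =>
    intro ι ex ab hM
    obtain ⟨C, hC⟩ := ihp (fun l => ι (Sum.inl l)) _ ab (fun l => hM _)
    obtain ⟨C', hC'⟩ := ihq (fun l => ι (Sum.inr l)) ex ab (fun l => hM _)
    refine ⟨C + C', fun w S v => ?_⟩
    rcases hC w S v with ⟨S', v', w', t, n, hw, he, hs, hn⟩ | ⟨S', v', w', n, hw, hs, hn⟩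
    · rcases hC' w' S' v' with
        ⟨S₂, v₂, w₂, t₂, n₂, hw₂, he₂, hs₂, hn₂⟩ | ⟨S₂, v₂, w₂, n₂, hw₂, hs₂, hn₂⟩
      · exact Or.inl ⟨S₂, v₂, w₂, t + t₂, n + n₂, by omega, .seq he he₂, hs.trans hs₂,
          by nlinarith⟩
      · refine Or.inr ⟨S₂, v₂, w₂, n + n₂, by omega, hs.trans hs₂, ?_⟩
        rw [← hw]
        nlinarith
    · exact Or.inr ⟨S', v', w', n, hw, hs, by nlinarith⟩
  | loop k ends body ih =>
    intro ι ex ab hM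
    choose C hC using fun o => ih o (fun l => ι (some ⟨o, l⟩)) (ι none) ab (fun l => hM _)
    refine ⟨(∑ o, C o) + 1, fun w => ?_⟩
    -- Each round consumes at least one clock bit, so the next round starts with a shorter
    -- certificate.
    induction hN : w.length using Nat.strong_induction_on generalizing w with
    | _ N ihN =>
    subst hN
    intro S v
    rcases w with _ | ⟨b, w⟩
    · refine Or.inr ⟨update S k (S k).tail, ((S k).head?, none), [], 1, by simp, ?_, by simp⟩
      simp [Steps.one_iff, step_loop_nil M hM]
    have hle : C (S k).head? ≤ ∑ o, C o := Finset.single_le_sum (by simp) (Finset.mem_univ _)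
    by_cases hst : ends (S k).head? = true
    · refine Or.inl ⟨update S k (S k).tail, ((S k).head?, some (Sum.inr b)), w, 1, 1, by simp; ring,
        .ends hst, ?_, by omega⟩
      simp [Steps.one_iff, step_loop_cons M hM, hst]
    simp only [Bool.not_eq_true] at hst
    have h1 : Steps (TM2.step M) 1 ⟨some (ι (entry (loop k ends body))), v, config (b :: w) S⟩
        ⟨some (ι (some ⟨(S k).head?, entry _⟩)), ((S k).head?, some (Sum.inr b)),
          config w (update S k (S k).tail)⟩ := by
      simp [Steps.one_iff, step_loop_cons M hM, hst]
    rcases hC (S k).head? w (update S k (S k).tail) ((S k).head?, some (Sum.inr b)) with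
      ⟨S', v', w', t, n, hw, he, hs, hn⟩ | ⟨S', v', w', n, hw, hs, hn⟩
    · rcases ihN w'.length (by simp; omega) w' rfl S' v' with
        ⟨S₂, v₂, w₂, t₂, n₂, hw₂, he₂, hs₂, hn₂⟩ | ⟨S₂, v₂, w₂, n₂, hw₂, hs₂, hn₂⟩
      · refine Or.inl ⟨S₂, v₂, w₂, 1 + t + t₂, 1 + n + n₂, by simp; omega, .step hst he he₂,
          (h1.trans hs).trans hs₂, ?_⟩
        nlinarith
      · refine Or.inr ⟨S₂, v₂, w₂, 1 + n + n₂, by simp; omega, (h1.trans hs).trans hs₂, ?_⟩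
        rw [List.length_cons, ← hw]
        nlinarith
    · refine Or.inr ⟨S', v', w', 1 + n, by simp; omega, h1.trans hs, ?_⟩
      rw [List.length_cons]
      nlinarith
  | guess f ih =>
    intro ι ex ab hM
    choose C hC using fun o => ih o (fun l => ι (some ⟨o, l⟩)) ex ab (fun l => hM _)
    refine ⟨(∑ o, C o) + 1, fun w S v => ?_⟩
    rcases w with _ | ⟨b, w⟩
    · refine Or.inr ⟨S, (v.1, none), [], 1, by simp, ?_, by simp⟩
      simp [Steps.one_iff, step_guess_nil M hM]
    have hle : C b ≤ ∑ o, C o := Finset.single_le_sum (by simp) (Finset.mem_univ _)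
    have h1 : Steps (TM2.step M) 1 ⟨some (ι (entry (guess f))), v, config (b :: w) S⟩
        ⟨some (ι (some ⟨b, entry _⟩)), (v.1, some (Sum.inr b)), config w S⟩ := by
      simp [Steps.one_iff, step_guess_cons M hM]
    rcases hC b w S (v.1, some (Sum.inr b)) with
      ⟨S', v', w', t, n, hw, he, hs, hn⟩ | ⟨S', v', w', n, hw, hs, hn⟩
    · exact Or.inl ⟨S', v', w', t + 1, 1 + n, by simp; omega, .guess b he, h1.trans hs,
        by nlinarith⟩
    · exact Or.inr ⟨S', v', w', 1 + n, by simp; omega, h1.trans hs,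
        by rw [List.length_cons]; nlinarith⟩

end Correct

end StackProg

/-! ### The complete machine: reading the input, running the program, cleaning up -/

namespace StackProg

open Function Turing

variable {r m : ℕ} {G : Type}

/-- The number of symbols that a statement pushes. -/
def pushes {K : Type} {Γ : K → Type} {Λ σ : Type} : TM2.Stmt Γ Λ σ → ℕ
  | .push _ _ q => pushes q + 1
  | .peek _ _ q => pushes q
  | .pop _ _ q => pushes q
  | .load _ q => pushes q
  | .branch _ q q' => pushes q + pushes q'
  | .goto _ => 0
  | .halt => 0

theorem length_stepAux_le {K : Type} [DecidableEq K] {Γ : K → Type} {Λ σ : Type}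
    (q : TM2.Stmt Γ Λ σ) (v : σ) (S : ∀ k, List (Γ k)) (k : K) :
    ((TM2.stepAux q v S).stk k).length ≤ (S k).length + pushes q := by
  induction q generalizing v S with
  | push j f q ih =>
    refine (ih _ _).trans ?_
    by_cases h : k = j
    · subst h; simp [pushes]; omega
    · simp [pushes, h]; try omega
  | peek j f q ih => exact ih _ _
  | pop j f q ih =>
    refine (ih _ _).trans ?_
    by_cases h : k = j
    · subst h; simp [pushes]
    · simp [pushes, h]
  | load f q ih => exact ih _ _
  | branch f q q' ih ih' =>
    have := ih v S
    have := ih' v S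
    simp only [TM2.stepAux, pushes]
    cases f v <;> simp <;> omega
  | goto f => simp [pushes]
  | halt => simp [pushes]

/-- A step pushes at most as many symbols as its statement contains, and there are finitely many
statements. The resulting bound on stack heights limits the time for cleaning up. -/
theorem Steps.length_le {K : Type} [DecidableEq K] {Γ : K → Type} {Λ σ : Type} [Fintype Λ]
    {M : Λ → TM2.Stmt Γ Λ σ} {n : ℕ} {c c' : TM2.Cfg Γ Λ σ} (h : Steps (TM2.step M) n c c') (k : K) :
    (c'.stk k).length ≤ (c.stk k).length + n * ∑ l, pushes (M l) := by
  induction n generalizing c with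
  | zero =>
    cases Option.some.inj h
    simp
  | succ n ih =>
    unfold Steps at h
    rw [Function.iterate_succ_apply] at h
    obtain ⟨l, v, S⟩ := c
    rcases l with _ | l
    · have aux : ∀ n, (flip bind (TM2.step M))^[n] none = none := fun n =>
        Function.iterate_fixed rfl n
      exact absurd ((aux n).symm.trans h) (by simp)
    · have h1 := ih (c := TM2.stepAux (M l) v S) h
      have h2 := length_stepAux_le (M l) v S k
      have h3 : pushes (M l) ≤ ∑ l, pushes (M l) :=
        Finset.single_le_sum (f := fun l => pushes (M l)) (by simp) (Finset.mem_univ _)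
      simp only [add_mul, one_mul]
      omega

/-- The stacks of the machine with input stack `u`, output stack `o` and program stacks `S`. -/
def config' (u : List (Fin m ⊕ Bool)) (o : List Bool) (S : Fin r → List G) :
    ∀ k, List (Stk m r G k)
  | none => u
  | some none => o
  | some (some k) => S k

/-- The labels of the machine that runs the program `p`. -/
abbrev MLabel (p : StackProg r G) : Type := Option (Label p ⊕ Bool × Fin (r + 1))

/-- Empty all stacks and put the answer on the output stack. -/
def clean (p : StackProg r G) (b : Bool) (i : Fin (r + 1)) :
    TM2.Stmt (Stk m r G) (MLabel p) (Var m G) :=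
  Fin.cases
    (.pop none (fun v o => (v.1, o)) (.branch (fun v => v.2.isSome)
      (.goto fun _ => some (Sum.inr (b, 0)))
      -- The halting configuration `haltList` requires the initial internal state and no content
      -- outside the output stack.
      (.load (fun _ => (none, none)) (.push (some none) (fun _ => b) .halt))))
    (fun i => .pop (some (some i)) (fun v o => (o, v.2))
      (.goto fun v => some (Sum.inr (b, bif v.1.isSome then i.succ else i.castSucc)))) i

/-- The symbol that represents a letter of the input. -/
def inSymbol [Inhabited G] (g : Fin m → G) : Option (Fin m ⊕ Bool) → G
  | some (Sum.inl a) => g a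
  | _ => default

def isLetter : Option (Fin m ⊕ Bool) → Bool
  | some (Sum.inl _) => true
  | _ => false

/-- The machine: move the input word to the stack `a`, run the program, clean up. -/
def machine [Inhabited G] (p : StackProg r G) (a : Fin r) (g : Fin m → G) :
    MLabel p → TM2.Stmt (Stk m r G) (MLabel p) (Var m G)
  | none => .pop none (fun v o => (v.1, o)) (.branch (fun v => isLetter v.2)
      (.push (some (some a)) (fun v => inSymbol g v.2) (.goto fun _ => none))
      -- The end of the input word is noticed by popping the first certificate bit, which is thereby
      -- lost for the program; an empty certificate is rejected.
      (.goto fun v => (isTick v.2).elim (some (Sum.inr (false, Fin.last r)))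
        fun _ => some (Sum.inl (entry p))))
  | some (Sum.inl l) => compile p (fun l => some (Sum.inl l)) (some (Sum.inr (true, Fin.last r)))
      (some (Sum.inr (false, Fin.last r))) l
  | some (Sum.inr (b, i)) => clean p b i

section

variable [Inhabited G] (p : StackProg r G) (a : Fin r) (g : Fin m → G)

theorem steps_clean_zero (b : Bool) (u : List (Fin m ⊕ Bool)) (v : Var m G) :
    Steps (TM2.step (machine p a g)) (u.length + 1)
      ⟨some (some (Sum.inr (b, 0))), v, config' u [] (fun _ => [])⟩
      ⟨none, (none, none), config' [] [b] (fun _ => [])⟩ := by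
  induction u generalizing v with
  | nil =>
    refine Steps.one (congrArg some ?_)
    refine congrArg (TM2.Cfg.mk none (none, none)) ?_
    funext k
    rcases k with _ | _ | k <;> rfl
  | cons s u ih =>
    rw [List.length_cons, add_comm (u.length + 1) 1]
    refine Steps.trans (Steps.one ?_) (ih (v.1, some s))
    refine congrArg some (congrArg (TM2.Cfg.mk _ _) ?_)
    funext k
    rcases k with _ | _ | k <;> rfl

theorem steps_clean_pop (b : Bool) (i : Fin r) (u : List (Fin m ⊕ Bool)) (s : G) (l : List G)
    (S : Fin r → List G) (hS : S i = s :: l) (v : Var m G) :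
    Steps (TM2.step (machine p a g)) 1 ⟨some (some (Sum.inr (b, i.succ))), v, config' u [] S⟩
      ⟨some (some (Sum.inr (b, i.succ))), (some s, v.2), config' u [] (update S i l)⟩ := by
  refine Steps.one ?_
  simp only [TM2.step, machine, clean, Fin.cases_succ, TM2.stepAux]
  have h : (config' (m := m) u [] S (some (some i)) : List G) = s :: l := hS
  have e : update (config' (m := m) u [] S) (some (some i)) l = config' u [] (update S i l) := by
    funext k
    rcases k with _ | _ | k
    · rfl
    · rfl
    · by_cases hk : k = i
      · subst hk; simp [config']
      · simp [config', hk]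
  rw [h]
  exact congrArg some (congrArg (TM2.Cfg.mk _ _) e)

theorem steps_clean_next (b : Bool) (i : Fin r) (u : List (Fin m ⊕ Bool))
    (S : Fin r → List G) (hS : S i = []) (v : Var m G) :
    Steps (TM2.step (machine p a g)) 1 ⟨some (some (Sum.inr (b, i.succ))), v, config' u [] S⟩
      ⟨some (some (Sum.inr (b, i.castSucc))), (none, v.2), config' u [] S⟩ := by
  refine Steps.one ?_
  simp only [TM2.step, machine, clean, Fin.cases_succ, TM2.stepAux]
  have h : (config' (m := m) u [] S (some (some i)) : List G) = [] := hS
  have e : update (config' (m := m) u [] S) (some (some i)) [] = config' u [] S := by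
    rw [update_eq_self_iff]; exact h.symm
  rw [h]
  exact congrArg some (congrArg (TM2.Cfg.mk _ _) e)

/-- The phase `i.succ` empties program stack `i` and then passes to the next lower phase; phase `0`
empties the input stack and answers. Stacks numbered `i` or higher are empty when phase `i` begins,
and each program stack costs at most `B + 1` pops. -/
theorem steps_clean (b : Bool) (i : Fin (r + 1)) : ∀ (u : List (Fin m ⊕ Bool)) (S : Fin r → List G)
    (v : Var m G) (B : ℕ), (∀ j : Fin r, i ≤ j.castSucc → S j = []) → (∀ j, (S j).length ≤ B) →
    ∃ n ≤ i.val * (B + 1) + u.length + 1, Steps (TM2.step (machine p a g)) n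
      ⟨some (some (Sum.inr (b, i))), v, config' u [] S⟩
      ⟨none, (none, none), config' [] [b] (fun _ => [])⟩ := by
  induction i using Fin.induction with
  | zero =>
    intro u S v B h _
    obtain rfl : S = fun _ => [] := funext fun j => h j (Fin.zero_le _)
    exact ⟨_, by simp, steps_clean_zero p a g b u v⟩
  | succ i ih =>
    intro u S v B h hB
    have key : ∀ (l : List G) (S : Fin r → List G) (v : Var m G), S i = l →
        (∀ j : Fin r, i.succ ≤ j.castSucc → S j = []) → (∀ j, (S j).length ≤ B) →
        ∃ n ≤ (l.length + 1) + (i.val * (B + 1) + u.length + 1),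
          Steps (TM2.step (machine p a g)) n
          ⟨some (some (Sum.inr (b, i.succ))), v, config' u [] S⟩
          ⟨none, (none, none), config' [] [b] (fun _ => [])⟩ := by
      intro l
      induction l with
      | nil =>
        intro S v hl h hB
        obtain ⟨n, hn, hs⟩ := ih u S (none, v.2) B (by
          intro j hj
          rcases eq_or_lt_of_le hj with hj | hj
          · rw [← Fin.castSucc_injective r hj]; exact hl
          · exact h j (by rw [Fin.succ_le_castSucc_iff]; exact Fin.castSucc_lt_castSucc_iff.1 hj)) hB
        refine ⟨1 + n, ?_, (steps_clean_next p a g b i u S hl v).trans hs⟩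
        simp at hn ⊢
        omega
      | cons s l ih' =>
        intro S v hl h hB
        obtain ⟨n, hn, hs⟩ := ih' (update S i l) (some s, v.2) (by simp) (by
          intro j hj
          have : j ≠ i := by
            rintro rfl
            rw [Fin.succ_le_castSucc_iff] at hj
            exact lt_irrefl _ hj
          simp [this, h j hj]) (by
          intro j
          by_cases hj : j = i
          · subst hj
            have := hB j
            rw [hl] at this
            simp at this ⊢
            omega
          · simpa [hj] using hB j)
        refine ⟨1 + n, ?_, (steps_clean_pop p a g b i u s l S hl v).trans hs⟩
        simp
        omega
    obtain ⟨n, hn, hs⟩ := key _ S v rfl h hB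
    refine ⟨n, ?_, hs⟩
    have := hB i
    simp only [Fin.val_succ, add_mul, one_mul]
    omega

theorem steps_read (z : List (Fin m)) (u : List (Fin m ⊕ Bool)) : ∀ (l : List G) (v : Var m G),
    ∃ v', Steps (TM2.step (machine p a g)) z.length
      ⟨some none, v, config' (z.map Sum.inl ++ u) [] (update (fun _ => []) a l)⟩
      ⟨some none, v', config' u [] (update (fun _ => []) a (z.reverse.map g ++ l))⟩ := by
  induction z with
  | nil => exact fun l v => ⟨v, Steps.refl _⟩
  | cons x z ih =>
    intro l v
    obtain ⟨v', h⟩ := ih (g x :: l) (v.1, some (Sum.inl x))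
    refine ⟨v', ?_⟩
    rw [List.length_cons, add_comm]
    refine Steps.trans (Steps.one ?_) (by simpa using h)
    refine congrArg some (congrArg (TM2.Cfg.mk _ _) ?_)
    funext k
    rcases k with _ | _ | k
    · rfl
    · rfl
    · by_cases hk : k = a
      · subst hk; simp [config', config', inSymbol]
      · simp [config', config', hk]

omit [Inhabited G] in
theorem config'_certificate (w : List Bool) (S : Fin r → List G) :
    config' (m := m) (w.map Sum.inr) [] S = config w S := by
  funext k
  rcases k with _ | _ | k <;> rfl

theorem steps_read_nil (S : Fin r → List G) (v : Var m G) :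
    Steps (TM2.step (machine p a g)) 1 ⟨some none, v, config' [] [] S⟩
      ⟨some (some (Sum.inr (false, Fin.last r))), (v.1, none), config [] S⟩ := by
  refine Steps.one (congrArg some (congrArg (TM2.Cfg.mk _ _) ?_))
  funext k
  rcases k with _ | _ | k <;> rfl

theorem steps_read_cons (b : Bool) (w : List Bool) (S : Fin r → List G) (v : Var m G) :
    Steps (TM2.step (machine p a g)) 1 ⟨some none, v, config' ((b :: w).map Sum.inr) [] S⟩
      ⟨some (some (Sum.inl (entry p))), (v.1, some (Sum.inr b)), config w S⟩ := by
  refine Steps.one (congrArg some (congrArg (TM2.Cfg.mk _ _) ?_))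
  funext k
  rcases k with _ | _ | k <;> rfl

/-- The program stacks that hold the input word `z`, last letter first, on the stack `a`. -/
def inputStacks (z : List (Fin m)) : Fin r → List G := update (fun _ => []) a (z.reverse.map g)

/-- The initial configuration of the machine. -/
def startCfg (z : List (Fin m)) (w : List Bool) : TM2.Cfg (Stk m r G) (MLabel p) (Var m G) :=
  ⟨some none, (none, none), config' (z.map Sum.inl ++ w.map Sum.inr) [] (fun _ => [])⟩

def haltCfg (b : Bool) : TM2.Cfg (Stk m r G) (MLabel p) (Var m G) :=
  ⟨none, (none, none), config' [] [b] (fun _ => [])⟩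

theorem steps_start_nil (z : List (Fin m)) : ∃ v, Steps (TM2.step (machine p a g)) (z.length + 1)
    (startCfg p z [])
    ⟨some (some (Sum.inr (false, Fin.last r))), v, config [] (inputStacks a g z)⟩ := by
  obtain ⟨v, h⟩ := steps_read p a g z [] [] (none, none)
  refine ⟨_, Steps.trans (b := ⟨some none, v, config' [] [] (inputStacks a g z)⟩) ?_
    (steps_read_nil p a g _ _)⟩
  simpa [startCfg, inputStacks] using h

theorem steps_start_cons (z : List (Fin m)) (b : Bool) (w : List Bool) :
    ∃ v, Steps (TM2.step (machine p a g)) (z.length + 1) (startCfg p z (b :: w))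
      ⟨some (some (Sum.inl (entry p))), v, config w (inputStacks a g z)⟩ := by
  obtain ⟨v, h⟩ := steps_read p a g z ((b :: w).map Sum.inr) [] (none, none)
  refine ⟨_, Steps.trans (b := ⟨some none, v, config' ((b :: w).map Sum.inr) []
    (inputStacks a g z)⟩) ?_ (steps_read_cons p a g _ _ _ _)⟩
  simpa [startCfg, inputStacks] using h

variable [Fintype G]

theorem exists_steps_clean : ∃ C : ℕ, ∀ (z : List (Fin m)) (w : List Bool), ∃ b n v S w',
    n ≤ C * (z.length + w.length + 1) ∧ w'.length ≤ w.length ∧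
    Steps (TM2.step (machine p a g)) n (startCfg p z w)
      ⟨some (some (Sum.inr (b, Fin.last r))), v, config w' S⟩ ∧
    (b = true → ∃ t ≤ w.length, ∃ S', t + 1 ≤ w.length ∧ Exec p (inputStacks a g z) t S') := by
  obtain ⟨C, hC⟩ := exists_steps (machine p a g) p (fun l => some (Sum.inl l)) _ _ (fun l => rfl)
  refine ⟨C + 1, fun z w => ?_⟩
  rcases w with _ | ⟨b, w⟩
  · obtain ⟨v, h⟩ := steps_start_nil p a g z
    exact ⟨_, _, _, _, _, by simp, le_rfl, h, by simp⟩
  · obtain ⟨v, h⟩ := steps_start_cons p a g z b w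
    rcases hC w (inputStacks a g z) v with
      ⟨S', v', w', t, n, hw, he, hs, hn⟩ | ⟨S', v', w', n, hw, hs, hn⟩
    · refine ⟨true, _, _, _, _, ?_, ?_, h.trans hs, fun _ => ⟨t, ?_, S', ?_, he⟩⟩
      · rw [List.length_cons, ← hw]; nlinarith
      all_goals rw [List.length_cons]; omega
    · refine ⟨false, _, _, _, _, ?_, ?_, h.trans hs, by simp⟩
      · rw [List.length_cons]; nlinarith
      · rw [List.length_cons]; omega

/-- The stacks are at most a constant times as high as the number of steps before cleaning, so
cleaning keeps the total time linear. The summand one in `t + 1` is the bit lost when the end of the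
input was noticed. -/
theorem exists_steps_halt : ∃ C : ℕ, ∀ (z : List (Fin m)) (w : List Bool), ∃ b n,
    n ≤ C * (z.length + w.length + 1) ∧
    Steps (TM2.step (machine p a g)) n (startCfg p z w) (haltCfg p b) ∧
    (b = true → ∃ t, t + 1 ≤ w.length ∧ ∃ S', Exec p (inputStacks a g z) t S') := by
  have := fintypeLabel p
  obtain ⟨C, hC⟩ := exists_steps_clean p a g
  set P := ∑ l, pushes (machine p a g l)
  refine ⟨C + (r * (C * P + 1) + 2), fun z w => ?_⟩
  obtain ⟨b, n, v, S, w', hn, hw, hs, hb⟩ := hC z w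
  have hl : ∀ j, (S j).length ≤ n * P := by
    intro j
    have := Steps.length_le hs (some (some j))
    simp only [startCfg, config', config, List.length_nil, zero_add] at this
    exact this
  obtain ⟨n', hn', hs'⟩ := steps_clean p a g b (Fin.last r) (w'.map Sum.inr) S v (n * P)
    (fun j hj => absurd hj (not_le.2 (Fin.castSucc_lt_last j))) hl
  rw [config'_certificate] at hs'
  refine ⟨b, n + n', ?_, hs.trans hs', fun h => ?_⟩
  · set ℓ := z.length + w.length + 1
    have h1 : n * P ≤ C * ℓ * P := Nat.mul_le_mul_right _ hn
    have h2 : r * (n * P + 1) ≤ r * ((C * P + 1) * ℓ) := by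
      apply Nat.mul_le_mul_left
      nlinarith [show 1 ≤ ℓ by omega]
    simp only [Fin.val_last, List.length_map] at hn'
    nlinarith [show w'.length + 1 ≤ 2 * ℓ by omega]
  · obtain ⟨t, -, S', ht, he⟩ := hb h
    exact ⟨t, ht, S', he⟩

/-- The machine bundled with its finiteness guarantees. -/
noncomputable def finTM2 : FinTM2 :=
  have := fintypeLabel p
  { K := Option (Option (Fin r))
    k₀ := none
    k₁ := some none
    Γ := Stk m r G
    Λ := MLabel p
    main := none
    σ := Var m G
    initialState := (none, none)
    Γk₀Fin := inferInstanceAs (Fintype (Fin m ⊕ Bool))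
    m := machine p a g }

/-- Languages accepted by a stack program in polynomially many ticks are in NP. -/
theorem exec_mem_NP (q : Polynomial ℕ) :
    {z : List (Fin m) | ∃ t ≤ q.eval z.length, ∃ S', Exec p (inputStacks a g z) t S'} ∈ NP m := by
  classical
  obtain ⟨C, hC⟩ := exists_steps_halt p a g
  choose V n hn hs hV using hC
  -- One certificate bit more than ticks: it starts the program.
  refine ⟨fun x => V x.1 x.2, q + 1, ⟨⟨⟨finTM2 p a g, Equiv.refl _, Equiv.refl _⟩,
    Polynomial.C C * (Polynomial.X + 1), ?_⟩⟩, ?_⟩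
  · rintro ⟨z, w⟩
    refine ⟨⟨n z w, ?_⟩, ?_⟩
    · have e₁ : initList (finTM2 p a g) (List.map (Equiv.refl _).invFun (encodePair (z, w))) =
          startCfg p z w := by
        refine congrArg (TM2.Cfg.mk _ _) ?_
        funext k
        rcases k with _ | _ | k
        · exact List.map_id _
        · rfl
        · rfl
      have e₂ : haltList (finTM2 p a g) [V z w] = haltCfg p (V z w) := by
        refine congrArg (TM2.Cfg.mk _ _) ?_
        funext k
        rcases k with _ | _ | k <;> rfl
      have h := hs z w
      rw [← e₁, ← e₂] at h
      exact h
    · have := hn z w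
      simpa [encodePair] using this
  · intro z
    constructor
    · rintro ⟨t, ht, S', he⟩
      obtain ⟨w, hw, hr⟩ := he.steps (machine p a g) (fun l => some (Sum.inl l)) _ _ (fun l => rfl)
      refine ⟨true :: w, by simp; omega, ?_⟩
      obtain ⟨v, h1⟩ := steps_start_cons p a g z true w
      obtain ⟨v', n', h2⟩ := hr [] v
      rw [List.append_nil] at h2
      obtain ⟨n'', -, h3⟩ := steps_clean p a g true (Fin.last r) [] S' v' (∑ j, (S' j).length)
        (fun j hj => absurd hj (not_le.2 (Fin.castSucc_lt_last j)))
        (fun j => Finset.single_le_sum (f := fun j => (S' j).length) (by simp) (Finset.mem_univ j))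
      have h4 := config'_certificate (m := m) [] S'
      rw [List.map_nil] at h4
      rw [h4] at h3
      -- The constructed accepting run and the run belonging to `V` both halt, hence they end in the
      -- same configuration, and the answers agree.
      have h5 := (hs z (true :: w)).unique ((h1.trans h2).trans h3) rfl rfl
      have h6 : [V z (true :: w)] = [true] := congrArg (fun c => c.stk (some none)) h5
      simpa using h6
    · rintro ⟨w, hw, hv⟩
      obtain ⟨t, ht, S', he⟩ := hV z w hv
      refine ⟨t, ?_, S', he⟩
      simp at hw
      omega

end

end StackProg

/-! ### Enumeration by prefix queries on a random access machine -/

namespace RAM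

/-- The letter `a` together with a decision about it, which may be missing. -/
def mark (a : Fin 24) (o : Option Bool) : Fin 72 :=
  ⟨a.val + 24 * o.elim 2 Bool.toNat, by rcases o with _ | _ | _ <;> simp <;> omega⟩

/-- The query for the word `x` and the decisions `p` about its first letters. -/
def query : List (Fin 24) → List Bool → List (Fin 72)
  | [], _ => []
  | a :: x, [] => mark a none :: query x []
  | a :: x, b :: p => mark a (some b) :: query x p

@[simp] theorem length_query (x : List (Fin 24)) (p : List Bool) :
    (query x p).length = x.length := by
  induction x generalizing p with
  | nil => rfl
  | cons a x ih => cases p <;> simp [query, ih]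

theorem getElem?_query (x : List (Fin 24)) (p : List Bool) (i : ℕ) :
    (query x p)[i]? = x[i]?.map (fun a => mark a p[i]?) := by
  induction x generalizing p i with
  | nil => simp [query]
  | cons a x ih => cases p <;> cases i <;> simp [query, ih]

/-- The part of the output that a letter contributes: it is kept, or it is suppressed, which
turns worlds into non-worlds and edges into non-edges. -/
def printLetter (a : Fin 24) (b : Bool) : List (Fin 24) :=
  if b then (if a = Letter.world then [Letter.absent] else
    if a = Letter.edge then [Letter.noEdge] else []) else [a]

/-- The output for the word `x` and the decisions `s`. -/
def printWord (x : List (Fin 24)) (s : List Bool) : List (Fin 24) :=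
  (List.zipWith printLetter x s).flatten

/-- The solutions among the sequences of `d` more decisions after `p`. -/
noncomputable def sols (good : Set (List Bool)) : ℕ → List Bool → List (List Bool)
  | 0, p => open Classical in if p ∈ good then [p] else []
  | d + 1, p => sols good d (p ++ [false]) ++ sols good d (p ++ [true])

theorem mem_sols {good : Set (List Bool)} {d : ℕ} {p s : List Bool} :
    s ∈ sols good d p ↔ p <+: s ∧ s.length = p.length + d ∧ s ∈ good := by
  induction d generalizing p with
  | zero =>
    constructor
    · intro h
      by_cases hp : p ∈ good <;> simp [sols, hp] at h
      subst h
      simp [hp]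
    · rintro ⟨h1, h2, h3⟩
      obtain rfl := h1.eq_of_length (by simpa using h2.symm)
      simp [sols, h3]
  | succ d ih =>
    simp only [sols, List.mem_append, ih, List.length_append, List.length_singleton]
    constructor
    · rintro (⟨h1, h2, h3⟩ | ⟨h1, h2, h3⟩) <;>
        exact ⟨(List.prefix_append _ _).trans h1, by omega, h3⟩
    · rintro ⟨⟨t, rfl⟩, h2, h3⟩
      rcases t with _ | ⟨b, t⟩
      · simp at h2
      · cases b
        · exact Or.inl ⟨⟨t, by simp⟩, by omega, h3⟩
        · exact Or.inr ⟨⟨t, by simp⟩, by omega, h3⟩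

theorem nodup_sols (good : Set (List Bool)) (d : ℕ) (p : List Bool) : (sols good d p).Nodup := by
  induction d generalizing p with
  | zero => by_cases hp : p ∈ good <;> simp [sols, hp]
  | succ d ih =>
    refine List.Nodup.append (ih _) (ih _) fun s h h' => ?_
    obtain ⟨t, ht⟩ := (mem_sols.1 h).1
    obtain ⟨t', ht'⟩ := (mem_sols.1 h').1
    rw [← ht'] at ht
    simp at ht

/-- The enumeration program. Register 0 holds the number of decisions made so far, and decision
`i` is kept in register `12 + i`. -/
def enumProgram : Program := [
  -- 24 is the distance between the variants of a letter in `mark`; 12 is the offset of the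
  -- registers for decisions; 5 and 8 are the register codes of `Letter.world` and `Letter.edge`,
  -- one more than the letters.
  .const 1 1, .const 5 24, .const 6 12, .const 10 5, .const 11 8,
  -- Copy the input to the oracle registers with all decisions missing, which adds 24 twice.
  .read 4 0, .jumpZero 4 12, .add 3 4 5, .add 3 3 5, .setOracle 0 3, .add 0 0 1, .jump 5,
  .const 0 0, .query 15, .halt,
  -- Address 15, descend: try `false`; if the oracle says no, take `true` without asking.
  .read 4 0, .jumpZero 4 26, .setOracle 0 4, .add 2 0 6, .store 2 8, .query 24,
  .add 3 4 5, .setOracle 0 3, .store 2 1, .add 0 0 1, .jump 15,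
  -- Address 26, print: `R 7` is the position. A suppressed letter is compared with 5 and with 8 by
  -- adding the two truncated differences.
  .const 7 0, .read 4 7, .jumpZero 4 45, .add 2 7 6, .load 3 2, .jumpZero 3 42,
  .sub 3 4 10, .sub 9 10 4, .add 3 3 9, .jumpZero 3 41,
  .sub 3 4 11, .sub 9 11 4, .add 3 3 9, .jumpZero 3 41, .jump 43,
  -- `Letter.absent` and `Letter.noEdge` directly precede `Letter.world` and `Letter.edge`, so one
  -- subtraction replaces either letter.
  .sub 4 4 1, .print 4, .add 7 7 1, .jump 27, .output,
  -- Address 46, climb: after `true`, mark the decision as missing and go on climbing; after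
  -- `false`, ask about `true` and descend again if the answer is yes.
  .jumpZero 0 61, .sub 0 0 1, .read 4 0, .add 2 0 6, .load 3 2, .jumpZero 3 56,
  .add 3 4 5, .add 3 3 5, .setOracle 0 3, .jump 46,
  .add 3 4 5, .setOracle 0 3, .store 2 1, .query 24, .jump 52,
  .halt]

/-- The sum of the numbers and addresses that an instruction handles. -/
def instrSize (inp : ℕ → ℕ) (c : Cfg) : Instr → ℕ
  | .const _ a => a
  | .add _ j k => c.reg j + c.reg k
  | .sub _ j k => c.reg j + c.reg k
  | .load _ j => c.reg j + c.reg (c.reg j)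
  | .store i j => c.reg i + c.reg j
  | .read _ j => c.reg j + inp (c.reg j)
  | .setOracle i j => c.reg i + c.reg j
  | .jumpZero i _ => c.reg i
  | .print i => c.reg i
  | _ => 0

/-- Bit lengths are bounded by the numbers themselves. This is wasteful but harmless, because the
registers and addresses used are linear in the input length. -/
theorem instrCost_le (inp : ℕ → ℕ) (c : Cfg) (I : Instr) :
    instrCost inp c I ≤ 1 + instrSize inp c I := by
  have h : ∀ n : ℕ, n.size ≤ n := fun n => Nat.size_le.2 Nat.lt_two_pow_self
  cases I <;> simp only [instrCost, instrSize, add_assoc, add_le_add_iff_left, add_zero, le_refl]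
  all_goals first | exact h _ | exact add_le_add (h _) (h _)

/-! ### Runs with bounded costs and bounded oracle calls -/

section

variable {m : ℕ} (P : Program) (L : Set (List (Fin m))) (inp : ℕ → ℕ) (b T : ℕ)

/-- `n` steps that complete no output, have cost at most `T` each, and ask the oracle only about
words of length at most `b`. -/
inductive Path : ℕ → Cfg → Cfg → Prop
  | refl (c : Cfg) : Path 0 c c
  | step {n : ℕ} {c c' c'' : Cfg} (I : Instr) (h : P[c.pc]? = some I) (ho : I ≠ .output)
      (hs : exec L inp c I = some c') (ht : 1 + instrSize inp c I ≤ T)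
      (hq : ∀ l, I = .query l → ∃ w : List (Fin m), w.length ≤ b ∧ HoldsWord c.orc w)
      (hr : Path n c' c'') : Path (n + 1) c c''

variable {P L inp b T}

theorem Path.trans {n n' : ℕ} {c c' c'' : Cfg} (h : Path P L inp b T n c c')
    (h' : Path P L inp b T n' c' c'') : Path P L inp b T (n + n') c c'' := by
  induction h with
  | refl c => simpa using h'
  | step I h ho hs ht hq hr ih =>
    rw [add_right_comm]
    exact .step I h ho hs ht hq (ih h')

theorem Path.silent {n : ℕ} {c c' : Cfg} (h : Path P L inp b T n c c') :
    ∃ t ≤ n * T, Silent P L inp c t c' := by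
  induction h with
  | refl c => exact ⟨0, by simp, .refl c⟩
  | @step n c c' c'' I h ho hs ht hq hr ih =>
    obtain ⟨t, htn, hsil⟩ := ih
    refine ⟨_, ?_, .step (c' := c') ?_ ?_ hsil⟩
    · have := instrCost_le inp c I
      simp only [cost, h, Option.elim_some, add_mul, one_mul]
      omega
    · rw [h]; simpa using ho
    · simp [RAM.step, h, hs]

variable (P L inp b)

/-- All oracle calls in the run from `c` are about words of length at most `b`. -/
def Safe (c : Cfg) : Prop :=
  ∀ c', Relation.ReflTransGen (fun c c' => step P L inp c = some c') c c' →
    ∀ l, P[c'.pc]? = some (.query l) → ∃ w : List (Fin m), w.length ≤ b ∧ HoldsWord c'.orc w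

variable {P L inp b}

theorem Safe.of_step {c c' : Cfg} (hs : step P L inp c = some c') (h : Safe P L inp b c')
    (hq : ∀ l, P[c.pc]? = some (.query l) → ∃ w : List (Fin m), w.length ≤ b ∧ HoldsWord c.orc w) :
    Safe P L inp b c := by
  intro d hd
  rcases hd.cases_head with rfl | ⟨e, he, hd⟩
  · exact hq
  · have he : step P L inp c = some e := he
    rw [hs] at he
    cases he
    exact h d hd

theorem Safe.of_path {n : ℕ} {c c' : Cfg} (hp : Path P L inp b T n c c')
    (h : Safe P L inp b c') : Safe P L inp b c := by
  induction hp with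
  | refl c => exact h
  | @step n c c' c'' I hI ho hs ht hq hr ih =>
    refine Safe.of_step (c' := c') (by simp [RAM.step, hI, hs]) (ih h) fun l hl => ?_
    rw [hI] at hl
    exact hq l (by simpa using hl)

variable (P L inp b T)

/-- Like `EnumDelay`, with delays counted in steps and a separate bound for the first delay. -/
inductive EnumSteps (d : ℕ) : ℕ → Cfg → List (List ℕ) → Prop
  | finish {r n : ℕ} {c c' : Cfg} (hr : Path P L inp b T n c c') (hs : P[c'.pc]? = some .halt)
      (hn : n ≤ r) : EnumSteps d r c []
  | next {r n pc : ℕ} {c : Cfg} {reg orc : ℕ → ℕ} {out : List ℕ} {ys : List (List ℕ)}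
      (hr : Path P L inp b T n c ⟨pc, reg, orc, out⟩) (ho : P[pc]? = some .output) (hn : n ≤ r)
      (hy : EnumSteps d d ⟨pc + 1, reg, orc, []⟩ ys) : EnumSteps d r c (out :: ys)

variable {P L inp b T}

theorem EnumSteps.of_path {d r r' n : ℕ} {c c' : Cfg} {ys : List (List ℕ)}
    (hp : Path P L inp b T n c c') (h : EnumSteps P L inp b T d r c' ys) (hr : n + r ≤ r') :
    EnumSteps P L inp b T d r' c ys := by
  cases h with
  | finish h1 h2 h3 => exact .finish (hp.trans h1) h2 (by omega)
  | next h1 h2 h3 h4 => exact .next (hp.trans h1) h2 (by omega) h4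

/-- At most `d` steps of cost `T` precede each output or the end, and the output instruction costs
one more. The machine is deterministic, so the exhibited run contains all oracle calls. -/
theorem EnumSteps.enumDelay {d r D : ℕ} {c : Cfg} {ys : List (List ℕ)}
    (h : EnumSteps P L inp b T d r c ys) (hr : r ≤ d) (hd : d * T + 1 ≤ D) :
    EnumDelay P L inp D c ys ∧ Safe P L inp b c := by
  induction h with
  | @finish r n c c' hp hs hn =>
    obtain ⟨t, ht, hsil⟩ := hp.silent
    have hst : step P L inp c' = none := by simp [RAM.step, hs, exec]
    refine ⟨.finish hsil hst ?_, .of_path hp ?_⟩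
    · have := Nat.mul_le_mul_right T (hn.trans hr)
      omega
    · intro e he
      rcases he.cases_head with rfl | ⟨f, hf, -⟩
      · intro l hl
        rw [hs] at hl
        simp at hl
      · have hf : step P L inp c' = some f := hf
        rw [hst] at hf
        cases hf
  | @next r n pc c reg orc out ys hp ho hn hy ih =>
    obtain ⟨t, ht, hsil⟩ := hp.silent
    obtain ⟨h1, h2⟩ := ih le_rfl
    have hst : step P L inp ⟨pc, reg, orc, out⟩ = some ⟨pc + 1, reg, orc, []⟩ := by
      simp [RAM.step, ho, exec]
    refine ⟨.next hsil ho hst ?_ h1, .of_path hp (.of_step hst h2 ?_)⟩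
    · have := Nat.mul_le_mul_right T (hn.trans hr)
      simp only [cost, ho, Option.elim_some, instrCost]
      omega
    · intro l hl
      simp [ho] at hl

/-- The first empty register ends the word, so the oracle registers hold at most one word. Without
this, a word outside `L` would not force a negative answer. -/
theorem HoldsWord.unique {f : ℕ → ℕ} {w w' : List (Fin m)} (h : HoldsWord f w)
    (h' : HoldsWord f w') : w = w' := by
  have aux : ∀ {w w' : List (Fin m)}, HoldsWord f w → HoldsWord f w' → w.length ≤ w'.length := by
    intro w w' h h'
    by_contra! hlt
    have h1 := h _ hlt.le
    have h2 := h' _ le_rfl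
    rw [h1] at h2
    simp [code, List.getD_eq_getElem?_getD, hlt] at h2
  have hl := le_antisymm (aux h h') (aux h' h)
  refine List.ext_getElem hl fun i h1 h2 => ?_
  have h3 := h i h1.le
  rw [h' i h2.le] at h3
  simp [code, List.getD_eq_getElem?_getD, h1, h2] at h3
  exact Fin.ext h3.symm

end

end RAM

/-! ### Symbolic execution of the enumeration program -/

namespace RAM

section

variable {m : ℕ} {P : Program} {L : Set (List (Fin m))} {inp : ℕ → ℕ} {b T : ℕ}

/-- Instructions other than outputs and oracle calls. -/
def Instr.plain : Instr → Bool
  | .output => false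
  | .query _ => false
  | _ => true

theorem Path.op {n : ℕ} {c c' c'' : Cfg} {I : Instr} (h : P[c.pc]? = some I)
    (hI : I.plain = true) (hs : exec L inp c I = some c') (hr : Path P L inp b T n c' c'')
    (ht : 1 + instrSize inp c I ≤ T) : Path P L inp b T (n + 1) c c'' :=
  .step I h (by rintro rfl; simp [Instr.plain] at hI) hs ht
    (by rintro l rfl; simp [Instr.plain] at hI) hr

variable {n pc i l : ℕ} {reg orc : ℕ → ℕ} {out : List ℕ} {c : Cfg}

/-- The address and the value may be given in simplified form, with equations as side goals. A
straight-line run can then be written as one term that names the values, and `simp` closes the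
equations. -/
theorem Path.write {I : Instr} {k' v' : ℕ} (k v : ℕ) (h : P[pc]? = some I) (hI : I.plain = true)
    (hs : exec L inp ⟨pc, reg, orc, out⟩ I =
      some ⟨pc + 1, Function.update reg k' v', orc, out⟩) (hk : k' = k) (hv : v' = v)
    (ht : 1 + instrSize inp ⟨pc, reg, orc, out⟩ I ≤ T)
    (hr : Path P L inp b T n ⟨pc + 1, Function.update reg k v, orc, out⟩ c) :
    Path P L inp b T (n + 1) ⟨pc, reg, orc, out⟩ c := by
  subst hk hv
  exact .op h hI hs hr ht

theorem Path.setOracle {i j : ℕ} (orc' : ℕ → ℕ) (h : P[pc]? = some (.setOracle i j))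
    (ho : Function.update orc (reg i) (reg j) = orc') (ht : 1 + (reg i + reg j) ≤ T)
    (hr : Path P L inp b T n ⟨pc + 1, reg, orc', out⟩ c) :
    Path P L inp b T (n + 1) ⟨pc, reg, orc, out⟩ c := by
  subst ho
  exact .op h rfl rfl hr ht

theorem Path.jump_zero (h : P[pc]? = some (.jumpZero i l)) (h0 : reg i = 0)
    (hr : Path P L inp b T n ⟨l, reg, orc, out⟩ c) (ht : 1 + reg i ≤ T) :
    Path P L inp b T (n + 1) ⟨pc, reg, orc, out⟩ c :=
  .op h rfl (by simp [exec, h0]) hr ht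

theorem Path.jump_ne (h : P[pc]? = some (.jumpZero i l)) (h0 : reg i ≠ 0)
    (hr : Path P L inp b T n ⟨pc + 1, reg, orc, out⟩ c) (ht : 1 + reg i ≤ T) :
    Path P L inp b T (n + 1) ⟨pc, reg, orc, out⟩ c :=
  .op h rfl (by simp [exec, h0]) hr ht

theorem Path.ask_yes {w : List (Fin m)} (h : P[pc]? = some (.query l)) (hw : HoldsWord orc w)
    (hb : w.length ≤ b) (hL : w ∈ L) (hT : 1 ≤ T)
    (hr : Path P L inp b T n ⟨l, reg, orc, out⟩ c) :
    Path P L inp b T (n + 1) ⟨pc, reg, orc, out⟩ c := by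
  refine .step _ h (by simp) ?_ (by simpa [instrSize] using hT) (fun _ _ => ⟨w, hb, hw⟩) hr
  have : ∃ w ∈ L, HoldsWord orc w := ⟨w, hL, hw⟩
  simp [exec, this]

theorem Path.ask_no {w : List (Fin m)} (h : P[pc]? = some (.query l)) (hw : HoldsWord orc w)
    (hb : w.length ≤ b) (hL : w ∉ L) (hT : 1 ≤ T)
    (hr : Path P L inp b T n ⟨pc + 1, reg, orc, out⟩ c) :
    Path P L inp b T (n + 1) ⟨pc, reg, orc, out⟩ c := by
  refine .step _ h (by simp) ?_ (by simpa [instrSize] using hT) (fun _ _ => ⟨w, hb, hw⟩) hr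
  have : ¬ ∃ w ∈ L, HoldsWord orc w := by
    rintro ⟨w', hL', hw'⟩
    exact hL (hw.unique hw' ▸ hL')
  simp [exec, this]

end

theorem input_of_lt {k : ℕ} {x : List (Fin k)} {i : ℕ} (h : i < x.length) :
    input x i = x[i].val + 1 := by
  simp [input, code, List.getD_eq_getElem?_getD, h]

theorem input_of_le {k : ℕ} {x : List (Fin k)} {i : ℕ} (h : x.length ≤ i) : input x i = 0 := by
  simp [input, code, List.getD_eq_getElem?_getD, h]

/-- The oracle registers that hold a word. -/
def oracleFn {k : ℕ} (w : List (Fin k)) (i : ℕ) : ℕ := (code w).getD i 0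

theorem holdsWord_oracleFn {k : ℕ} (w : List (Fin k)) : HoldsWord (oracleFn w) w := fun _ _ => rfl

theorem oracleFn_query (x : List (Fin 24)) (p : List Bool) (i : ℕ) :
    oracleFn (query x p) i = x[i]?.elim 0 fun a => a.val + 24 * p[i]?.elim 2 Bool.toNat + 1 := by
  simp only [oracleFn, code, List.getD_eq_getElem?_getD, List.getElem?_map, getElem?_query]
  cases x[i]? <;> simp [mark]

/-- Queries whose decision lists differ at one position only differ in one letter, so a move in the
search tree costs a single oracle write. -/
theorem update_oracleFn (x : List (Fin 24)) (p q : List Bool) (i v : ℕ) (h : i < x.length)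
    (hv : v = x[i].val + 24 * q[i]?.elim 2 Bool.toNat + 1) (hpq : ∀ j ≠ i, p[j]? = q[j]?) :
    Function.update (oracleFn (query x p)) i v = oracleFn (query x q) := by
  funext j
  by_cases hj : j = i
  · subst hj
    simp [oracleFn_query, h, hv]
  · simp [hj, oracleFn_query, hpq j hj]

theorem getElem?_concat_ne {α : Type*} {p : List α} (a : α) {j : ℕ} (hj : j ≠ p.length) :
    (p ++ [a])[j]? = p[j]? := by
  rcases lt_or_gt_of_ne hj with hj | hj
  · rw [List.getElem?_append_left hj]
  · rw [List.getElem?_eq_none (by simpa using hj), List.getElem?_eq_none hj.le]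

/-- The registers after the decisions `p` about the first letters of `x`. -/
structure Ready (x : List (Fin 24)) (p : List Bool) (reg orc : ℕ → ℕ) : Prop where
  r0 : reg 0 = p.length
  r1 : reg 1 = 1
  r5 : reg 5 = 24
  r6 : reg 6 = 12
  r8 : reg 8 = 0
  r10 : reg 10 = 5
  r11 : reg 11 = 8
  bits : ∀ i (h : i < p.length), reg (12 + i) = p[i].toNat
  query : orc = oracleFn (query x p)

section

open Function

variable {L : Set (List (Fin 72))} {x : List (Fin 24)} {p : List Bool} {reg orc : ℕ → ℕ}

/-- Paths of the enumeration program on input `x`. -/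
abbrev EPath (L : Set (List (Fin 72))) (x : List (Fin 24)) : ℕ → Cfg → Cfg → Prop :=
  Path enumProgram L (input x) x.length (2 * x.length + 300)

theorem bits_concat {reg' : ℕ → ℕ} (b : Bool) (bits : ∀ i (h : i < p.length), reg (12 + i) = p[i].toNat)
    (h : ∀ i < p.length, reg' (12 + i) = reg (12 + i)) (h' : reg' (12 + p.length) = b.toNat) :
    ∀ i (h : i < (p ++ [b]).length), reg' (12 + i) = (p ++ [b])[i].toNat := by
  intro i hi
  rcases Nat.lt_or_eq_of_le (Nat.lt_succ_iff.1 (by simpa using hi)) with hi' | rfl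
  · rw [h i hi', bits i hi', List.getElem_append_left hi']
  · simp [h']

/-- A move of the search is a fixed sequence of instructions. The term lists them with the written
values; the registers at the end are found by unification, and the holes are equations about
registers and cost bounds. The other moves follow the same pattern. -/
theorem fill_yes (h : Ready x p reg orc) (hp : p.length < x.length)
    (hL : query x (p ++ [false]) ∈ L) : ∃ reg' orc',
    EPath L x 8 ⟨15, reg, orc, []⟩ ⟨15, reg', orc', []⟩ ∧ Ready x (p ++ [false]) reg' orc' := by
  have hx := input_of_lt hp
  have hlt := x[p.length].isLt
  obtain ⟨r0, r1, r5, r6, r8, r10, r11, bits, rfl⟩ := h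
  have ho := update_oracleFn x p (p ++ [false]) p.length (x[p.length].val + 1) hp (by simp)
    (fun j hj => (getElem?_concat_ne false hj).symm)
  refine ⟨_, _, 
    .write (4) (x[p.length].val + 1) rfl rfl rfl ?_ ?_ ?_ (.jump_ne rfl ?_ (.setOracle
    (oracleFn (query x (p ++ [false]))) rfl ?_ ?_ (.write (2) (p.length + 12) rfl rfl rfl ?_
    ?_ ?_ (.write (p.length + 12) (0) rfl rfl rfl ?_ ?_ ?_ (.ask_yes (w := query x (p ++
    [false])) rfl (holdsWord_oracleFn _) (by simp) hL (by omega) (.write (0) (p.length + 1)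
    rfl rfl rfl ?_ ?_ ?_ (.op rfl rfl rfl (.refl _) (by simp [instrSize]))))))) ?_), ?_⟩
  rotate_right
  · constructor
    case bits =>
      refine bits_concat false bits (fun i hi => ?_) ?_
      · simp only [update_apply]
        split_ifs <;> first | omega | rfl
      · simp [update_apply, add_comm]
    all_goals simp [update_apply, r0, r1, r5, r6, r8, r10, r11]
  all_goals simp [instrSize, r0, r1, r5, r6, r8, r10, r11, hx, ho, update_apply]
  all_goals omega

/-- Only the query for `false` is made. The search visits extendable prefixes only, so after a
negative answer `true` must be right. -/
theorem fill_no (h : Ready x p reg orc) (hp : p.length < x.length)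
    (hL : query x (p ++ [false]) ∉ L) : ∃ reg' orc',
    EPath L x 11 ⟨15, reg, orc, []⟩ ⟨15, reg', orc', []⟩ ∧ Ready x (p ++ [true]) reg' orc' := by
  have hx := input_of_lt hp
  have hlt := x[p.length].isLt
  obtain ⟨r0, r1, r5, r6, r8, r10, r11, bits, rfl⟩ := h
  have ho := update_oracleFn x p (p ++ [false]) p.length (x[p.length].val + 1) hp (by simp)
    (fun j hj => (getElem?_concat_ne false hj).symm)
  have ho' := update_oracleFn x (p ++ [false]) (p ++ [true]) p.length (x[p.length].val + 1 + 24) hp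
    (by simp)
    (fun j hj => (getElem?_concat_ne false hj).trans (getElem?_concat_ne true hj).symm)
  refine ⟨_, _, 
    .write (4) (x[p.length].val + 1) rfl rfl rfl ?_ ?_ ?_ (.jump_ne rfl ?_ (.setOracle
    (oracleFn (query x (p ++ [false]))) rfl ?_ ?_ (.write (2) (p.length + 12) rfl rfl rfl ?_
    ?_ ?_ (.write (p.length + 12) (0) rfl rfl rfl ?_ ?_ ?_ (.ask_no (w := query x (p ++
    [false])) rfl (holdsWord_oracleFn _) (by simp) hL (by omega) (.write (3) (x[p.length].val
    + 1 + 24) rfl rfl rfl ?_ ?_ ?_ (.setOracle (oracleFn (query x (p ++ [true]))) rfl ?_ ?_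
    (.write (p.length + 12) (1) rfl rfl rfl ?_ ?_ ?_ (.write (0) (p.length + 1) rfl rfl rfl ?_
    ?_ ?_ (.op rfl rfl rfl (.refl _) (by simp [instrSize])))))))))) ?_), ?_⟩
  rotate_right
  · constructor
    case bits =>
      refine bits_concat true bits (fun i hi => ?_) ?_
      · simp only [update_apply]
        split_ifs <;> first | omega | rfl
      · simp [update_apply, add_comm]
    all_goals simp [update_apply, r0, r1, r5, r6, r8, r10, r11]
  all_goals simp [instrSize, r0, r1, r5, r6, r8, r10, r11, hx, ho, ho', update_apply]
  all_goals omega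

/-- Every node tries `false` first, so climbing out of a `false` branch leaves the `true` branch
still to be explored. -/
theorem back_yes (h : Ready x (p ++ [false]) reg orc) (hp : p.length < x.length)
    (hL : query x (p ++ [true]) ∈ L) : ∃ reg' orc',
    EPath L x 12 ⟨46, reg, orc, []⟩ ⟨15, reg', orc', []⟩ ∧ Ready x (p ++ [true]) reg' orc' := by
  have hx := input_of_lt hp
  have hlt := x[p.length].isLt
  obtain ⟨r0, r1, r5, r6, r8, r10, r11, bits, rfl⟩ := h
  have r0 : reg 0 = p.length + 1 := by simpa using r0
  have hb : reg (p.length + 12) = 0 := by simpa [add_comm] using bits p.length (by simp)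
  have hbits : ∀ i (h : i < p.length), reg (12 + i) = p[i].toNat := fun i hi => by
    have := bits i (by simp; omega)
    rwa [List.getElem_append_left hi] at this
  have ho' := update_oracleFn x (p ++ [false]) (p ++ [true]) p.length (x[p.length].val + 1 + 24) hp
    (by simp)
    (fun j hj => (getElem?_concat_ne false hj).trans (getElem?_concat_ne true hj).symm)
  refine ⟨_, _, 
    .jump_ne rfl ?_ (.write (0) (p.length) rfl rfl rfl ?_ ?_ ?_ (.write (4) (x[p.length].val +
    1) rfl rfl rfl ?_ ?_ ?_ (.write (2) (p.length + 12) rfl rfl rfl ?_ ?_ ?_ (.write (3) (0)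
    rfl rfl rfl ?_ ?_ ?_ (.jump_zero rfl ?_ (.write (3) (x[p.length].val + 1 + 24) rfl rfl rfl
    ?_ ?_ ?_ (.setOracle (oracleFn (query x (p ++ [true]))) rfl ?_ ?_ (.write (p.length + 12)
    (1) rfl rfl rfl ?_ ?_ ?_ (.ask_yes (w := query x (p ++ [true])) rfl (holdsWord_oracleFn _)
    (by simp) hL (by omega) (.write (0) (p.length + 1) rfl rfl rfl ?_ ?_ ?_ (.op rfl rfl rfl
    (.refl _) (by simp [instrSize]))))))) ?_))))) ?_, ?_⟩
  rotate_right
  · constructor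
    case bits =>
      refine bits_concat true hbits (fun i hi => ?_) ?_
      · simp only [update_apply]
        split_ifs <;> first | omega | rfl
      · simp [update_apply, add_comm]
    all_goals simp [update_apply, r0, r1, r5, r6, r8, r10, r11]
  all_goals simp [instrSize, r0, r1, r5, r6, r8, r10, r11, hx, hb, ho', update_apply]
  all_goals omega

/-- The letter must be marked as undecided again, since queries at higher levels assume that later
decisions are missing. -/
theorem back_no (h : Ready x (p ++ [false]) reg orc) (hp : p.length < x.length)
    (hL : query x (p ++ [true]) ∉ L) : ∃ reg' orc',
    EPath L x 15 ⟨46, reg, orc, []⟩ ⟨46, reg', orc', []⟩ ∧ Ready x p reg' orc' := by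
  have hx := input_of_lt hp
  have hlt := x[p.length].isLt
  obtain ⟨r0, r1, r5, r6, r8, r10, r11, bits, rfl⟩ := h
  have r0 : reg 0 = p.length + 1 := by simpa using r0
  have hb : reg (p.length + 12) = 0 := by simpa [add_comm] using bits p.length (by simp)
  have hbits : ∀ i (h : i < p.length), reg (12 + i) = p[i].toNat := fun i hi => by
    have := bits i (by simp; omega)
    rwa [List.getElem_append_left hi] at this
  have ho' := update_oracleFn x (p ++ [false]) (p ++ [true]) p.length (x[p.length].val + 1 + 24) hp
    (by simp)
    (fun j hj => (getElem?_concat_ne false hj).trans (getElem?_concat_ne true hj).symm)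
  have hu := update_oracleFn x (p ++ [true]) p p.length (x[p.length].val + 1 + 24 + 24) hp
    (by simp) (fun j hj => getElem?_concat_ne true hj)
  refine ⟨_, _, 
    .jump_ne rfl ?_ (.write (0) (p.length) rfl rfl rfl ?_ ?_ ?_ (.write (4) (x[p.length].val +
    1) rfl rfl rfl ?_ ?_ ?_ (.write (2) (p.length + 12) rfl rfl rfl ?_ ?_ ?_ (.write (3) (0)
    rfl rfl rfl ?_ ?_ ?_ (.jump_zero rfl ?_ (.write (3) (x[p.length].val + 1 + 24) rfl rfl rfl
    ?_ ?_ ?_ (.setOracle (oracleFn (query x (p ++ [true]))) rfl ?_ ?_ (.write (p.length + 12)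
    (1) rfl rfl rfl ?_ ?_ ?_ (.ask_no (w := query x (p ++ [true])) rfl (holdsWord_oracleFn _)
    (by simp) hL (by omega) (.op rfl rfl rfl (.write (3) (x[p.length].val + 1 + 24) rfl rfl
    rfl ?_ ?_ ?_ (.write (3) (x[p.length].val + 1 + 24 + 24) rfl rfl rfl ?_ ?_ ?_ (.setOracle
    (oracleFn (query x p)) rfl ?_ ?_ (.op rfl rfl rfl (.refl _) (by simp [instrSize]))))) (by
    simp [instrSize])))))) ?_))))) ?_, ?_⟩
  rotate_right
  · constructor
    case bits =>
      intro i hi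
      rw [← hbits i hi]
      simp only [update_apply]
      split_ifs <;> first | omega | rfl
    all_goals simp [update_apply, r0, r1, r5, r6, r8, r10, r11]
  all_goals simp [instrSize, r0, r1, r5, r6, r8, r10, r11, hx, hb, ho', hu, update_apply]
  all_goals omega

theorem back_unset (h : Ready x (p ++ [true]) reg orc) (hp : p.length < x.length) : ∃ reg' orc',
    EPath L x 10 ⟨46, reg, orc, []⟩ ⟨46, reg', orc', []⟩ ∧ Ready x p reg' orc' := by
  have hx := input_of_lt hp
  have hlt := x[p.length].isLt
  obtain ⟨r0, r1, r5, r6, r8, r10, r11, bits, rfl⟩ := h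
  have r0 : reg 0 = p.length + 1 := by simpa using r0
  have hb : reg (p.length + 12) = 1 := by simpa [add_comm] using bits p.length (by simp)
  have hbits : ∀ i (h : i < p.length), reg (12 + i) = p[i].toNat := fun i hi => by
    have := bits i (by simp; omega)
    rwa [List.getElem_append_left hi] at this
  have hu := update_oracleFn x (p ++ [true]) p p.length (x[p.length].val + 1 + 24 + 24) hp
    (by simp) (fun j hj => getElem?_concat_ne true hj)
  refine ⟨_, _, 
    .jump_ne rfl ?_ (.write (0) (p.length) rfl rfl rfl ?_ ?_ ?_ (.write (4) (x[p.length].val +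
    1) rfl rfl rfl ?_ ?_ ?_ (.write (2) (p.length + 12) rfl rfl rfl ?_ ?_ ?_ (.write (3) (1)
    rfl rfl rfl ?_ ?_ ?_ (.jump_ne rfl ?_ (.write (3) (x[p.length].val + 1 + 24) rfl rfl rfl
    ?_ ?_ ?_ (.write (3) (x[p.length].val + 1 + 24 + 24) rfl rfl rfl ?_ ?_ ?_ (.setOracle
    (oracleFn (query x p)) rfl ?_ ?_ (.op rfl rfl rfl (.refl _) (by simp [instrSize])))))
    ?_))))) ?_, ?_⟩
  rotate_right
  · constructor
    case bits =>
      intro i hi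
      rw [← hbits i hi]
      simp only [update_apply]
      split_ifs <;> first | omega | rfl
    all_goals simp [update_apply, r0, r1, r5, r6, r8, r10, r11]
  all_goals simp [instrSize, r0, r1, r5, r6, r8, r10, r11, hx, hb, hu, update_apply]
  all_goals omega

/-- Registers 2, 3, 4, 7 and 9 are scratch space, and printing writes to no others. -/
theorem Ready.congr {reg' : ℕ → ℕ} (h : Ready x p reg orc)
    (hr : ∀ i, i ≠ 2 → i ≠ 3 → i ≠ 4 → i ≠ 7 → i ≠ 9 → reg' i = reg i) : Ready x p reg' orc := by
  obtain ⟨r0, r1, r5, r6, r8, r10, r11, bits, ho⟩ := h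
  constructor
  case bits => exact fun i hi => (hr _ (by omega) (by omega) (by omega) (by omega)
    (by omega)).trans (bits i hi)
  case query => exact ho
  all_goals rwa [hr _ (by omega) (by omega) (by omega) (by omega) (by omega)]

theorem EPath.out_eq {n : ℕ} {c : Cfg} {pc : ℕ} {out out' : List ℕ}
    (h : EPath L x n c ⟨pc, reg, orc, out⟩) (ho : out = out') :
    EPath L x n c ⟨pc, reg, orc, out'⟩ := ho ▸ h

theorem print_keep {j : ℕ} {out : List ℕ} (h : Ready x p reg orc) (hj : reg 7 = j)
    (hp : j < p.length) (hx : j < x.length) (hpj : p[j] = false) : ∃ reg',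
    EPath L x 8 ⟨27, reg, orc, out⟩ ⟨27, reg', orc, out ++ [x[j].val + 1]⟩ ∧
      Ready x p reg' orc ∧ reg' 7 = j + 1 := by
  have hx := input_of_lt hx
  have hlt := x[j].isLt
  have hb : reg (j + 12) = _ := (congrArg reg (add_comm _ _)).trans (h.bits j hp)
  have ⟨r0, r1, r5, r6, r8, r10, r11, bits, ho⟩ := h
  have ha := hpj
  refine ⟨_, EPath.out_eq (.write (4) (x[j].val + 1) rfl rfl rfl ?_ ?_ ?_ (.jump_ne rfl ?_ (.write (2) (j + 12) rfl
    rfl rfl ?_ ?_ ?_ (.write (3) (0) rfl rfl rfl ?_ ?_ ?_ (.jump_zero rfl ?_ (.op rfl rfl rfl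
    (.write (7) (j + 1) rfl rfl rfl ?_ ?_ ?_ (.op rfl rfl rfl (.refl _) (by simp
    [instrSize]))) ?_) ?_))) ?_)) (by simp), h.congr ?_, ?_⟩
  rotate_right 2
  · intros; simp [update_apply, *]
  · simp
  all_goals simp [instrSize, r1, r6, r10, r11, hj, hx, hb, ha]
  all_goals omega

/-- The world letter 4 has code 5, which makes both truncated differences with the constant 5
vanish; the printed 4 is the code of `Letter.absent`. -/
theorem print_world {j : ℕ} {out : List ℕ} (h : Ready x p reg orc) (hj : reg 7 = j)
    (hp : j < p.length) (hx : j < x.length) (hpj : p[j] = true) (hw : x[j].val = 4) : ∃ reg',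
    EPath L x 13 ⟨27, reg, orc, out⟩ ⟨27, reg', orc, out ++ [4]⟩ ∧
      Ready x p reg' orc ∧ reg' 7 = j + 1 := by
  have hx := input_of_lt hx
  have hlt := x[j].isLt
  have hb : reg (j + 12) = _ := (congrArg reg (add_comm _ _)).trans (h.bits j hp)
  have ⟨r0, r1, r5, r6, r8, r10, r11, bits, ho⟩ := h
  have ha := And.intro hpj hw
  refine ⟨_, EPath.out_eq (.write (4) (x[j].val + 1) rfl rfl rfl ?_ ?_ ?_ (.jump_ne rfl ?_ (.write (2) (j + 12) rfl
    rfl rfl ?_ ?_ ?_ (.write (3) (1) rfl rfl rfl ?_ ?_ ?_ (.jump_ne rfl ?_ (.write (3) (0) rfl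
    rfl rfl ?_ ?_ ?_ (.write (9) (0) rfl rfl rfl ?_ ?_ ?_ (.write (3) (0) rfl rfl rfl ?_ ?_ ?_
    (.jump_zero rfl ?_ (.write (4) (4) rfl rfl rfl ?_ ?_ ?_ (.op rfl rfl rfl (.write (7) (j +
    1) rfl rfl rfl ?_ ?_ ?_ (.op rfl rfl rfl (.refl _) (by simp [instrSize]))) ?_)) ?_))))
    ?_))) ?_)) (by simp), h.congr ?_, ?_⟩
  rotate_right 2
  · intros; simp [update_apply, *]
  · simp
  all_goals simp [instrSize, r1, r6, r10, r11, hj, hx, hb, ha]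
  all_goals omega

theorem print_edge {j : ℕ} {out : List ℕ} (h : Ready x p reg orc) (hj : reg 7 = j)
    (hp : j < p.length) (hx : j < x.length) (hpj : p[j] = true) (hw : x[j].val = 7) : ∃ reg',
    EPath L x 17 ⟨27, reg, orc, out⟩ ⟨27, reg', orc, out ++ [7]⟩ ∧
      Ready x p reg' orc ∧ reg' 7 = j + 1 := by
  have hx := input_of_lt hx
  have hlt := x[j].isLt
  have hb : reg (j + 12) = _ := (congrArg reg (add_comm _ _)).trans (h.bits j hp)
  have ⟨r0, r1, r5, r6, r8, r10, r11, bits, ho⟩ := h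
  have ha := And.intro hpj hw
  refine ⟨_, EPath.out_eq (.write (4) (x[j].val + 1) rfl rfl rfl ?_ ?_ ?_ (.jump_ne rfl ?_ (.write (2) (j + 12) rfl
    rfl rfl ?_ ?_ ?_ (.write (3) (1) rfl rfl rfl ?_ ?_ ?_ (.jump_ne rfl ?_ (.write (3) (3) rfl
    rfl rfl ?_ ?_ ?_ (.write (9) (0) rfl rfl rfl ?_ ?_ ?_ (.write (3) (3) rfl rfl rfl ?_ ?_ ?_
    (.jump_ne rfl ?_ (.write (3) (0) rfl rfl rfl ?_ ?_ ?_ (.write (9) (0) rfl rfl rfl ?_ ?_ ?_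
    (.write (3) (0) rfl rfl rfl ?_ ?_ ?_ (.jump_zero rfl ?_ (.write (4) (7) rfl rfl rfl ?_ ?_
    ?_ (.op rfl rfl rfl (.write (7) (j + 1) rfl rfl rfl ?_ ?_ ?_ (.op rfl rfl rfl (.refl _)
    (by simp [instrSize]))) ?_)) ?_)))) ?_)))) ?_))) ?_)) (by simp), h.congr ?_, ?_⟩
  rotate_right 2
  · intros; simp [update_apply, *]
  · simp
  all_goals simp [instrSize, r1, r6, r10, r11, hj, hx, hb, ha]
  all_goals omega

/-- For different numbers one of the two truncated differences is positive, so both comparisons fail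
and the print instruction is skipped. -/
theorem print_none {j : ℕ} {out : List ℕ} (h : Ready x p reg orc) (hj : reg 7 = j)
    (hp : j < p.length) (hx : j < x.length) (hpj : p[j] = true) (hw : x[j].val ≠ 4) (he : x[j].val ≠ 7) : ∃ reg',
    EPath L x 16 ⟨27, reg, orc, out⟩ ⟨27, reg', orc, out ++ []⟩ ∧
      Ready x p reg' orc ∧ reg' 7 = j + 1 := by
  have hx := input_of_lt hx
  have hlt := x[j].isLt
  have hb : reg (j + 12) = _ := (congrArg reg (add_comm _ _)).trans (h.bits j hp)
  have ⟨r0, r1, r5, r6, r8, r10, r11, bits, ho⟩ := h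
  have ha := hpj
  refine ⟨_, EPath.out_eq (.write (4) (x[j].val + 1) rfl rfl rfl ?_ ?_ ?_ (.jump_ne rfl ?_ (.write (2) (j + 12) rfl
    rfl rfl ?_ ?_ ?_ (.write (3) (1) rfl rfl rfl ?_ ?_ ?_ (.jump_ne rfl ?_ (.write (3)
    (x[j].val + 1 - 5) rfl rfl rfl ?_ ?_ ?_ (.write (9) (5 - (x[j].val + 1)) rfl rfl rfl ?_ ?_
    ?_ (.write (3) (x[j].val + 1 - 5 + (5 - (x[j].val + 1))) rfl rfl rfl ?_ ?_ ?_ (.jump_ne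
    rfl ?_ (.write (3) (x[j].val + 1 - 8) rfl rfl rfl ?_ ?_ ?_ (.write (9) (8 - (x[j].val +
    1)) rfl rfl rfl ?_ ?_ ?_ (.write (3) (x[j].val + 1 - 8 + (8 - (x[j].val + 1))) rfl rfl rfl
    ?_ ?_ ?_ (.jump_ne rfl ?_ (.op rfl rfl rfl (.write (7) (j + 1) rfl rfl rfl ?_ ?_ ?_ (.op
    rfl rfl rfl (.refl _) (by simp [instrSize]))) (by simp [instrSize])) ?_)))) ?_)))) ?_)))
    ?_)) (by simp), h.congr ?_, ?_⟩
  rotate_right 2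
  · intros; simp [update_apply, *]
  · simp
  all_goals simp [instrSize, r1, r6, r10, r11, hj, hx, hb, ha]
  all_goals omega

theorem print_step {j : ℕ} {out : List ℕ} (h : Ready x p reg orc) (hj : reg 7 = j)
    (hp : j < p.length) (hx : j < x.length) : ∃ n ≤ 17, ∃ reg',
    EPath L x n ⟨27, reg, orc, out⟩ ⟨27, reg', orc, out ++ code (printLetter x[j] p[j])⟩ ∧
      Ready x p reg' orc ∧ reg' 7 = j + 1 := by
  cases hpj : p[j]
  · exact ⟨8, by omega, print_keep h hj hp hx hpj⟩
  · by_cases hw : x[j].val = 4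
    · have hw' : x[j] = Letter.world := Fin.ext hw
      obtain ⟨reg', h'⟩ := print_world (L := L) (out := out) h hj hp hx hpj hw
      exact ⟨13, by omega, reg', by simpa [hw', printLetter, code, Letter.absent] using h'⟩
    by_cases he : x[j].val = 7
    · have he' : x[j] = Letter.edge := Fin.ext he
      obtain ⟨reg', h'⟩ := print_edge (L := L) (out := out) h hj hp hx hpj he
      exact ⟨17, le_rfl, reg', by
        simpa [he', printLetter, code, Letter.noEdge, Letter.edge, Letter.world] using h'⟩
    · obtain ⟨reg', h'⟩ := print_none (L := L) (out := out) h hj hp hx hpj hw he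
      have hw' : x[j] ≠ Letter.world := fun h => hw (congrArg Fin.val h)
      have he' : x[j] ≠ Letter.edge := fun h => he (congrArg Fin.val h)
      exact ⟨16, by omega, reg', by simpa [hw', he', printLetter, code] using h'⟩

end

end RAM

/-! ### Depth-first search with polynomial delay -/

namespace RAM

open Function

section

variable {L : Set (List (Fin 72))} {x : List (Fin 24)} {p : List Bool} {reg orc : ℕ → ℕ}

theorem take_append_getElem {α : Type*} (l : List α) (i : ℕ) (h : i < l.length) :
    l.take (i + 1) = l.take i ++ [l[i]] := by
  rw [List.take_add_one, List.getElem?_eq_getElem h, Option.toList_some]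

theorem query_append_nil (x y : List (Fin 24)) : query (x ++ y) [] = query x [] ++ query y [] := by
  induction x with
  | nil => rfl
  | cons a x ih => simp [query, ih]

theorem oracleFn_concat {k : ℕ} (w : List (Fin k)) (a : Fin k) :
    update (oracleFn w) w.length (a.val + 1) = oracleFn (w ++ [a]) := by
  funext j
  by_cases hj : j = w.length
  · subst hj; simp [oracleFn, code, List.getD_eq_getElem?_getD]
  · rw [update_of_ne hj]
    simp only [oracleFn, code, List.getD_eq_getElem?_getD, List.getElem?_map,
      getElem?_concat_ne a hj]

theorem printWord_append {s : List Bool} {x' : List (Fin 24)} {s' : List Bool}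
    (h : x.length = s.length) : printWord (x ++ x') (s ++ s') = printWord x s ++ printWord x' s' := by
  simp [printWord, List.zipWith_append h]

/-- Copying the input to the oracle registers. -/
theorem init_loop (i : ℕ) (hi : i ≤ x.length) : ∃ reg n, n ≤ 7 * i + 5 ∧
    EPath L x n start ⟨5, reg, oracleFn (query (x.take i) []), []⟩ ∧
    reg 0 = i ∧ reg 1 = 1 ∧ reg 5 = 24 ∧ reg 6 = 12 ∧ reg 8 = 0 ∧ reg 10 = 5 ∧ reg 11 = 8 := by
  induction i with
  | zero =>
    refine ⟨_, 5, by omega, .write 1 1 rfl rfl rfl rfl rfl ?_ (.write 5 24 rfl rfl rfl rfl rfl ?_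
      (.write 6 12 rfl rfl rfl rfl rfl ?_ (.write 10 5 rfl rfl rfl rfl rfl ?_
      (.write 11 8 rfl rfl rfl rfl rfl ?_ (.refl _))))), ?_⟩
    all_goals simp [instrSize]
    all_goals omega
  | succ i ih =>
    obtain ⟨reg, n, hn, hp, r0, r1, r5, r6, r8, r10, r11⟩ := ih (by omega)
    have hx := input_of_lt (x := x) (i := i) (by omega)
    have hlt := x[i].isLt
    have ho := oracleFn_concat (query (x.take i) []) (mark x[i] none)
    rw [length_query, List.length_take, min_eq_left (by omega)] at ho
    have hq : query (x.take i) [] ++ [mark x[i] none] = query (x.take (i + 1)) [] := by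
      rw [take_append_getElem x i (by omega), query_append_nil]; rfl
    rw [hq, show (mark x[i] none).val + 1 = x[i].val + 1 + 24 + 24 by simp [mark]] at ho
    refine ⟨_, n + 7, by omega, hp.trans (.write 4 (x[i].val + 1) rfl rfl rfl rfl ?_ ?_
      (.jump_ne rfl ?_ (.write 3 (x[i].val + 1 + 24) rfl rfl rfl rfl ?_ ?_
      (.write 3 (x[i].val + 1 + 24 + 24) rfl rfl rfl rfl ?_ ?_
      (.setOracle (oracleFn (query (x.take (i + 1)) [])) rfl ?_ ?_
      (.write 0 (i + 1) rfl rfl rfl rfl ?_ ?_ (.op rfl rfl rfl (.refl _) (by simp [instrSize])))))) ?_)), ?_⟩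
    rotate_right
    · simp [update_apply, r0, r1, r5, r6, r8, r10, r11]
    all_goals simp [instrSize, r0, r1, r5, r6, hx, ho]
    all_goals omega

theorem init_path : ∃ reg orc n, n ≤ 7 * x.length + 8 ∧ Ready x [] reg orc ∧
    EPath L x n start ⟨13, reg, orc, []⟩ := by
  obtain ⟨reg, n, hn, hp, r0, r1, r5, r6, r8, r10, r11⟩ := init_loop (L := L) (x := x) _ le_rfl
  have hx := input_of_le (x := x) le_rfl
  rw [List.take_length] at hp
  refine ⟨_, _, n + 3, by omega, ?_, hp.trans (.write 4 0 rfl rfl rfl rfl ?_ ?_ (.jump_zero rfl ?_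
    (.write 0 0 rfl rfl rfl rfl rfl ?_ (.refl _)) ?_))⟩
  · constructor <;> simp [update_apply, r0, r1, r5, r6, r8, r10, r11]
  all_goals simp [instrSize, r0, hx]
  all_goals omega

theorem print_loop (h : Ready x p reg orc) (hp : p.length = x.length) (j : ℕ)
    (hj : j ≤ x.length) : ∃ n reg', n ≤ 17 * j + 3 ∧
    EPath L x n ⟨15, reg, orc, []⟩ ⟨27, reg', orc, code (printWord (x.take j) (p.take j))⟩ ∧
    Ready x p reg' orc ∧ reg' 7 = j := by
  induction j with
  | zero =>
    have hx := input_of_le (x := x) le_rfl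
    have r0 := h.r0
    refine ⟨3, _, by omega, .write 4 0 rfl rfl rfl rfl ?_ ?_ (.jump_zero rfl ?_
      (.write 7 0 rfl rfl rfl rfl rfl ?_ (.refl _)) ?_), h.congr ?_, ?_⟩
    rotate_right 2
    · intros; simp [update_apply, *]
    · simp
    all_goals simp [instrSize, r0, hp, hx]
    all_goals omega
  | succ j ih =>
    obtain ⟨n, reg', hn, h1, h2, h3⟩ := ih (by omega)
    obtain ⟨n', hn', reg'', h4, h5, h6⟩ := print_step (L := L) h2 h3 (by omega) (by omega)
      (out := code (printWord (x.take j) (p.take j)))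
    refine ⟨n + n', reg'', by omega, ?_, h5, h6⟩
    rw [take_append_getElem x j (by omega), take_append_getElem p j (by omega),
      printWord_append (by simp; omega)]
    have : printWord [x[j]] [p[j]] = printLetter x[j] p[j] := by simp [printWord]
    rw [this, code, List.map_append]
    exact h1.trans h4

theorem print_path (h : Ready x p reg orc) (hp : p.length = x.length) : ∃ n reg',
    n ≤ 17 * x.length + 5 ∧ EPath L x n ⟨15, reg, orc, []⟩ ⟨45, reg', orc, code (printWord x p)⟩ ∧
    Ready x p reg' orc := by
  obtain ⟨n, reg', hn, h1, h2, h3⟩ := print_loop (L := L) h hp _ le_rfl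
  have hx := input_of_le (x := x) le_rfl
  rw [List.take_length, ← hp, List.take_length] at h1
  refine ⟨n + 2, _, by omega, h1.trans (.write 4 0 rfl rfl rfl rfl ?_ ?_ (.jump_zero rfl ?_
      (.refl _) ?_)), h2.congr ?_⟩
  rotate_right
  · intros; simp [update_apply, *]
  all_goals simp [instrSize, h3, hp, hx]
  all_goals omega

/-- Runs of the enumeration program on input `x`. -/
abbrev EEnum (L : Set (List (Fin 72))) (x : List (Fin 24)) : ℕ → Cfg → List (List ℕ) → Prop :=
  EnumSteps enumProgram L (input x) x.length (2 * x.length + 300) (100 * x.length + 100)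

variable {good : Set (List Bool)}

/-- Induction on the number `d` of missing decisions, in continuation style: `ys` is what the
machine outputs once it has returned from the subtree of `p` to address 46. A level costs at most 12
steps downwards and 15 upwards, which 20 covers; `20 * x.length + 10` covers printing. In the
hypothesis, `40 * x.length + 40` leaves room for a new descent after the climb. -/
theorem enum_fill (hL : ∀ p, p.length ≤ x.length →
      (query x p ∈ L ↔ sols good (x.length - p.length) p ≠ [])) (d : ℕ) :
    ∀ (p : List Bool) (ys : List (List ℕ)), p.length + d = x.length → sols good d p ≠ [] →
      (∀ reg orc, Ready x p reg orc →
        EEnum L x (20 * p.length + 40 * x.length + 40) ⟨46, reg, orc, []⟩ ys) →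
      ∀ reg orc, Ready x p reg orc → EEnum L x (20 * d + 20 * x.length + 10) ⟨15, reg, orc, []⟩
        ((sols good d p).map (fun s => code (printWord x s)) ++ ys) := by
  induction d with
  | zero =>
    intro p ys hp hs hys reg orc h
    have hg : p ∈ good := by
      by_contra hg
      simp [sols, hg] at hs
    obtain ⟨n, reg', hn, h1, h2⟩ := print_path (L := L) h (by omega)
    simp only [sols, hg, if_true, List.map_cons, List.map_nil, List.cons_append, List.nil_append]
    refine .next h1 rfl (by omega) (.of_path (.refl _) (hys reg' orc h2) (by omega))
  | succ d ih =>
    intro p ys hp hs hys reg orc h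
    have h0 := hL (p ++ [false]) (by simp; omega)
    have h1 := hL (p ++ [true]) (by simp; omega)
    have hd : ∀ b : Bool, x.length - (p ++ [b]).length = d := fun b => by simp; omega
    rw [hd] at h0 h1
    -- the part of the run after the decision `true`
    have hback : ∀ reg orc, Ready x (p ++ [true]) reg orc →
        EEnum L x (20 * (p ++ [true]).length + 40 * x.length + 40) ⟨46, reg, orc, []⟩ ys := by
      intro reg orc h
      obtain ⟨reg', orc', hp', hr⟩ := back_unset (L := L) h (by omega)
      exact (hys _ _ hr).of_path hp' (by simp; omega)
    have hfill := ih (p ++ [true]) ys (by simp; omega)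
    by_cases hf : sols good d (p ++ [false]) = []
    · have ht : sols good d (p ++ [true]) ≠ [] := by
        intro ht; exact hs (by simp [sols, hf, ht])
      obtain ⟨reg', orc', hp', hr⟩ := fill_no h (by omega) (mt h0.1 (by simpa using hf))
      have := (hfill ht hback _ _ hr).of_path (r' := 20 * (d + 1) + 20 * x.length + 10) hp'
        (by omega)
      simpa [sols, hf] using this
    · obtain ⟨reg', orc', hp', hr⟩ := fill_yes h (by omega) (h0.2 hf)
      have := (ih (p ++ [false]) ((sols good d (p ++ [true])).map
        (fun s => code (printWord x s)) ++ ys) (by simp; omega) hf ?_ _ _ hr).of_path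
          (r' := 20 * (d + 1) + 20 * x.length + 10) hp' (by omega)
      · simpa [sols] using this
      -- This is the continuation after the `false` branch: only now the oracle is asked about
      -- `true`.
      · intro reg orc h
        by_cases ht : sols good d (p ++ [true]) = []
        · obtain ⟨reg', orc', hp', hr⟩ := back_no h (by omega) (mt h1.1 (by simpa using ht))
          rw [ht]
          exact (hys _ _ hr).of_path hp' (by simp; omega)
        · obtain ⟨reg', orc', hp', hr⟩ := back_yes h (by omega) (h1.2 ht)
          exact (hfill ht hback _ _ hr).of_path hp' (by simp; omega)

theorem enum_start (hL : ∀ p, p.length ≤ x.length →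
      (query x p ∈ L ↔ sols good (x.length - p.length) p ≠ [])) :
    EEnum L x (100 * x.length + 100) start
      ((sols good x.length []).map (fun s => code (printWord x s))) := by
  obtain ⟨reg, orc, n, hn, hr, hp⟩ := init_path (L := L) (x := x)
  have h0 := hL [] (by simp)
  simp only [List.length_nil, Nat.sub_zero] at h0
  by_cases hs : sols good x.length [] = []
  · rw [hs]
    refine .finish (hp.trans (.ask_no (w := query x []) rfl ?_ (by simp)
      (mt h0.1 (by simpa using hs)) (by omega) (.refl _))) rfl (by omega)
    rw [hr.query]; exact holdsWord_oracleFn _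
  · have := enum_fill hL x.length [] [] (by simp) hs (fun reg orc h => .finish (n := 1)
      (.jump_zero rfl h.r0 (.refl _) (by simp [h.r0])) rfl (by omega)) reg orc hr
    rw [List.append_nil] at this
    refine this.of_path (hp.trans (.ask_yes (w := query x []) (n := 0) rfl ?_ (by simp) (h0.2 hs)
      (by omega) (.refl _))) (by omega)
    rw [hr.query]; exact holdsWord_oracleFn _

/-- If an oracle decides which sequences of decisions can be completed, then the completions are
enumerated with polynomial delay. -/
theorem enumDelay_of_query (hL : ∀ p, p.length ≤ x.length →
      (query x p ∈ L ↔ ∃ s ∈ good, p <+: s ∧ s.length = x.length)) :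
    EnumDelay enumProgram L (input x) ((100 * x.length + 100) * (2 * x.length + 300) + 1) start
      ((sols good x.length []).map (fun s => code (printWord x s))) ∧
    OracleBounded enumProgram L (input x) x.length := by
  refine (enum_start fun p hp => (hL p hp).trans ?_).enumDelay le_rfl le_rfl
  simp only [ne_eq, List.eq_nil_iff_forall_not_mem, not_forall, not_not, mem_sols]
  refine exists_congr fun s => ?_
  rw [Nat.add_sub_cancel' hp]
  tauto

end

end RAM

/-! ### Evaluation of CTL formulas by iteration -/

/-- The iterates from `⊥` increase. Each strict increase adds an element of `Fin n`, so at most `n`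
of them are possible, and an iterate that repeats once repeats forever. -/
theorem Monotone.iterate_bot_fixed {n : ℕ} {F : (Fin n → Bool) → (Fin n → Bool)} (hF : Monotone F) :
    F (F^[n] ⊥) = F^[n] ⊥ := by
  have hmono : ∀ k, F^[k] ⊥ ≤ F^[k + 1] ⊥ := fun k => by
    rw [Function.iterate_succ_apply]
    exact hF.iterate k bot_le
  have key : ∀ k, F^[k + 1] ⊥ = F^[k] ⊥ ∨
      k + 1 ≤ (Finset.univ.filter fun w => (F^[k + 1] ⊥ : Fin n → Bool) w = true).card := by
    have hcard : ∀ k, F^[k + 1] ⊥ ≠ F^[k] ⊥ →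
        (Finset.univ.filter fun w => (F^[k] ⊥ : Fin n → Bool) w = true).card <
          (Finset.univ.filter fun w => (F^[k + 1] ⊥ : Fin n → Bool) w = true).card := by
      intro k hk
      refine Finset.card_lt_card ⟨fun w hw => ?_, fun hsub => hk (funext fun w => ?_)⟩
      · have := hmono k w
        rw [(Finset.mem_filter.1 hw).2] at this
        exact Finset.mem_filter.2 ⟨Finset.mem_univ _, top_le_iff.1 this⟩
      · refine le_antisymm ?_ (hmono k w)
        intro hw
        exact (Finset.mem_filter.1 (hsub (Finset.mem_filter.2 ⟨Finset.mem_univ _, hw⟩))).2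
    intro k
    induction k with
    | zero =>
      by_cases h : F^[0 + 1] ⊥ = F^[0] ⊥
      · exact Or.inl h
      · exact Or.inr (Nat.lt_of_le_of_lt (Nat.zero_le _) (hcard 0 h))
    | succ k ih =>
      by_cases h : F^[k + 1 + 1] ⊥ = F^[k + 1] ⊥
      · exact Or.inl h
      · rcases ih with ih | ih
        · exfalso
          apply h
          rw [Function.iterate_succ_apply' F (k + 1), ih, ← Function.iterate_succ_apply' F k, ih]
        · exact Or.inr (Nat.lt_of_le_of_lt ih (hcard _ h))
  rw [← Function.iterate_succ_apply' F]
  rcases key n with h | h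
  · exact h
  · have := Finset.card_filter_le Finset.univ fun w => (F^[n + 1] ⊥ : Fin n → Bool) w = true
    simp at this h
    omega

/-- A way to compute truth values of a compound formula: values are stored in the form given by
`out`, initialized from those of the last argument, and updated, once or repeatedly, from the
values `a`, `b` of the arguments and the information `x` whether some successor stores `true`. -/
structure VecOp where
  init : Bool → Bool
  upd : Bool → Bool → Bool → Bool
  out : Bool → Bool
  iter : Bool

namespace VecOp

/-- Some successor of `w` stores `true`. -/
def succ {n : ℕ} (e : Fin n → Fin n → Bool) (Z : Fin n → Bool) (w : Fin n) : Bool :=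
  (List.finRange n).any fun v => e w v && Z v

theorem succ_eq_true {n : ℕ} {e : Fin n → Fin n → Bool} {Z : Fin n → Bool} {w : Fin n} :
    succ e Z w = true ↔ ∃ v, e w v = true ∧ Z v = true := by
  simp [succ]

variable (o : VecOp) {n : ℕ} (e : Fin n → Fin n → Bool) (A B : Fin n → Bool)

def step (Z : Fin n → Bool) (w : Fin n) : Bool := o.upd (A w) (B w) (succ e Z w)

def apply (w : Fin n) : Bool :=
  o.out (((o.step e A B)^[if o.iter then n else 1]) (fun w => o.init (B w)) w)

def neg : VecOp := ⟨id, fun _ b _ => !b, id, false⟩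
def or : VecOp := ⟨id, fun a b _ => a || b, id, false⟩
def and : VecOp := ⟨id, fun a b _ => a && b, id, false⟩
-- A step only knows whether some successor stores `true`. For `A` the stored bits are therefore
-- negated truth values, which replaces "all successors" by "not some successor".
def next : PathQuant → VecOp
  | .E => ⟨id, fun _ _ x => x, id, false⟩
  | .A => ⟨not, fun _ _ x => x, not, false⟩
def upTo : PathQuant → VecOp
  | .E => ⟨fun _ => false, fun a b x => b || (a && x), id, true⟩
  | .A => ⟨fun _ => true, fun a b x => !(b || (a && !x)), not, true⟩
def release : PathQuant → VecOp
  | .E => ⟨fun _ => true, fun a b x => b && (a || x), id, true⟩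
  | .A => ⟨fun _ => false, fun a b x => !b || (!a && x), not, true⟩
def always : PathQuant → VecOp
  | .E => ⟨fun _ => true, fun _ b x => b && x, id, true⟩
  | .A => ⟨fun _ => false, fun _ b x => !b || x, not, true⟩

end VecOp

/-- The operator for a unary temporal operator; the first argument will be constantly true. -/
def UnOp.vecOp (Q : PathQuant) : UnOp → VecOp
  | .X => .next Q
  | .F => .upTo Q
  | .G => .always Q

def BinOp.vecOp (Q : PathQuant) : BinOp → VecOp
  | .U => .upTo Q
  | .R => .release Q

/-- The truth values of a formula at all worlds, for edges `e` and labels `η`. -/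
def CTL.eval {n : ℕ} (e : Fin n → Fin n → Bool) (η : Fin n → ℕ → Bool) : CTL → Fin n → Bool
  | .top => fun _ => true
  | .prop p => fun w => η w p
  | .neg φ => VecOp.neg.apply e (fun _ => true) (φ.eval e η)
  | .or φ ψ => VecOp.or.apply e (φ.eval e η) (ψ.eval e η)
  | .and φ ψ => VecOp.and.apply e (φ.eval e η) (ψ.eval e η)
  | .un Q T φ => (T.vecOp Q).apply e (fun _ => true) (φ.eval e η)
  | .bin Q T φ ψ => (T.vecOp Q).apply e (φ.eval e η) (ψ.eval e η)

/-- The dual path quantifier. -/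
def PathQuant.dual : PathQuant → PathQuant
  | .E => .A
  | .A => .E

theorem PathQuant.not_holds {α : Type} {S : Set α} {P : α → Prop} (Q : PathQuant) :
    ¬ Q.dual.Holds S P ↔ Q.Holds S (fun π => ¬ P π) := by
  cases Q <;> simp [PathQuant.Holds, PathQuant.dual]

theorem PathQuant.holds_congr {α : Type} {S : Set α} {P P' : α → Prop} (Q : PathQuant)
    (h : ∀ π ∈ S, (P π ↔ P' π)) : Q.Holds S P ↔ Q.Holds S P' := by
  cases Q
  · exact exists_congr fun π => and_congr_right fun hπ => h π hπ
  · exact forall₂_congr h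

/-! ### Fixed points and infinite paths -/

section

variable {n : ℕ} {e : Fin n → Fin n → Bool} {W : Set (Fin n)}

/-- The paths of the graph with edges `e`. -/
def edgePaths (e : Fin n → Fin n → Bool) (w : Fin n) : Set (ℕ → Fin n) :=
  {π | π 0 = w ∧ ∀ i, e (π i) (π (i + 1)) = true}

theorem mem_of_mem_edgePaths (hcl : ∀ w ∈ W, ∀ v, e w v = true → v ∈ W) {w : Fin n} (hw : w ∈ W)
    {π : ℕ → Fin n} (hπ : π ∈ edgePaths e w) (i : ℕ) : π i ∈ W := by
  induction i with
  | zero => rw [hπ.1]; exact hw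
  | succ i ih => exact hcl _ ih _ (hπ.2 i)

theorem tail_mem_edgePaths {w : Fin n} {π : ℕ → Fin n} (hπ : π ∈ edgePaths e w) :
    (fun i => π (i + 1)) ∈ edgePaths e (π 1) := ⟨rfl, fun i => hπ.2 (i + 1)⟩

theorem cons_mem_edgePaths {w v : Fin n} (h : e w v = true) {π : ℕ → Fin n}
    (hπ : π ∈ edgePaths e v) : (fun i => Nat.casesOn i w π : ℕ → Fin n) ∈ edgePaths e w := by
  refine ⟨rfl, fun i => ?_⟩
  cases i with
  | zero => simpa [hπ.1] using h
  | succ i => exact hπ.2 i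

theorem iterate_mem_edgePaths {f : Fin n → Fin n} (hf : ∀ w ∈ W, e w (f w) = true)
    (hcl : ∀ w ∈ W, ∀ v, e w v = true → v ∈ W) {w : Fin n} (hw : w ∈ W) :
    (fun i => f^[i] w) ∈ edgePaths e w := by
  have hW : ∀ i, f^[i] w ∈ W := fun i => by
    induction i with
    | zero => exact hw
    | succ i ih =>
      rw [Function.iterate_succ_apply']
      exact hcl _ ih _ (hf _ ih)
  refine ⟨rfl, fun i => ?_⟩
  change e (f^[i] w) (f^[i + 1] w) = true
  rw [Function.iterate_succ_apply']
  exact hf _ (hW i)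

/-- Iterate a chosen successor function. Numbers below `n` that are not worlds may lack successors,
so everything about paths is relative to a set `W` that is closed under edges and on which edges are
total. -/
theorem exists_mem_edgePaths (hcl : ∀ w ∈ W, ∀ v, e w v = true → v ∈ W)
    (htot : ∀ w ∈ W, ∃ v, e w v = true) {w : Fin n} (hw : w ∈ W) : (edgePaths e w).Nonempty := by
  have : ∀ w, ∃ v, w ∈ W → e w v = true := fun w => by
    by_cases hw : w ∈ W
    · obtain ⟨v, hv⟩ := htot w hw
      exact ⟨v, fun _ => hv⟩
    · exact ⟨w, fun h => absurd h hw⟩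
  choose f hf using this
  exact ⟨_, iterate_mem_edgePaths hf hcl hw⟩

/-- The worlds with a path that satisfies an until formula. -/
def untilStep (Q : PathQuant) (e : Fin n → Fin n → Bool) (A B Z : Fin n → Bool) (w : Fin n) : Bool :=
  B w || (A w && match Q with
    | .E => VecOp.succ e Z w
    | .A => !VecOp.succ e (fun v => !Z v) w)

theorem untilStep_mono (Q : PathQuant) (A B : Fin n → Bool) : Monotone (untilStep Q e A B) := by
  intro Z Z' h w hw
  have h' : ∀ v, Z v = true → Z' v = true := fun v => h v
  change untilStep Q e A B Z w = true at hw
  change untilStep Q e A B Z' w = true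
  cases Q <;> simp only [untilStep, Bool.or_eq_true, Bool.and_eq_true, Bool.not_eq_true',
    Bool.eq_false_iff, ne_eq, VecOp.succ_eq_true] at hw ⊢
  · exact hw.imp_right fun ⟨ha, v, hv, hz⟩ => ⟨ha, v, hv, h' v hz⟩
  · refine hw.imp_right fun ⟨ha, hv⟩ => ⟨ha, fun ⟨v, hv', hz'⟩ => hv ⟨v, hv', fun hz => hz' (h' v hz)⟩⟩

/-- For `A` the stored bits are the complements of the iterates of `untilStep`; for `E` they are
these iterates themselves. -/
theorem until_apply (Q : PathQuant) (A B : Fin n → Bool) :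
    (VecOp.upTo Q).apply e A B = (untilStep Q e A B)^[n] ⊥ := by
  cases Q
  · rfl
  · have : ∀ k, (fun w => !(((VecOp.upTo .A).step e A B)^[k]) (fun _ => true) w) =
        (untilStep .A e A B)^[k] ⊥ := by
      intro k
      induction k with
      | zero => rfl
      | succ k ih =>
        rw [Function.iterate_succ_apply', Function.iterate_succ_apply', ← ih]
        funext w
        simp [VecOp.step, VecOp.upTo, untilStep]
    exact this n

/-- A world that enters the set in some round satisfies the until formula, by induction on the
round. The converse uses only that the last iterate is a fixed point: for `E` membership propagates
backwards along a witnessing path, and for `A` a world outside the set starts a path that refutes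
the formula. -/
theorem until_apply_iff (hcl : ∀ w ∈ W, ∀ v, e w v = true → v ∈ W)
    (htot : ∀ w ∈ W, ∃ v, e w v = true) (Q : PathQuant) (A B : Fin n → Bool) {w : Fin n}
    (hw : w ∈ W) : (VecOp.upTo Q).apply e A B w = true ↔ Q.Holds (edgePaths e w)
      (fun π => BinOp.U.Holds (fun i => A (π i) = true) (fun i => B (π i) = true)) := by
  have hfix := (untilStep_mono (e := e) Q A B).iterate_bot_fixed
  rw [until_apply]
  constructor
  · have key : ∀ k, ∀ w ∈ W, (untilStep Q e A B)^[k] ⊥ w = true → Q.Holds (edgePaths e w)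
        (fun π => BinOp.U.Holds (fun i => A (π i) = true) (fun i => B (π i) = true)) := by
      intro k
      induction k with
      | zero => intro w _ h; simp at h
      | succ k ih =>
        intro w hw h
        rw [Function.iterate_succ_apply'] at h
        generalize hZ : (untilStep Q e A B)^[k] ⊥ = Z at h ih
        cases Q <;> simp only [untilStep, Bool.or_eq_true, Bool.and_eq_true, Bool.not_eq_true',
          Bool.eq_false_iff, ne_eq, VecOp.succ_eq_true, not_exists, not_and, not_not] at h
        · rcases h with h | ⟨ha, v, hv, hz⟩
          · obtain ⟨π, hπ⟩ := exists_mem_edgePaths hcl htot hw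
            exact ⟨π, hπ, 0, by simpa [hπ.1] using h, by simp⟩
          · obtain ⟨π, hπ, k, hk, hk'⟩ := ih v (hcl w hw v hv) hz
            refine ⟨_, cons_mem_edgePaths hv hπ, k + 1, hk, fun i hi => ?_⟩
            cases i with
            | zero => exact ha
            | succ i => exact hk' i (by omega)
        · intro π hπ
          rcases h with h | ⟨ha, hv⟩
          · exact ⟨0, by simpa [hπ.1] using h, by simp⟩
          · have he : e w (π 1) = true := by have := hπ.2 0; rwa [hπ.1] at this
            obtain ⟨k, hk, hk'⟩ := ih (π 1) (hcl w hw _ he) (hv _ he) _ (tail_mem_edgePaths hπ)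
            refine ⟨k + 1, hk, fun i hi => ?_⟩
            cases i with
            | zero => simpa [hπ.1] using ha
            | succ i => exact hk' i (by omega)
    exact key n w hw
  · generalize hX : (untilStep Q e A B)^[n] ⊥ = X at hfix
    intro h
    cases Q
    · obtain ⟨π, hπ, k, hk, hk'⟩ := h
      -- Go back from the position `k` where `B` holds to the start of the path.
      have : ∀ j ≤ k, X (π (k - j)) = true := by
        intro j
        induction j with
        | zero => intro _; rw [← hfix]; simp [untilStep, hk]
        | succ j ih =>
          intro hj
          rw [← hfix]
          have h1 := ih (by omega)
          have h2 := hπ.2 (k - (j + 1))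
          rw [show k - (j + 1) + 1 = k - j by omega] at h2
          simp only [untilStep, Bool.or_eq_true, Bool.and_eq_true, VecOp.succ_eq_true]
          exact Or.inr ⟨hk' _ (by omega), _, h2, h1⟩
      simpa [hπ.1] using this k le_rfl
    · by_contra hw'
      -- A world outside the fixed point that satisfies `A` has a successor outside, since otherwise
      -- it would have been added. Following such successors, `B` is never reached as long as `A`
      -- has held throughout.
      have hnext : ∀ w, ∃ v, w ∈ W → e w v = true ∧
          (X w = false → A w = true → X v = false) := by
        intro w
        by_cases hw : w ∈ W
        · by_cases hwx : X w = false ∧ A w = true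
          · have h1 := congrFun hfix w
            rw [hwx.1] at h1
            simp only [untilStep, hwx.2, Bool.true_and, Bool.or_eq_false_iff,
              Bool.not_eq_false', VecOp.succ_eq_true] at h1
            obtain ⟨-, v, hv, hx⟩ := h1
            exact ⟨v, fun _ => ⟨hv, fun _ _ => by simpa using hx⟩⟩
          · obtain ⟨v, hv⟩ := htot w hw
            exact ⟨v, fun _ => ⟨hv, fun h1 h2 => absurd ⟨h1, h2⟩ hwx⟩⟩
        · exact ⟨w, fun h => absurd h hw⟩
      choose f hf using hnext
      have hπ := iterate_mem_edgePaths (fun w hw => (hf w hw).1) hcl hw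
      obtain ⟨k, hk, hk'⟩ := h _ hπ
      have hall : ∀ j ≤ k, X (f^[j] w) = false := by
        intro j
        induction j with
        | zero => intro _; simpa using hw'
        | succ j ih =>
          intro hj
          rw [Function.iterate_succ_apply']
          exact (hf _ (mem_of_mem_edgePaths hcl hw hπ j)).2 (ih (by omega)) (hk' j (by omega))
      have h1 := hall k le_rfl
      rw [← hfix] at h1
      simp only [untilStep, Bool.or_eq_false_iff] at h1
      simp only at hk
      rw [h1.1] at hk
      cases hk

/-- Release is the dual of until, already at the level of single steps: complemented arguments and
dual quantifier give the same update of the stored bits. -/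
theorem release_apply (Q : PathQuant) (A B : Fin n → Bool) (w : Fin n) :
    (VecOp.release Q).apply e A B w =
      !(VecOp.upTo Q.dual).apply e (fun w => !A w) (fun w => !B w) w := by
  cases Q
  · have : (VecOp.release .E).step e A B =
        (VecOp.upTo .A).step e (fun w => !A w) (fun w => !B w) := by
      funext Z w; simp [VecOp.step, VecOp.release, VecOp.upTo]
    rw [VecOp.apply, this]
    exact (Bool.not_not _).symm
  · have : (VecOp.release .A).step e A B =
        (VecOp.upTo .E).step e (fun w => !A w) (fun w => !B w) := by
      funext Z w; simp [VecOp.step, VecOp.release, VecOp.upTo]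
    simp [VecOp.apply, PathQuant.dual, this]
    rfl

/-- Globally is release with a first argument that never holds. -/
theorem always_apply (Q : PathQuant) (A B : Fin n → Bool) :
    (VecOp.always Q).apply e A B = (VecOp.release Q).apply e (fun _ => false) B := by
  cases Q
  · have : (VecOp.always .E).step e A B = (VecOp.release .E).step e (fun _ => false) B := by
      funext Z w; simp [VecOp.step, VecOp.release, VecOp.always]
    funext w
    simp only [VecOp.apply, this]
    rfl
  · have : (VecOp.always .A).step e A B = (VecOp.release .A).step e (fun _ => false) B := by
      funext Z w; simp [VecOp.step, VecOp.release, VecOp.always]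
    funext w
    simp only [VecOp.apply, this]
    rfl

theorem release_apply_iff (hcl : ∀ w ∈ W, ∀ v, e w v = true → v ∈ W)
    (htot : ∀ w ∈ W, ∃ v, e w v = true) (Q : PathQuant) (A B : Fin n → Bool) {w : Fin n}
    (hw : w ∈ W) : (VecOp.release Q).apply e A B w = true ↔ Q.Holds (edgePaths e w)
      (fun π => BinOp.R.Holds (fun i => A (π i) = true) (fun i => B (π i) = true)) := by
  rw [release_apply, Bool.not_eq_true', Bool.eq_false_iff, ne_eq,
    until_apply_iff hcl htot _ (fun w => !A w) (fun w => !B w) hw, PathQuant.not_holds]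
  refine Q.holds_congr fun π _ => ?_
  simp only [BinOp.Holds, Bool.not_eq_true', not_exists, not_and, not_forall]
  refine forall_congr' fun k => ?_
  cases B (π k) <;> simp

theorem next_apply_iff (hcl : ∀ w ∈ W, ∀ v, e w v = true → v ∈ W)
    (htot : ∀ w ∈ W, ∃ v, e w v = true) (Q : PathQuant) (A B : Fin n → Bool) {w : Fin n}
    (hw : w ∈ W) : (VecOp.next Q).apply e A B w = true ↔ Q.Holds (edgePaths e w)
      (fun π => UnOp.X.Holds (fun i => B (π i) = true)) := by
  cases Q
  · change VecOp.succ e B w = true ↔ _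
    rw [VecOp.succ_eq_true]
    constructor
    · rintro ⟨v, hv, hb⟩
      obtain ⟨π, hπ⟩ := exists_mem_edgePaths hcl htot (hcl w hw v hv)
      exact ⟨_, cons_mem_edgePaths hv hπ, by simpa [UnOp.Holds, hπ.1] using hb⟩
    · rintro ⟨π, hπ, hb⟩
      exact ⟨π 1, by have := hπ.2 0; rwa [hπ.1] at this, hb⟩
  · change (!VecOp.succ e (fun w => !B w) w) = true ↔ _
    rw [Bool.not_eq_true', Bool.eq_false_iff, ne_eq, VecOp.succ_eq_true]
    constructor
    · intro h π hπ
      by_contra hb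
      exact h ⟨π 1, by have := hπ.2 0; rwa [hπ.1] at this, by simpa [UnOp.Holds] using hb⟩
    · rintro h ⟨v, hv, hb⟩
      obtain ⟨π, hπ⟩ := exists_mem_edgePaths hcl htot (hcl w hw v hv)
      have := h _ (cons_mem_edgePaths hv hπ)
      simp [UnOp.Holds, hπ.1] at this hb
      rw [this] at hb
      cases hb

end

/-- Paths from a world stay within the worlds, so the induction hypothesis applies at every position
of a path. Outside the worlds the computed values carry no meaning. -/
theorem CTL.eval_iff {n : ℕ} (M : Kripke n) (φ : CTL) : ∀ w ∈ M.worlds,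
    (φ.eval (fun w v => decide ((w, v) ∈ M.R)) (fun w p => decide (p ∈ M.η w)) w = true ↔
      M.Sat φ w) := by
  set e : Fin n → Fin n → Bool := fun w v => decide ((w, v) ∈ M.R) with he
  have hcl : ∀ w ∈ (M.worlds : Set (Fin n)), ∀ v, e w v = true → v ∈ (M.worlds : Set (Fin n)) :=
    fun w _ v hv => (M.R_sub _ (by simpa [he] using hv)).2
  have htot : ∀ w ∈ (M.worlds : Set (Fin n)), ∃ v, e w v = true := fun w hw => by
    simpa [he] using M.total w hw
  have hp : ∀ w, M.paths w = edgePaths e w := fun w => by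
    ext π; simp [Kripke.paths, edgePaths, he]
  induction φ with
  | top => simp [CTL.eval, Kripke.Sat]
  | prop p => simp [CTL.eval, Kripke.Sat]
  | neg φ ih =>
    intro w hw
    have h : ∀ b, b = true → (CTL.eval e (fun w p => decide (p ∈ M.η w)) φ w = true ↔ M.Sat φ w) :=
      fun _ _ => ih w hw
    simp [CTL.eval, Kripke.Sat, ← ih w hw, VecOp.neg, VecOp.apply, VecOp.step]
  | or φ ψ ih₁ ih₂ =>
    intro w hw
    simp [CTL.eval, Kripke.Sat, ← ih₁ w hw, ← ih₂ w hw, VecOp.or, VecOp.apply, VecOp.step]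
  | and φ ψ ih₁ ih₂ =>
    intro w hw
    simp [CTL.eval, Kripke.Sat, ← ih₁ w hw, ← ih₂ w hw, VecOp.and, VecOp.apply, VecOp.step]
  | un Q T φ ih =>
    intro w hw
    have hpath : ∀ π ∈ edgePaths e w, ∀ i, (CTL.eval e (fun w p => decide (p ∈ M.η w)) φ (π i) = true ↔
        M.Sat φ (π i)) := fun π hπ i => ih _ (mem_of_mem_edgePaths hcl hw hπ i)
    rw [Kripke.Sat, hp]
    cases T with
    | X =>
      refine (next_apply_iff hcl htot Q _ _ hw).trans (Q.holds_congr fun π hπ => ?_)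
      simp [UnOp.Holds, hpath π hπ]
    | F =>
      refine (until_apply_iff hcl htot Q _ _ hw).trans (Q.holds_congr fun π hπ => ?_)
      simp [UnOp.Holds, BinOp.Holds, hpath π hπ]
    | G =>
      change (VecOp.always Q).apply e _ _ w = true ↔ _
      rw [always_apply]
      refine (release_apply_iff hcl htot Q _ _ hw).trans (Q.holds_congr fun π hπ => ?_)
      simp [UnOp.Holds, BinOp.Holds, hpath π hπ]
  | bin Q T φ ψ ih₁ ih₂ =>
    intro w hw
    have h₁ : ∀ π ∈ edgePaths e w, ∀ i, (CTL.eval e (fun w p => decide (p ∈ M.η w)) φ (π i) = true ↔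
        M.Sat φ (π i)) := fun π hπ i => ih₁ _ (mem_of_mem_edgePaths hcl hw hπ i)
    have h₂ : ∀ π ∈ edgePaths e w, ∀ i, (CTL.eval e (fun w p => decide (p ∈ M.η w)) ψ (π i) = true ↔
        M.Sat ψ (π i)) := fun π hπ i => ih₂ _ (mem_of_mem_edgePaths hcl hw hπ i)
    rw [Kripke.Sat, hp]
    cases T with
    | U =>
      refine (until_apply_iff hcl htot Q _ _ hw).trans (Q.holds_congr fun π hπ => ?_)
      simp [BinOp.Holds, h₁ π hπ, h₂ π hπ]
    | R =>
      refine (release_apply_iff hcl htot Q _ _ hw).trans (Q.holds_congr fun π hπ => ?_)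
      simp [BinOp.Holds, h₁ π hπ, h₂ π hπ]

/-! ### The verifier: stacks, and rules for deterministic programs -/

namespace StackProg

variable {r : ℕ} {G : Type} {S S' S'' : Fin r → List G} {t : ℕ}

theorem exec_skip_iff : Exec skip S t S' ↔ t = 0 ∧ S' = S :=
  ⟨fun h => by cases h; exact ⟨rfl, rfl⟩, fun ⟨h, h'⟩ => by subst h h'; exact .skip _⟩

theorem exec_fail_iff : Exec (fail : StackProg r G) S t S' ↔ False :=
  ⟨nofun, False.elim⟩

theorem exec_push_iff {k : Fin r} {g : G} :
    Exec (push k g) S t S' ↔ t = 0 ∧ S' = Function.update S k (g :: S k) :=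
  ⟨fun h => by cases h; exact ⟨rfl, rfl⟩, fun ⟨h, h'⟩ => by subst h h'; exact .push _ _ _⟩

theorem exec_case_iff {k : Fin r} {f : Option G → StackProg r G} :
    Exec (case k f) S t S' ↔ Exec (f (S k).head?) (Function.update S k (S k).tail) t S' :=
  ⟨fun h => by cases h; assumption, .case⟩

theorem exec_seq_iff {p q : StackProg r G} :
    Exec (seq p q) S t S' ↔ ∃ t₁ t₂ S₁, Exec p S t₁ S₁ ∧ Exec q S₁ t₂ S' ∧ t = t₁ + t₂ :=
  ⟨fun h => by cases h with | seq h h' => exact ⟨_, _, _, h, h', rfl⟩,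
    fun ⟨_, _, _, h, h', e⟩ => e ▸ .seq h h'⟩

theorem exec_guess_iff {f : Bool → StackProg r G} :
    Exec (guess f) S t S' ↔ ∃ b t₁, Exec (f b) S t₁ S' ∧ t = t₁ + 1 :=
  ⟨fun h => by cases h with | guess b h => exact ⟨b, _, h, rfl⟩, fun ⟨b, _, h, e⟩ => e ▸ .guess b h⟩

theorem exec_loop_iff {k : Fin r} {ends : Option G → Bool} {body : Option G → StackProg r G} :
    Exec (loop k ends body) S t S' ↔
      ends (S k).head? = true ∧ t = 1 ∧ S' = Function.update S k (S k).tail ∨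
      ends (S k).head? = false ∧ ∃ t₁ t₂ S₁, Exec (body (S k).head?) (Function.update S k (S k).tail) t₁ S₁ ∧
        Exec (loop k ends body) S₁ t₂ S' ∧ t = 1 + t₁ + t₂ := by
  constructor
  · intro h
    cases h with
    | ends hs => exact Or.inl ⟨hs, rfl, rfl⟩
    | step hs h h' => exact Or.inr ⟨hs, _, _, _, h, h', rfl⟩
  · rintro (⟨hs, rfl, rfl⟩ | ⟨hs, _, _, _, h, h', rfl⟩)
    · exact .ends hs
    · exact .step hs h h'

/-- Programs without guesses. -/
def Det : StackProg r G → Prop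
  | skip => True
  | fail => True
  | push _ _ => True
  | case _ f => ∀ o, Det (f o)
  | seq p q => Det p ∧ Det q
  | loop _ _ body => ∀ o, Det (body o)
  | guess _ => False

/-- Turns each computed run of a program without guesses into a statement about all its executions,
so soundness of the verifier reuses the runs built for completeness. -/
theorem Exec.det {p : StackProg r G} (h : Exec p S t S') :
    ∀ {t' S''}, Det p → Exec p S t' S'' → S' = S'' := by
  induction h with
  | skip => intro _ _ _ h'; exact (exec_skip_iff.1 h').2.symm
  | push => intro _ _ _ h'; exact (exec_push_iff.1 h').2.symm
  | case _ ih => intro _ _ hp h'; exact ih (hp _) (exec_case_iff.1 h')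
  | seq _ _ ih₁ ih₂ =>
    intro _ _ hp h'
    obtain ⟨_, _, _, h₁, h₂, -⟩ := exec_seq_iff.1 h'
    obtain rfl := ih₁ hp.1 h₁
    exact ih₂ hp.2 h₂
  | ends hs =>
    intro _ _ _ h'
    rcases exec_loop_iff.1 h' with ⟨-, -, h⟩ | ⟨h, -⟩
    · exact h.symm
    · rw [hs] at h; cases h
  | step hs _ _ ih₁ ih₂ =>
    intro _ _ hp h'
    rcases exec_loop_iff.1 h' with ⟨h, -⟩ | ⟨-, _, _, _, h₁, h₂, -⟩
    · rw [hs] at h; cases h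
    · obtain rfl := ih₁ (hp _) h₁
      exact ih₂ hp h₂
  | guess => intro _ _ hp; exact hp.elim

end StackProg

namespace Verifier

/-- Stack symbols: a letter and some bits. -/
@[ext]
structure Sym where
  lt : Letter := 0
  a : Bool := false
  b : Bool := false
  z : Bool := false
  x : Bool := false
  y : Bool := false

instance : Inhabited Sym := ⟨{}⟩

noncomputable instance : Fintype Sym :=
  have := Classical.decEq Sym
  Fintype.ofSurjective (fun p : Letter × Bool × Bool × Bool × Bool × Bool =>
    (⟨p.1, p.2.1, p.2.2.1, p.2.2.2.1, p.2.2.2.2.1, p.2.2.2.2.2⟩ : Sym))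
    fun s => ⟨(s.lt, s.a, s.b, s.z, s.x, s.y), rfl⟩

/-- The symbol for a letter. -/
abbrev sym (l : Letter) : Sym := { lt := l }

/-- The names of the stacks. -/
inductive K
  | A | B | F | U | D | T | PT | SC | S2 | CUR | OUT | P | VS | C

namespace K

def pos : K → Fin 14
  | A => 0 | B => 1 | F => 2 | U => 3 | D => 4 | T => 5 | PT => 6 | SC => 7 | S2 => 8 | CUR => 9
  | OUT => 10 | P => 11 | VS => 12 | C => 13

def ofPos : Fin 14 → K
  | 0 => A | 1 => B | 2 => F | 3 => U | 4 => D | 5 => T | 6 => PT | 7 => SC | 8 => S2 | 9 => CUR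
  | 10 => OUT | 11 => P | 12 => VS | 13 => C

theorem ofPos_pos (k : K) : ofPos k.pos = k := by cases k <;> rfl

theorem pos_ofPos (i : Fin 14) : (ofPos i).pos = i := by revert i; decide

end K

/-- The contents of the stacks. -/
structure Mem where
  -- `A` and `B` hold the model word, already read and still to be read; `F` holds formula letters,
  -- the last on top; `U` holds one symbol per world and `C` its used part, as a counter. `D` holds
  -- the data of all worlds; `T`, `PT`, `SC`, `S2`, `CUR` and `OUT` are working space; `P` holds the
  -- digits of a proposition and `VS` the vectors of truth values.
  A : List Sym := []
  B : List Sym := []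
  F : List Sym := []
  U : List Sym := []
  D : List Sym := []
  T : List Sym := []
  PT : List Sym := []
  SC : List Sym := []
  S2 : List Sym := []
  CUR : List Sym := []
  OUT : List Sym := []
  P : List Sym := []
  VS : List Sym := []
  C : List Sym := []

namespace Mem

def get (m : Mem) : K → List Sym
  | .A => m.A | .B => m.B | .F => m.F | .U => m.U | .D => m.D | .T => m.T | .PT => m.PT
  | .SC => m.SC | .S2 => m.S2 | .CUR => m.CUR | .OUT => m.OUT | .P => m.P | .VS => m.VS | .C => m.C

def set (m : Mem) (k : K) (l : List Sym) : Mem :=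
  match k with
  | .A => { m with A := l } | .B => { m with B := l } | .F => { m with F := l }
  | .U => { m with U := l } | .D => { m with D := l } | .T => { m with T := l }
  | .PT => { m with PT := l } | .SC => { m with SC := l } | .S2 => { m with S2 := l }
  | .CUR => { m with CUR := l } | .OUT => { m with OUT := l } | .P => { m with P := l }
  | .VS => { m with VS := l } | .C => { m with C := l }

theorem get_set_self (m : Mem) (k : K) (l : List Sym) : (m.set k l).get k = l := by
  cases k <;> rfl

theorem get_set_of_ne (m : Mem) {k k' : K} (h : k' ≠ k) (l : List Sym) :
    (m.set k l).get k' = m.get k' := by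
  cases k <;> cases k' <;> first | rfl | exact absurd rfl h

theorem set_get_self (m : Mem) (k : K) : m.set k (m.get k) = m := by
  cases k <;> rfl

theorem set_set (m : Mem) (k : K) (l l' : List Sym) : (m.set k l).set k l' = m.set k l' := by
  cases k <;> rfl

theorem set_comm (m : Mem) {k k' : K} (h : k ≠ k') (l l' : List Sym) :
    (m.set k l).set k' l' = (m.set k' l').set k l := by
  cases k <;> cases k' <;> first | rfl | exact absurd rfl h

/-- The stacks by number. -/
def fn (m : Mem) (i : Fin 14) : List Sym := m.get (K.ofPos i)

theorem fn_pos (m : Mem) (k : K) : m.fn k.pos = m.get k := by rw [fn, K.ofPos_pos]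

theorem update_fn (m : Mem) (k : K) (l : List Sym) :
    Function.update m.fn k.pos l = (m.set k l).fn := by
  funext i
  by_cases h : i = k.pos
  · subst h; rw [Function.update_self, fn_pos, get_set_self]
  · rw [Function.update_of_ne h, fn, fn, get_set_of_ne]
    rintro rfl
    exact h (K.pos_ofPos i).symm

end Mem

abbrev Prog := StackProg 14 Sym

open StackProg

abbrev push (k : K) (s : Sym) : Prog := .push k.pos s
abbrev case (k : K) (f : Option Sym → Prog) : Prog := .case k.pos f
abbrev loop (k : K) (ends : Option Sym → Bool) (body : Option Sym → Prog) : Prog :=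
  .loop k.pos ends body

infixr:60 " ;; " => StackProg.seq

/-- Pop and process symbols until the stack is empty. -/
def forEach (k : K) (body : Sym → Prog) : Prog :=
  loop k Option.isNone fun o => o.elim skip body

/-- `p` leads from `m` to `m'`, with at most `T` loop tests. -/
def Runs (p : Prog) (m : Mem) (T : ℕ) (m' : Mem) : Prop := ∃ t ≤ T, Exec p m.fn t m'.fn

namespace Runs

variable {p q : Prog} {m m' m'' : Mem} {T T' : ℕ}

theorem mono (h : Runs p m T m') (hT : T ≤ T') : Runs p m T' m' :=
  h.imp fun _ h => ⟨h.1.trans hT, h.2⟩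

theorem cast (h : Runs p m T m') (hm : m' = m'') : Runs p m T m'' := hm ▸ h

theorem seq (h : Runs p m T m') (h' : Runs q m' T' m'') : Runs (p ;; q) m (T + T') m'' := by
  obtain ⟨t, ht, h⟩ := h
  obtain ⟨t', ht', h'⟩ := h'
  exact ⟨t + t', Nat.add_le_add ht ht', .seq h h'⟩

theorem push (k : K) (s : Sym) (m : Mem) : Runs (push k s) m 0 (m.set k (s :: m.get k)) :=
  ⟨0, le_rfl, by rw [← Mem.update_fn, ← Mem.fn_pos]; exact .push _ _ _⟩

theorem case {k : K} {f : Option Sym → Prog}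
    (h : Runs (f (m.get k).head?) (m.set k (m.get k).tail) T m') : Runs (case k f) m T m' := by
  obtain ⟨t, ht, h⟩ := h
  exact ⟨t, ht, .case (by rw [Mem.update_fn, Mem.fn_pos]; exact h)⟩

theorem forEach_nil {k : K} {body : Sym → Prog} (hk : m.get k = []) :
    Runs (forEach k body) m 1 m := by
  have := Exec.ends (k := k.pos) (ends := Option.isNone) (body := fun o : Option Sym => o.elim skip body)
    (S := m.fn) (by rw [Mem.fn_pos, hk]; rfl)
  rw [Mem.update_fn, Mem.fn_pos, hk, List.tail_nil, ← hk, Mem.set_get_self] at this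
  exact ⟨1, le_rfl, this⟩

theorem forEach_cons {k : K} {body : Sym → Prog} {s : Sym} {l : List Sym} (hk : m.get k = s :: l)
    (h : Runs (body s) (m.set k l) T m') (h' : Runs (forEach k body) m' T' m'') :
    Runs (forEach k body) m (1 + T + T') m'' := by
  obtain ⟨t, ht, h⟩ := h
  obtain ⟨t', ht', h'⟩ := h'
  refine ⟨1 + t + t', by omega, .step (by rw [Mem.fn_pos, hk]; rfl) ?_ h'⟩
  rw [Mem.update_fn, Mem.fn_pos, hk]
  exact h

/-- The outcome of a program without guesses is unique. -/
theorem unique (h : Runs p m T m') (hp : Det p) {t : ℕ} {S : Fin 14 → List Sym}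
    (h' : Exec p m.fn t S) : S = m'.fn := by
  obtain ⟨_, _, h⟩ := h
  exact (h.det hp h').symm

end Runs

/-- The outcome of a program without loops. -/
def run : Prog → Mem → Option Mem
  | .skip, m => some m
  | .fail, _ => none
  | .push k s, m => some (m.set (K.ofPos k) (s :: m.get (K.ofPos k)))
  | .case k f, m => run (f (m.get (K.ofPos k)).head?) (m.set (K.ofPos k) (m.get (K.ofPos k)).tail)
  | .seq p q, m => (run p m).bind (run q)
  | .loop _ _ _, _ => none
  | .guess _, _ => none

/-- Loop-free pieces of programs are executed by definitional unfolding, so their runs are mostly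
proved by `rfl`. -/
theorem Runs.of_run : ∀ {p : Prog} {m m' : Mem}, run p m = some m' → Runs p m 0 m'
  | .skip, m, m', h => by
    cases h
    exact ⟨0, le_rfl, .skip _⟩
  | .push k s, m, m', h => by
    cases h
    have := Runs.push (K.ofPos k) s m
    rwa [Verifier.push, K.pos_ofPos] at this
  | .case k f, m, m', h => by
    have := Runs.case (k := K.ofPos k) (f := f) (Runs.of_run h)
    rwa [Verifier.case, K.pos_ofPos] at this
  | .seq p q, m, m', h => by
    rw [run, Option.bind_eq_some_iff] at h
    obtain ⟨m₁, h₁, h₂⟩ := h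
    exact (Runs.of_run h₁).seq (Runs.of_run h₂)
  | .fail, _, _, h => by cases h
  | .loop _ _ _, _, _, h => by cases h
  | .guess _, _, _, h => by cases h

/-- Some rounds of `forEach k body` lead from `m` to `m'`. -/
def Rounds (k : K) (body : Sym → Prog) (m : Mem) (t : ℕ) (m' : Mem) : Prop :=
  ∀ T m'', Runs (forEach k body) m' T m'' → Runs (forEach k body) m (t + T) m''

namespace Rounds

variable {k : K} {body : Sym → Prog} {m m' m'' : Mem} {t t' : ℕ}

theorem refl : Rounds k body m 0 m := fun T m'' h => by rwa [Nat.zero_add]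

theorem trans (h : Rounds k body m t m') (h' : Rounds k body m' t' m'') :
    Rounds k body m (t + t') m'' := fun T _ h'' => by
  rw [Nat.add_assoc]; exact h _ _ (h' _ _ h'')

theorem mono (h : Rounds k body m t m') (ht : t ≤ t') : Rounds k body m t' m' :=
  fun T _ h' => (h T _ h').mono (by omega)

theorem cast (h : Rounds k body m t m') (hm : m' = m'') : Rounds k body m t m'' := hm ▸ h

theorem one {s : Sym} {l : List Sym} (hk : m.get k = s :: l)
    (h : Runs (body s) (m.set k l) t m') : Rounds k body m (t + 1) m' := fun T _ h' =>
  (Runs.forEach_cons hk h h').mono (by omega)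

theorem runs (h : Rounds k body m t m') (hk : m'.get k = []) : Runs (forEach k body) m (t + 1) m' :=
  h 1 _ (Runs.forEach_nil hk)

end Rounds

/-- Move the symbols of a stack, changed by `f`, to another stack, in reverse order. -/
def move (k k' : K) (f : Sym → Sym) : Prog := forEach k fun s => push k' (f s)

theorem runs_move {k k' : K} (hk : k ≠ k') (f : Sym → Sym) (m : Mem) :
    Runs (move k k' f) m ((m.get k).length + 1)
      ((m.set k []).set k' (((m.get k).map f).reverse ++ m.get k')) := by
  generalize hl : m.get k = l
  induction l generalizing m with
  | nil =>
    refine (Runs.forEach_nil hl).cast ?_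
    rw [← hl, Mem.set_get_self, hl, List.map_nil, List.reverse_nil, List.nil_append,
      Mem.set_get_self]
  | cons s l ih =>
    refine ((Runs.forEach_cons hl (Runs.push k' (f s) (m.set k l)) (ih _ ?_)).mono ?_).cast ?_
    · rw [Mem.get_set_of_ne _ hk, Mem.get_set_self]
    · simp; omega
    · have : ((m.set k l).set k' (f s :: (m.set k l).get k')).set k [] =
          (m.set k []).set k' (f s :: m.get k') := by
        rw [Mem.set_comm _ hk.symm, Mem.set_set, Mem.get_set_of_ne _ hk.symm]
      rw [this, Mem.set_set, Mem.get_set_self, Mem.get_set_of_ne _ hk.symm]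
      simp

/-- Empty a stack. -/
def clear (k : K) : Prog := forEach k fun _ => skip

theorem runs_clear (k : K) (m : Mem) : Runs (clear k) m ((m.get k).length + 1) (m.set k []) := by
  generalize hl : m.get k = l
  induction l generalizing m with
  | nil => exact (Runs.forEach_nil hl).cast (by rw [← hl, Mem.set_get_self])
  | cons s l ih =>
    refine ((Runs.forEach_cons hl (Runs.of_run rfl) (ih _ (Mem.get_set_self _ _ _))).mono ?_).cast
      (Mem.set_set _ _ _ _)
    simp; omega

end Verifier

/-! ### The verifier: exchanging information along edges -/

/-- The data of a word that looks like the word of a model. -/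
structure WordData (n : ℕ) where
  st : Fin n → Letter
  e : Fin n → Fin n → Bool
  lab : Fin n → List ℕ
  st_mem : ∀ w, st w = Letter.root ∨ st w = Letter.world ∨ st w = Letter.absent

namespace WordData

variable {n : ℕ} (M : WordData n)

def row (w : Fin n) (v : Fin n) : Letter := if M.e w v then Letter.edge else Letter.noEdge

def block (w : Fin n) : List Letter :=
  M.st w :: ((List.finRange n).map (M.row w) ++ ((M.lab w).flatMap encodeNum ++ [Letter.endWorld]))

def word : List Letter := (List.finRange n).flatMap M.block

/-- Some predecessor stores `true`. -/
def pred (Z : Fin n → Bool) (w : Fin n) : Bool := (List.finRange n).any fun v => M.e v w && Z v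

/-- Each block contains a status letter and a row of `n` letters. The time analysis bounds the
number of worlds in this way. -/
theorem card_le_word : n * (n + 1) ≤ M.word.length := by
  have : ∀ l : List (Fin n), l.length * (n + 1) ≤ (l.flatMap M.block).length := by
    intro l
    induction l with
    | nil => simp
    | cons w l ih =>
      simp only [List.flatMap_cons, List.length_append, List.length_cons, Nat.add_mul, one_mul]
      simp only [block, List.length_cons, List.length_append, List.length_map, List.length_finRange]
      omega
  simpa [word] using this (List.finRange n)

end WordData

theorem le_two_of_mem_encodeNum {k : ℕ} {l : Letter} (h : l ∈ encodeNum k) : l.val ≤ 2 := by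
  simp only [encodeNum, List.mem_append, List.mem_map, List.mem_singleton] at h
  rcases h with ⟨b, -, rfl⟩ | rfl
  · cases b <;> decide
  · decide

namespace Verifier

open StackProg

/-- Process a letter of the model in the exchange of information along edges. -/
def stepBody (s : Sym) : Prog :=
  push .A s ;;
  -- `SC` advances in step with the columns of the matrix. At an edge the current world `c` learns
  -- the bit of its successor `t`, and `t` learns the bit of its predecessor `c`.
  if s.lt = Letter.edge then
    case .CUR fun o => o.elim fail fun c => case .SC fun o' => o'.elim fail fun t =>
      push .CUR { c with x := c.x || t.z } ;; push .S2 { t with y := t.y || c.z }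
  else if s.lt = Letter.noEdge then
    case .SC fun o' => o'.elim fail fun t => push .S2 t
  else if s.lt = Letter.endWorld then
    (case .CUR fun o => o.elim fail fun c => push .OUT c) ;; move .S2 .SC id
  else if s.lt.val ≤ 2 then skip
  else case .PT fun o => o.elim fail fun d => push .CUR { d with lt := s.lt, x := false }

/-- Every world learns whether successors or predecessors store `true`, and stores a new bit. -/
def step (g : Sym → Bool) : Prog :=
  move .D .T id ;;
  -- Two copies of the data: `PT` is used up row by row, `SC` is traversed once for every row.
  forEach .T (fun s => push .PT s ;; push .SC { s with y := false }) ;;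
  forEach .B stepBody ;;
  move .A .B id ;;
  move .SC .S2 id ;;
  forEach .OUT fun c => case .S2 fun o => o.elim fail fun t =>
    push .D { c with y := t.y, z := g { c with y := t.y } }

variable {n : ℕ} (M : WordData n) (m : Mem)

theorem rounds_row (e : Fin n → Bool) (t : Fin n → Sym) (vs : List (Fin n)) :
    ∀ (a b sc s2 : List Sym) (c : Sym), Rounds .B stepBody
      { m with
        A := a
        B := vs.map (fun v => sym (if e v then Letter.edge else Letter.noEdge)) ++ b
        SC := vs.map t ++ sc
        S2 := s2
        CUR := [c] } vs.length
      { m with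
        A := (vs.map fun v => sym (if e v then Letter.edge else Letter.noEdge)).reverse ++ a
        B := b
        SC := sc
        S2 := (vs.map fun v => { t v with y := (t v).y || (e v && c.z) }).reverse ++ s2
        CUR := [{ c with x := c.x || vs.any fun v => e v && (t v).z }] } := by
  induction vs with
  | nil => intro a b sc s2 c; exact Rounds.refl.cast (by simp)
  | cons v vs ih =>
    intro a b sc s2 c
    cases he : e v
    · refine ((Rounds.one rfl (Runs.of_run (m' := { m with
        A := sym Letter.noEdge :: a
        B := vs.map (fun v => sym (if e v then Letter.edge else Letter.noEdge)) ++ b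
        SC := vs.map t ++ sc
        S2 := t v :: s2
        CUR := [c] }) ?_)).trans (ih _ _ _ _ _)).mono (by simp; omega) |>.cast ?_
      · simp only [List.map_cons, he]; rfl
      · simp [he]
    · refine ((Rounds.one rfl (Runs.of_run (m' := { m with
        A := sym Letter.edge :: a
        B := vs.map (fun v => sym (if e v then Letter.edge else Letter.noEdge)) ++ b
        SC := vs.map t ++ sc
        S2 := { t v with y := (t v).y || c.z } :: s2
        CUR := [{ c with x := c.x || (t v).z }] }) ?_)).trans (ih _ _ _ _ _)).mono (by simp; omega)
          |>.cast ?_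
      · simp only [List.map_cons, he]; rfl
      · simp [he, Bool.or_assoc]

theorem rounds_digits (ls : List Letter) (hls : ∀ l ∈ ls, l.val ≤ 2) : ∀ (a b : List Sym),
    Rounds .B stepBody { m with A := a, B := ls.map sym ++ b } ls.length
      { m with A := (ls.map sym).reverse ++ a, B := b } := by
  induction ls with
  | nil => intro a b; exact Rounds.refl
  | cons l ls ih =>
    intro a b
    refine ((Rounds.one rfl (Runs.of_run (m' := { m with A := sym l :: a, B := ls.map sym ++ b }) ?_)).trans
      (ih (fun l hl => hls l (by simp [hl])) _ _)).mono (by simp; omega) |>.cast (by simp)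
    have hl := hls l (by simp)
    obtain rfl | rfl | rfl : l = 0 ∨ l = 1 ∨ l = 2 := by
      clear ih hls; revert hl; revert l; decide
    all_goals rfl

theorem rounds_endWorld (a b s2 o : List Sym) (c : Sym) :
    Rounds .B stepBody
      { m with A := a, B := sym Letter.endWorld :: b, S2 := s2, SC := [], CUR := [c], OUT := o }
      (s2.length + 2)
      { m with A := sym Letter.endWorld :: a, B := b, S2 := [], SC := s2.reverse, CUR := [],
               OUT := c :: o } := by
  have hs : stepBody (sym Letter.endWorld) = (push .A (sym Letter.endWorld) ;;
      (case .CUR fun o => o.elim fail fun c => push .OUT c) ;; move .S2 .SC id) := rfl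
  refine (Rounds.one rfl ?_).mono (t := s2.length + 1 + 1) (by omega)
  rw [hs]
  refine ((Runs.of_run (m' := { m with
    A := sym Letter.endWorld :: a, B := b, S2 := s2, SC := [], CUR := [c], OUT := o }) rfl).seq
    ((Runs.of_run (m' := { m with
    A := sym Letter.endWorld :: a, B := b, S2 := s2, SC := [], CUR := [], OUT := c :: o }) rfl).seq
    (runs_move (k := .S2) (k' := .SC) nofun id _))).mono ?_ |>.cast ?_
  · simp [Mem.get]
  · simp [Mem.get, Mem.set]

theorem rounds_block (w : Fin n) (a b pt o : List Sym) (d : Sym) (t : Fin n → Sym) :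
    Rounds .B stepBody
      { m with
        A := a
        B := (M.block w).map sym ++ b
        PT := d :: pt
        SC := (List.finRange n).map t
        S2 := []
        OUT := o
        CUR := [] } ((M.block w).length + (n + 1))
      { m with
        A := ((M.block w).map sym).reverse ++ a
        B := b
        PT := pt
        SC := (List.finRange n).map fun v => { t v with y := (t v).y || (M.e w v && d.z) }
        S2 := []
        OUT := { d with lt := M.st w, x := VecOp.succ M.e (fun v => (t v).z) w } :: o
        CUR := [] } := by
  have hB : (M.block w).map sym ++ b = sym (M.st w) ::
      ((List.finRange n).map (fun v => sym (if M.e w v then Letter.edge else Letter.noEdge)) ++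
        (((M.lab w).flatMap encodeNum).map sym ++ (sym Letter.endWorld :: b))) := by
    simp [WordData.block, WordData.row, Function.comp_def]
  rw [hB]
  have h₁ : Rounds .B stepBody { m with
        A := a
        B := sym (M.st w) ::
          ((List.finRange n).map (fun v => sym (if M.e w v then Letter.edge else Letter.noEdge)) ++
            (((M.lab w).flatMap encodeNum).map sym ++ (sym Letter.endWorld :: b)))
        PT := d :: pt
        SC := (List.finRange n).map t
        S2 := []
        OUT := o
        CUR := [] } 1 { m with
        A := sym (M.st w) :: a
        B := (List.finRange n).map (fun v => sym (if M.e w v then Letter.edge else Letter.noEdge)) ++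
            (((M.lab w).flatMap encodeNum).map sym ++ (sym Letter.endWorld :: b))
        PT := pt
        SC := (List.finRange n).map t ++ []
        S2 := []
        OUT := o
        CUR := [{ d with lt := M.st w, x := false }] } := by
    refine Rounds.one rfl (Runs.of_run ?_)
    rw [List.append_nil]
    rcases M.st_mem w with h | h | h <;> rw [h] <;> rfl
  have h₂ := rounds_row { m with PT := pt, OUT := o } (M.e w) t (List.finRange n) (sym (M.st w) :: a)
    (((M.lab w).flatMap encodeNum).map sym ++ (sym Letter.endWorld :: b)) [] []
    { d with lt := M.st w, x := false }
  have hdig : ∀ l ∈ (M.lab w).flatMap encodeNum, l.val ≤ 2 := fun l hl => by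
    obtain ⟨k, -, hk⟩ := List.mem_flatMap.1 hl
    exact le_two_of_mem_encodeNum hk
  have h₃ := rounds_digits { m with
        PT := pt
        SC := []
        S2 := ((List.finRange n).map fun v => { t v with y := (t v).y || (M.e w v && d.z) }).reverse ++ []
        OUT := o
        CUR := [{ d with
          lt := M.st w
          x := false || (List.finRange n).any fun v => M.e w v && (t v).z }] } _ hdig
    (((List.finRange n).map fun v => sym (if M.e w v then Letter.edge else Letter.noEdge)).reverse ++
      sym (M.st w) :: a) (sym Letter.endWorld :: b)
  have h₄ := rounds_endWorld { m with PT := pt }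
    ((((M.lab w).flatMap encodeNum).map sym).reverse ++
      (((List.finRange n).map fun v => sym (if M.e w v then Letter.edge else Letter.noEdge)).reverse ++
      sym (M.st w) :: a)) b
    (((List.finRange n).map fun v => { t v with y := (t v).y || (M.e w v && d.z) }).reverse ++ []) o
    { d with lt := M.st w, x := false || (List.finRange n).any fun v => M.e w v && (t v).z }
  refine ((h₁.trans (h₂.trans (h₃.trans h₄))).mono ?_).cast ?_
  · simp only [WordData.block, List.length_cons, List.length_append, List.length_map,
      List.length_finRange, List.length_reverse, List.length_nil]
    omega
  · simp [WordData.block, WordData.row, VecOp.succ, Function.comp_def]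

/-- What a world knows after a step. -/
def stepInfo (d : Fin n → Sym) (w : Fin n) : Sym :=
  { d w with
    lt := M.st w
    x := VecOp.succ M.e (fun v => (d v).z) w
    y := M.pred (fun v => (d v).z) w }

/-- The copies `t` for the columns accumulate their bits `y` from row to row, while their bits `z`
remain those of `d`. Hence every row still sees the bits stored before the step. -/
theorem rounds_blocks (d : Fin n → Sym) (ws : List (Fin n)) :
    ∀ (a b pt o : List Sym) (t : Fin n → Sym) (_ : ∀ v, (t v).z = (d v).z), Rounds .B stepBody
      { m with
        A := a
        B := (ws.flatMap M.block).map sym ++ b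
        PT := ws.map d ++ pt
        SC := (List.finRange n).map t
        S2 := []
        OUT := o
        CUR := [] } ((ws.flatMap M.block).length + ws.length * (n + 1))
      { m with
        A := ((ws.flatMap M.block).map sym).reverse ++ a
        B := b
        PT := pt
        SC := (List.finRange n).map fun v =>
          { t v with y := (t v).y || ws.any fun w => M.e w v && (d w).z }
        S2 := []
        OUT := (ws.map fun w =>
          { d w with lt := M.st w, x := VecOp.succ M.e (fun v => (d v).z) w }).reverse ++ o
        CUR := [] } := by
  induction ws with
  | nil => 
    intro a b pt o t _
    refine (Rounds.refl.mono (Nat.zero_le _)).cast ?_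
    simp
  | cons w ws ih =>
    intro a b pt o t ht
    have h₁ := rounds_block M m w a ((ws.flatMap M.block).map sym ++ b) (ws.map d ++ pt) o (d w) t
    have h₂ := ih (((M.block w).map sym).reverse ++ a) b pt
      ({ d w with lt := M.st w, x := VecOp.succ M.e (fun v => (t v).z) w } :: o)
      (fun v => { t v with y := (t v).y || (M.e w v && (d w).z) }) ht
    rw [List.flatMap_cons, List.map_append, List.append_assoc]
    refine (h₁.trans h₂).mono ?_ |>.cast ?_
    · simp only [List.length_append, List.length_cons, Nat.add_mul, one_mul]
      omega
    · simp [ht, Bool.or_assoc]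

theorem runs_distribute (l : List Sym) : ∀ p q : List Sym,
    Runs (forEach .T (fun s => push .PT s ;; push .SC { s with y := false }))
      { m with T := l, PT := p, SC := q } (l.length + 1)
      { m with T := [], PT := l.reverse ++ p,
               SC := (l.map fun s => { s with y := false }).reverse ++ q } := by
  induction l with
  | nil => intro p q; exact Runs.forEach_nil rfl
  | cons s l ih =>
    intro p q
    refine ((Runs.forEach_cons rfl (Runs.of_run rfl) (ih (s :: p) ({ s with y := false } :: q))).mono
      (by simp; omega)).cast (by simp)

theorem runs_collect (g : Sym → Bool) (c t : Fin n → Sym) (ws : List (Fin n)) : ∀ d : List Sym,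
    Runs (forEach .OUT fun c => case .S2 fun o => o.elim fail fun t =>
      push .D { c with y := t.y, z := g { c with y := t.y } })
      { m with OUT := ws.map c, S2 := ws.map t, D := d } (ws.length + 1)
      { m with OUT := [], S2 := [],
               D := (ws.map fun w => { c w with y := (t w).y, z := g { c w with y := (t w).y } }).reverse ++ d } := by
  induction ws with
  | nil => intro d; exact Runs.forEach_nil rfl
  | cons w ws ih =>
    intro d
    refine ((Runs.forEach_cons rfl (Runs.of_run rfl)
      (ih ({ c w with y := (t w).y, z := g { c w with y := (t w).y } } :: d))).mono
      (by simp; omega)).cast (by simp)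

/-- The memory between the main parts of the verifier. -/
def base (F U P VS C : List Sym) : Mem := { B := M.word.map sym, F := F, U := U, P := P, VS := VS, C := C }

/-- The word is read once and moved back once, which gives `2 * M.word.length`. Restoring `SC` after
each of the `n` rows gives `n * (n + 1)`, and the remaining summands come from turning over stacks.
-/
theorem runs_step (g : Sym → Bool) (d : Fin n → Sym) (F U P VS C : List Sym) :
    Runs (step g) { base M F U P VS C with D := (List.finRange n).map d }
      (2 * M.word.length + n * (n + 1) + 4 * n + 6)
      { base M F U P VS C with
        D := (List.finRange n).map fun w => { stepInfo M d w with z := g (stepInfo M d w) } } := by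
  have h₁ := runs_move (k := .D) (k' := .T) nofun id
    { base M F U P VS C with D := (List.finRange n).map d }
  have h₂ := runs_distribute (base M F U P VS C) ((List.finRange n).map d).reverse [] []
  have h₃ := (rounds_blocks M (base M F U P VS C) d (List.finRange n) [] [] [] []
    (fun v => { d v with y := false }) (fun _ => rfl)).runs rfl
  have h₄ := runs_move (k := .A) (k' := .B) nofun id { base M F U P VS C with
    A := (M.word.map sym).reverse
    B := []
    SC := (List.finRange n).map fun v => { d v with y := M.pred (fun v => (d v).z) v }
    OUT := ((List.finRange n).map fun w =>
          { d w with lt := M.st w, x := VecOp.succ M.e (fun v => (d v).z) w }).reverse }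
  have h₅ := runs_move (k := .SC) (k' := .S2) nofun id { base M F U P VS C with
    SC := (List.finRange n).map fun v => { d v with y := M.pred (fun v => (d v).z) v }
    OUT := ((List.finRange n).map fun w =>
          { d w with lt := M.st w, x := VecOp.succ M.e (fun v => (d v).z) w }).reverse }
  have h₆ := runs_collect (base M F U P VS C) g
    (fun w => { d w with lt := M.st w, x := VecOp.succ M.e (fun v => (d v).z) w })
    (fun v => { d v with y := M.pred (fun v => (d v).z) v }) (List.finRange n).reverse []
  refine ((h₁.cast ?_).seq ((h₂.cast ?_).seq ((h₃.cast ?_).seq ((h₄.cast ?_).seq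
    ((h₅.cast ?_).seq h₆))))).mono ?_ |>.cast ?_
  · simp [Mem.get, Mem.set, base]
  · simp [Mem.get, Mem.set, base, WordData.word]
  · simp [Mem.get, Mem.set, base, WordData.word, WordData.pred]
  · simp [Mem.get, Mem.set, base]
  · simp [Mem.get, Mem.set, base]
  · simp only [Mem.get, WordData.word, List.length_append, List.length_map, List.length_finRange,
      List.length_reverse]
    omega
  · simp [stepInfo, base]

end Verifier

/-! ### The verifier: labels and vectors of truth values -/

namespace Verifier

open StackProg

/-- Compare a digit with the next digit on the stack `P`, which is saved on `S2`. -/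
def compareDigit (l : Letter) : Prog :=
  case .CUR fun o => o.elim fail fun c => case .P fun o' =>
    push .CUR { c with x := c.x && o'.elim false fun h => decide (l = h.lt) } ;;
      o'.elim skip fun h => push .S2 h

/-- Process a letter of the model in the search for the label on the stack `P`. -/
def labelBody (s : Sym) : Prog :=
  push .A s ;;
  if s.lt.val < 2 then compareDigit s.lt
  else if s.lt = Letter.endNum then
    -- The end marker is compared as well. Then `x` says whether the entire number agreed; this is
    -- recorded in `z`, and the digits saved on `S2` return to `P`.
    compareDigit s.lt ;;
    (case .CUR fun o => o.elim fail fun c => push .CUR { x := true, z := c.z || c.x }) ;;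
    move .S2 .P id
  else if s.lt = Letter.edge then skip
  else if s.lt = Letter.noEdge then skip
  else if s.lt = Letter.endWorld then case .CUR fun o => o.elim fail fun c => push .OUT c
  else push .CUR { x := true }

/-- Find the worlds whose labels contain the number on the stack `P`. -/
def label : Prog := forEach .B labelBody ;; move .A .B id ;; clear .P ;; move .OUT .D id

variable {n : ℕ} (M : WordData n) (m : Mem)

/-- `ps` are the digits still to be compared, `s2` those already compared; `e` tells whether all
comparisons succeeded so far, and `f` whether an earlier label was a hit. If `ps` runs out, the
comparison fails. -/
theorem rounds_labelBody_num (ds : List Letter) (hds : ∀ l ∈ ds, l.val < 2) (f : Bool) (b : List Sym) :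
    ∀ (e : Bool) (ps : List Letter) (s2 a : List Sym), Rounds .B labelBody
      { m with
        A := a
        B := (ds ++ [Letter.endNum]).map sym ++ b
        P := ps.map sym
        S2 := s2
        CUR := [{ x := e, z := f }] } (2 * (ds.length + 1) + s2.length + 1)
      { m with
        A := ((ds ++ [Letter.endNum]).map sym).reverse ++ a
        B := b
        P := s2.reverse ++ ps.map sym
        S2 := []
        CUR := [{ x := true, z := f || (e && (ds ++ [Letter.endNum]).isPrefixOf ps) }] } := by
  induction ds with
  | nil =>
    intro e ps s2 a
    cases ps with
    | nil =>
      refine (Rounds.one rfl ((Runs.push .A _ _).seq ((Runs.of_run (m' := { m with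
        A := sym Letter.endNum :: a
        B := b
        P := []
        S2 := s2
        CUR := [{ x := e && false, z := f }] }) rfl).seq ((Runs.of_run (m' := { m with
        A := sym Letter.endNum :: a
        B := b
        P := []
        S2 := s2
        CUR := [{ x := true, z := f || (e && false) }] }) rfl).seq
        (runs_move (k := .S2) (k' := .P) nofun id _))))).mono ?_ |>.cast ?_
      · simp [Mem.get]
      · simp [Mem.get, Mem.set]
    | cons p ps =>
      refine (Rounds.one rfl ((Runs.push .A _ _).seq ((Runs.of_run (m' := { m with
        A := sym Letter.endNum :: a
        B := b
        P := ps.map sym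
        S2 := sym p :: s2
        CUR := [{ x := e && decide (Letter.endNum = p), z := f }] }) rfl).seq ((Runs.of_run (m' := { m with
        A := sym Letter.endNum :: a
        B := b
        P := ps.map sym
        S2 := sym p :: s2
        CUR := [{ x := true, z := f || (e && decide (Letter.endNum = p)) }] }) rfl).seq
        (runs_move (k := .S2) (k' := .P) nofun id _))))).mono ?_ |>.cast ?_
      · simp [Mem.get]; omega
      · simp [Mem.get, Mem.set, List.isPrefixOf, Bool.beq_eq_decide_eq]
  | cons d ds ih =>
    intro e ps s2 a
    have hd : labelBody (sym d) = (push .A (sym d) ;; compareDigit d) := by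
      have := hds d (by simp)
      simp [labelBody, this]
    cases ps with
    | nil =>
      refine ((Rounds.one rfl ?_).trans (ih (fun l hl => hds l (by simp [hl])) (e && false) [] s2
        (sym d :: a))).mono (t := 0 + 1 + _) ?_ |>.cast ?_
      · rw [hd]; exact Runs.of_run rfl
      · simp; omega
      · simp
    | cons p ps =>
      refine ((Rounds.one rfl ?_).trans (ih (fun l hl => hds l (by simp [hl])) (e && decide (d = p)) ps
        (sym p :: s2) (sym d :: a))).mono (t := 0 + 1 + _) ?_ |>.cast ?_
      · rw [hd]; exact Runs.of_run rfl
      · simp; omega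
      · simp [List.isPrefixOf, Bool.and_assoc, Bool.beq_eq_decide_eq]

/-- The end marker makes the code of numbers prefix-free, so the digitwise prefix test decides
equality. -/
theorem isPrefixOf_encodeNum {k p : ℕ} : (encodeNum k).isPrefixOf (encodeNum p) = decide (k = p) := by
  rw [Bool.eq_iff_iff, List.isPrefixOf_iff_prefix, decide_eq_true_iff]
  constructor
  · rintro ⟨s, hs⟩
    exact (encodeNum_append (hs.trans (List.append_nil _).symm)).1
  · rintro rfl
    exact List.prefix_refl _

theorem rounds_labelBody_nums (p : ℕ) (b : List Sym) (ks : List ℕ) : ∀ (f : Bool) (a : List Sym),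
    Rounds .B labelBody
      { m with
        A := a
        B := (ks.flatMap encodeNum).map sym ++ b
        P := (encodeNum p).map sym
        S2 := []
        CUR := [{ x := true, z := f }] } (3 * (ks.flatMap encodeNum).length)
      { m with
        A := ((ks.flatMap encodeNum).map sym).reverse ++ a
        B := b
        P := (encodeNum p).map sym
        S2 := []
        CUR := [{ x := true, z := f || decide (p ∈ ks) }] } := by
  induction ks with
  | nil => intro f a; exact Rounds.refl.cast (by simp)
  | cons k ks ih =>
    intro f a
    have h := rounds_labelBody_num m (k.bits.map (fun b => if b then Letter.one else Letter.zero))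
      (by
        intro l hl
        obtain ⟨b, -, rfl⟩ := List.mem_map.1 hl
        cases b <;> decide) f ((ks.flatMap encodeNum).map sym ++ b) true (encodeNum p) [] a
    rw [← encodeNum] at h
    have hlen : (k.bits.map (fun b => if b then Letter.one else Letter.zero)).length + 1 =
      (encodeNum k).length := by simp [encodeNum]
    rw [List.flatMap_cons, List.map_append, List.append_assoc]
    refine (h.trans (ih _ _)).mono ?_ |>.cast ?_
    · simp only [hlen, List.length_append, List.length_nil]
      omega
    · simp [isPrefixOf_encodeNum, Bool.or_assoc, eq_comm (a := k)]

theorem rounds_labelBody_row (e : Fin n → Bool) (b : List Sym) (vs : List (Fin n)) : ∀ a : List Sym,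
    Rounds .B labelBody
      { m with
        A := a
        B := vs.map (fun v => sym (if e v then Letter.edge else Letter.noEdge)) ++ b } vs.length
      { m with
        A := (vs.map fun v => sym (if e v then Letter.edge else Letter.noEdge)).reverse ++ a
        B := b } := by
  induction vs with
  | nil => intro a; exact Rounds.refl.cast (by simp)
  | cons v vs ih =>
    intro a
    refine ((Rounds.one rfl (Runs.of_run (m' := { m with
      A := sym (if e v then Letter.edge else Letter.noEdge) :: a
      B := vs.map (fun v => sym (if e v then Letter.edge else Letter.noEdge)) ++ b }) ?_)).trans
      (ih _)).mono (by simp; omega) |>.cast (by simp)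
    cases h : e v <;> simp only [List.map_cons, h] <;> rfl

theorem rounds_labelBody_blocks (p : ℕ) (b : List Sym) (ws : List (Fin n)) : ∀ (a o : List Sym),
    Rounds .B labelBody
      { m with
        A := a
        B := (ws.flatMap M.block).map sym ++ b
        P := (encodeNum p).map sym
        S2 := []
        CUR := []
        OUT := o } (3 * (ws.flatMap M.block).length)
      { m with
        A := ((ws.flatMap M.block).map sym).reverse ++ a
        B := b
        P := (encodeNum p).map sym
        S2 := []
        CUR := []
        OUT := (ws.map fun w => { x := true, z := decide (p ∈ M.lab w) }).reverse ++ o } := by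
  induction ws with
  | nil => intro a o; exact Rounds.refl.cast (by simp)
  | cons w ws ih =>
    intro a o
    have hB : ((w :: ws).flatMap M.block).map sym ++ b = sym (M.st w) ::
      ((List.finRange n).map (fun v => sym (if M.e w v then Letter.edge else Letter.noEdge)) ++
        (((M.lab w).flatMap encodeNum).map sym ++
          (sym Letter.endWorld :: ((ws.flatMap M.block).map sym ++ b)))) := by
      simp [WordData.block, WordData.row, Function.comp_def]
    rw [hB]
    have h₁ : ∀ b' : List Sym, Rounds .B labelBody { m with
        A := a
        B := sym (M.st w) :: b'
        P := (encodeNum p).map sym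
        S2 := []
        CUR := []
        OUT := o } 1 { m with
        A := sym (M.st w) :: a
        B := b'
        P := (encodeNum p).map sym
        S2 := []
        CUR := [{ x := true }]
        OUT := o } := by
      intro b'
      refine Rounds.one rfl (Runs.of_run ?_)
      rcases M.st_mem w with h | h | h <;> rw [h] <;> rfl
    have h₂ := rounds_labelBody_row { m with
        P := (encodeNum p).map sym, S2 := [], CUR := [{ x := true }], OUT := o } (M.e w)
      (((M.lab w).flatMap encodeNum).map sym ++
          (sym Letter.endWorld :: ((ws.flatMap M.block).map sym ++ b))) (List.finRange n) (sym (M.st w) :: a)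
    have h₃ := rounds_labelBody_nums { m with OUT := o } p
      (sym Letter.endWorld :: ((ws.flatMap M.block).map sym ++ b)) (M.lab w) false
      (((List.finRange n).map fun v => sym (if M.e w v then Letter.edge else Letter.noEdge)).reverse ++
        sym (M.st w) :: a)
    refine ((h₁ _).trans (h₂.trans (h₃.trans ((Rounds.one rfl (Runs.of_run (m' := { m with
        A := sym Letter.endWorld :: ((((M.lab w).flatMap encodeNum).map sym).reverse ++
          (((List.finRange n).map fun v => sym (if M.e w v then Letter.edge else Letter.noEdge)).reverse ++
            sym (M.st w) :: a))
        B := (ws.flatMap M.block).map sym ++ b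
        P := (encodeNum p).map sym
        S2 := []
        CUR := []
        OUT := { x := true, z := false || decide (p ∈ M.lab w) } :: o }) rfl)).trans (ih _ _))))).mono ?_
      |>.cast ?_
    · simp only [List.flatMap_cons, WordData.block, List.length_cons, List.length_append,
        List.length_map, List.length_finRange, List.length_nil]
      omega
    · simp [WordData.block, WordData.row, Function.comp_def]

theorem runs_label (p : ℕ) (F U VS C : List Sym) :
    Runs label (base M F U ((encodeNum p).map sym) VS C)
      (4 * M.word.length + n + (encodeNum p).length + 4)
      { base M F U [] VS C with
        D := (List.finRange n).map fun w => { x := true, z := decide (p ∈ M.lab w) } } := by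
  have h₁ := (rounds_labelBody_blocks M (base M F U ((encodeNum p).map sym) VS C) p []
    (List.finRange n) [] []).runs rfl
  rw [List.append_nil] at h₁
  have h₂ := runs_move (k := .A) (k' := .B) nofun id { base M F U ((encodeNum p).map sym) VS C with
    A := (M.word.map sym).reverse
    B := []
    OUT := ((List.finRange n).map fun w => ({ x := true, z := decide (p ∈ M.lab w) } : Sym)).reverse }
  have h₃ := runs_clear .P { base M F U ((encodeNum p).map sym) VS C with
    OUT := ((List.finRange n).map fun w => ({ x := true, z := decide (p ∈ M.lab w) } : Sym)).reverse }
  have h₄ := runs_move (k := .OUT) (k' := .D) nofun id { base M F U [] VS C with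
    OUT := ((List.finRange n).map fun w => ({ x := true, z := decide (p ∈ M.lab w) } : Sym)).reverse }
  refine (((h₁.cast ?_).seq ((h₂.cast ?_).seq ((h₃.cast ?_).seq h₄))).mono ?_).cast ?_
  · simp [base, WordData.word]
  · simp [base, Mem.get, Mem.set]
  · simp [base, Mem.get, Mem.set]
  · simp only [base, Mem.get, WordData.word, List.length_append, List.length_map, List.length_finRange,
      List.length_reverse]
    omega
  · simp [base, Mem.get, Mem.set]

/-! #### Vectors -/

/-- The bottom of a vector. -/
def mark : Sym := { lt := 1 }

/-- A vector on the stack `VS`. -/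
def vec (Z : Fin n → Bool) : List Sym := ((List.finRange n).map fun w => { z := Z w }).reverse ++ [mark]

def isMark (o : Option Sym) : Bool := o.elim true fun s => decide (s.lt = 1)

/-- Move the top vector to the stack `D`. -/
def unload : Prog := loop .VS isMark fun o => o.elim skip fun s => push .D s

/-- Store the bits on the stack `D`, changed by `f`, as a vector. -/
def store (f : Bool → Bool) : Prog := push .VS mark ;; move .D .VS fun s => { z := f s.z }

/-- Push as many copies of `s` as there are worlds. -/
def fill (k : K) (s : Sym) : Prog := forEach .U (fun u => push .C u ;; push k s) ;; move .C .U id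

/-- Repeat a step as often as there are worlds. -/
def stepAll (g : Sym → Bool) : Prog := forEach .U (fun u => push .C u ;; step g) ;; move .C .U id

theorem runs_loop_stop {ends : Option Sym → Bool} {body : Option Sym → Prog} {k : K} {m : Mem}
    (hs : ends (m.get k).head? = true) : Runs (loop k ends body) m 1 (m.set k (m.get k).tail) :=
  ⟨1, le_rfl, by rw [← Mem.update_fn, ← Mem.fn_pos] at *; exact .ends hs⟩

theorem runs_loop_step {ends : Option Sym → Bool} {body : Option Sym → Prog} {k : K} {m m' m'' : Mem}
    {T T' : ℕ} (hs : ends (m.get k).head? = false)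
    (h : Runs (body (m.get k).head?) (m.set k (m.get k).tail) T m')
    (h' : Runs (loop k ends body) m' T' m'') : Runs (loop k ends body) m (1 + T + T') m'' := by
  obtain ⟨t, ht, h⟩ := h
  obtain ⟨t', ht', h'⟩ := h'
  rw [← Mem.fn_pos] at hs
  rw [← Mem.update_fn, ← Mem.fn_pos] at h
  exact ⟨1 + t + t', by omega, .step hs h h'⟩

theorem runs_unload (Z : Fin n → Bool) (VS : List Sym) :
    Runs unload { m with VS := vec Z ++ VS, D := [] } (n + 1)
      { m with VS := VS, D := (List.finRange n).map fun w => { z := Z w } } := by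
  have : ∀ (l : List (Fin n)) (D : List Sym),
      Runs unload { m with VS := l.map (fun w => { z := Z w }) ++ mark :: VS, D := D } (l.length + 1)
        { m with VS := VS, D := (l.map fun w => { z := Z w }).reverse ++ D } := by
    intro l
    induction l with
    | nil => intro D; exact runs_loop_stop rfl
    | cons w l ih =>
      intro D
      exact ((runs_loop_step rfl (Runs.of_run rfl) (ih ({ z := Z w } :: D))).mono
        (by simp; omega)).cast (by simp)
  simpa [vec] using this (List.finRange n).reverse []

theorem runs_store (f : Bool → Bool) (d : Fin n → Sym) (VS : List Sym) :
    Runs (store f) { m with VS := VS, D := (List.finRange n).map d } (n + 1)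
      { m with VS := vec (fun w => f (d w).z) ++ VS, D := [] } :=
  (((Runs.push .VS mark _).seq (runs_move (k := .D) (k' := .VS) nofun _ _)).mono
    (by simp [Mem.get, Mem.set])).cast (by simp [Mem.get, Mem.set, vec, Function.comp_def])

theorem runs_stepAll (g : Sym → Bool) (d : Fin n → Sym) (F U P VS : List Sym) :
    Runs (stepAll g) { base M F U P VS [] with D := (List.finRange n).map d }
      (U.length * (2 * M.word.length + n * (n + 1) + 4 * n + 7) + U.length + 2)
      { base M F U P VS [] with
        D := (List.finRange n).map ((fun d w => { stepInfo M d w with z := g (stepInfo M d w) })^[U.length] d) } := by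
  have : ∀ (l c : List Sym) (d : Fin n → Sym), Runs (forEach .U (fun u => push .C u ;; step g))
      { base M F l P VS c with D := (List.finRange n).map d }
      (l.length * (2 * M.word.length + n * (n + 1) + 4 * n + 7) + 1)
      { base M F [] P VS (l.reverse ++ c) with
        D := (List.finRange n).map ((fun d w => { stepInfo M d w with z := g (stepInfo M d w) })^[l.length] d) } := by
    intro l
    induction l with
    | nil => intro c d; exact (Runs.forEach_nil rfl).mono (by simp)
    | cons u l ih =>
      intro c d
      refine ((Runs.forEach_cons rfl ((Runs.push .C u _).seq (runs_step M g d F l P VS (u :: c)))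
        (ih (u :: c) _)).mono ?_).cast ?_
      · simp only [List.length_cons, Nat.add_mul, one_mul]
        omega
      · simp
  refine (((this U [] d).seq (runs_move (k := .C) (k' := .U) nofun id _)).mono ?_).cast ?_
  · simp [Mem.get, base]; omega
  · simp [Mem.get, Mem.set, base]

theorem runs_fill_D (s : Sym) (d : List Sym) (hm : m.C = []) :
    Runs (fill .D s) { m with D := d } (2 * m.U.length + 2)
      { m with D := List.replicate m.U.length s ++ d } := by
  have : ∀ l c d : List Sym, Runs (forEach .U (fun u => push .C u ;; push .D s))
      { m with U := l, C := c, D := d } (l.length + 1)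
      { m with U := [], C := l.reverse ++ c, D := List.replicate l.length s ++ d } := by
    intro l
    induction l with
    | nil => intro c d; exact Runs.forEach_nil rfl
    | cons u l ih =>
      intro c d
      refine ((Runs.forEach_cons rfl (Runs.of_run rfl) (ih (u :: c) (s :: d))).mono
        (by simp; omega)).cast ?_
      simp [List.replicate_succ']
  refine (((this m.U m.C d).seq (runs_move (k := .C) (k' := .U) nofun id _)).mono ?_).cast ?_
  · simp [Mem.get, hm]; omega
  · simp [Mem.get, Mem.set, hm]

theorem runs_fill_VS (s : Sym) (VS : List Sym) (hm : m.C = []) :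
    Runs (fill .VS s) { m with VS := VS } (2 * m.U.length + 2)
      { m with VS := List.replicate m.U.length s ++ VS } := by
  have : ∀ l c d : List Sym, Runs (forEach .U (fun u => push .C u ;; push .VS s))
      { m with U := l, C := c, VS := d } (l.length + 1)
      { m with U := [], C := l.reverse ++ c, VS := List.replicate l.length s ++ d } := by
    intro l
    induction l with
    | nil => intro c d; exact Runs.forEach_nil rfl
    | cons u l ih =>
      intro c d
      refine ((Runs.forEach_cons rfl (Runs.of_run rfl) (ih (u :: c) (s :: d))).mono
        (by simp; omega)).cast ?_
      simp [List.replicate_succ']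
  refine (((this m.U m.C VS).seq (runs_move (k := .C) (k' := .U) nofun id _)).mono ?_).cast ?_
  · simp [Mem.get, hm]; omega
  · simp [Mem.get, Mem.set, hm]

end Verifier

/-! ### The verifier: evaluation of formulas -/

namespace Verifier

open StackProg

/-- Replace the two top vectors by the result of an operator. -/
def binop (o : VecOp) : Prog :=
  unload ;;
  move .D .T id ;;
  (loop .VS isMark fun x => x.elim skip fun s => case .T fun x => x.elim fail fun t =>
    push .D { a := t.z, b := s.z, z := o.init s.z }) ;;
  -- The bits `a` and `b` keep the arguments available throughout the iteration, and `z` is the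
  -- value being updated.
  (if o.iter then stepAll fun c => o.upd c.a c.b c.x else step fun c => o.upd c.a c.b c.x) ;;
  store o.out

def topVec : Prog := push .VS mark ;; fill .VS { z := true }

/-- The operator of a letter, and whether it is unary. -/
def opOf (l : Letter) : Option (Bool × VecOp) :=
  match l.val with
  | 11 => some (true, .neg)
  | 12 => some (false, .or)
  | 13 => some (false, .and)
  | 14 => some (true, UnOp.X.vecOp .E)
  | 15 => some (true, UnOp.X.vecOp .A)
  | 16 => some (true, UnOp.F.vecOp .E)
  | 17 => some (true, UnOp.F.vecOp .A)
  | 18 => some (true, UnOp.G.vecOp .E)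
  | 19 => some (true, UnOp.G.vecOp .A)
  | 20 => some (false, BinOp.U.vecOp .E)
  | 21 => some (false, BinOp.U.vecOp .A)
  | 22 => some (false, BinOp.R.vecOp .E)
  | 23 => some (false, BinOp.R.vecOp .A)
  | _ => none

theorem opOf_un (Q : PathQuant) (T : UnOp) : opOf (Letter.un Q T) = some (true, T.vecOp Q) := by
  cases Q <;> cases T <;> rfl

theorem opOf_bin (Q : PathQuant) (T : BinOp) : opOf (Letter.bin Q T) = some (false, T.vecOp Q) := by
  cases Q <;> cases T <;> rfl

/-- Process a letter of a formula, in postfix order. -/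
def evalBody (s : Sym) : Prog :=
  if s.lt.val ≤ 2 then push .P s
  else if s.lt = Letter.top then topVec
  else if s.lt = Letter.prop then label ;; store id
  else (opOf s.lt).elim fail fun u => (if u.1 then topVec else skip) ;; binop u.2

variable {n : ℕ} (M : WordData n) (F U VS : List Sym)

/-- The effect of a step. -/
def stepData (g : Sym → Bool) (d : Fin n → Sym) (w : Fin n) : Sym :=
  { stepInfo M d w with z := g (stepInfo M d w) }

/-- A bound for the time of a step. -/
def stepCost : ℕ := 2 * M.word.length + n * (n + 1) + 4 * n + 6

/-- A bound for the time of processing one letter of a formula. -/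
def cost : ℕ := (n + 1) * (stepCost M + 1) + 20 * (n + 1) + 4 * M.word.length

/-- A step leaves the bits `a` and `b` alone, so on the bits `z` the iteration on the stacks
coincides with the abstract iteration of `VecOp.step`. -/
theorem iterate_stepData (o : VecOp) (d : Fin n → Sym) (A B : Fin n → Bool)
    (hA : ∀ w, (d w).a = A w) (hB : ∀ w, (d w).b = B w) (k : ℕ) :
    ∀ w, ((stepData M fun c => o.upd c.a c.b c.x)^[k] d w).a = A w ∧
      ((stepData M fun c => o.upd c.a c.b c.x)^[k] d w).b = B w ∧
      ((stepData M fun c => o.upd c.a c.b c.x)^[k] d w).z = (o.step M.e A B)^[k] (fun w => (d w).z) w := by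
  induction k with
  | zero => intro w; exact ⟨hA w, hB w, rfl⟩
  | succ k ih =>
    intro w
    rw [Function.iterate_succ_apply', Function.iterate_succ_apply']
    refine ⟨(ih w).1, (ih w).2.1, ?_⟩
    have : (fun w => ((stepData M fun c => o.upd c.a c.b c.x)^[k] d w).z) =
        (o.step M.e A B)^[k] (fun w => (d w).z) := funext fun w => (ih w).2.2
    rw [← this]
    simp only [stepData, stepInfo, VecOp.step, (ih w).1, (ih w).2.1]

theorem runs_binop (hU : U.length = n) (o : VecOp) (A B : Fin n → Bool) :
    Runs (binop o) (base M F U [] (vec A ++ (vec B ++ VS)) [])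
      ((n + 1) * (stepCost M + 1) + 6 * (n + 1)) (base M F U [] (vec (o.apply M.e A B) ++ VS) []) := by
  have h₁ := runs_unload (base M F U [] [] []) A (vec B ++ VS)
  have h₂ := runs_move (k := .D) (k' := .T) nofun id
    { base M F U [] (vec B ++ VS) [] with D := (List.finRange n).map fun w => { z := A w } }
  have h₃ : ∀ (l : List (Fin n)) (D : List Sym),
      Runs (loop .VS isMark fun x => x.elim skip fun s => case .T fun x => x.elim fail fun t =>
        push .D { a := t.z, b := s.z, z := o.init s.z })
      { base M F U [] (l.map (fun w => { z := B w }) ++ mark :: VS) [] with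
        T := l.map fun w => { z := A w }, D := D } (l.length + 1)
      { base M F U [] VS [] with
        D := (l.map fun w => { a := A w, b := B w, z := o.init (B w) }).reverse ++ D } := by
    intro l
    induction l with
    | nil => intro D; exact runs_loop_stop rfl
    | cons w l ih =>
      intro D
      exact ((runs_loop_step rfl (Runs.of_run rfl)
        (ih ({ a := A w, b := B w, z := o.init (B w) } :: D))).mono (by simp; omega)).cast (by simp)
  have h₃ := h₃ (List.finRange n).reverse []
  set d : Fin n → Sym := fun w => { a := A w, b := B w, z := o.init (B w) }
  have h₄ : Runs (if o.iter then stepAll fun c => o.upd c.a c.b c.x else step fun c => o.upd c.a c.b c.x)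
      { base M F U [] VS [] with D := (List.finRange n).map d }
      ((n + 1) * (stepCost M + 1) + n + 2) { base M F U [] VS [] with
        D := (List.finRange n).map
          ((stepData M fun c => o.upd c.a c.b c.x)^[if o.iter then n else 1] d) } := by
    cases o.iter
    · simp only [Bool.false_eq_true, if_false, Function.iterate_one]
      refine (runs_step M _ d F U [] VS []).mono ?_
      rw [← stepCost, Nat.add_mul]
      omega
    · simp only [if_true]
      have := runs_stepAll M (fun c => o.upd c.a c.b c.x) d F U [] VS
      rw [hU] at this
      refine this.mono ?_
      rw [show 2 * M.word.length + n * (n + 1) + 4 * n + 7 = stepCost M + 1 from rfl, Nat.add_mul]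
      omega
  have h₅ := runs_store (base M F U [] [] []) o.out
    ((stepData M fun c => o.upd c.a c.b c.x)^[if o.iter then n else 1] d) VS
  refine ((h₁.seq ((h₂.cast ?_).seq ((h₃.cast ?_).seq (h₄.seq h₅)))).mono ?_).cast ?_
  · simp [Mem.get, Mem.set, base, vec]
  · simp [base]
  · simp only [Mem.get, List.length_map, List.length_finRange, List.length_reverse]
    omega
  · have : (fun w => o.out ((stepData M fun c => o.upd c.a c.b c.x)^[if o.iter then n else 1] d w).z) =
        o.apply M.e A B := by
      funext w
      rw [(iterate_stepData M o d A B (fun _ => rfl) (fun _ => rfl) _ w).2.2]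
      rfl
    rw [this]
    rfl

theorem runs_topVec (hU : U.length = n) (P : List Sym) :
    Runs topVec (base M F U P VS []) (2 * n + 2) (base M F U P (vec (fun _ : Fin n => true) ++ VS) []) := by
  refine (((Runs.push .VS mark _).seq (runs_fill_VS (base M F U P [] []) { z := true } (mark :: VS) rfl)).mono
    ?_).cast ?_
  · simp [base, hU]
  · simp [base, hU, vec]

/-- The last letter of the formula is on top of `F`, so arguments are evaluated before their
operator, and of two arguments the second comes first; the vector of the first argument therefore
ends on top. Each letter is charged the cost of the most expensive operation. -/
theorem rounds_evalBody (hU : U.length = n) (φ : CTL) : ∀ F VS : List Sym, Rounds .F evalBody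
    (base M ((φ.encode.map sym).reverse ++ F) U [] VS []) (φ.encode.length * (cost M + 1))
    (base M F U [] (vec (φ.eval M.e fun w p => decide (p ∈ M.lab w)) ++ VS) []) := by
  have hop : ∀ (l : Letter) (o : VecOp), opOf l = some (true, o) → ∀ (Z : Fin n → Bool) (F VS : List Sym),
      Rounds .F evalBody (base M (sym l :: F) U [] (vec Z ++ VS) []) (cost M + 1)
        (base M F U [] (vec (o.apply M.e (fun _ => true) Z) ++ VS) []) := by
    intro l o hl Z F VS
    have hb : evalBody (sym l) = (topVec ;; binop o) := by
      have : ¬ l.val ≤ 2 ∧ l ≠ Letter.top ∧ l ≠ Letter.prop := by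
        refine ⟨fun h => ?_, ?_, ?_⟩
        · obtain h | h | h : l.val = 0 ∨ l.val = 1 ∨ l.val = 2 := by omega
          all_goals simp [opOf, h] at hl
        · rintro rfl; cases hl
        · rintro rfl; cases hl
      simp [evalBody, this.1, this.2.1, this.2.2, hl]
    refine Rounds.one rfl ?_
    rw [hb]
    refine ((runs_topVec M F U (vec Z ++ VS) hU []).seq (runs_binop M F U VS hU o _ _)).mono ?_
    unfold cost
    omega
  have hop' : ∀ (l : Letter) (o : VecOp), opOf l = some (false, o) → ∀ (Z Z' : Fin n → Bool) (F VS : List Sym),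
      Rounds .F evalBody (base M (sym l :: F) U [] (vec Z ++ (vec Z' ++ VS)) []) (cost M + 1)
        (base M F U [] (vec (o.apply M.e Z Z') ++ VS) []) := by
    intro l o hl Z Z' F VS
    have hb : evalBody (sym l) = (skip ;; binop o) := by
      have : ¬ l.val ≤ 2 ∧ l ≠ Letter.top ∧ l ≠ Letter.prop := by
        refine ⟨fun h => ?_, ?_, ?_⟩
        · obtain h | h | h : l.val = 0 ∨ l.val = 1 ∨ l.val = 2 := by omega
          all_goals simp [opOf, h] at hl
        · rintro rfl; cases hl
        · rintro rfl; cases hl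
      simp [evalBody, this.1, this.2.1, this.2.2, hl]
    refine Rounds.one rfl ?_
    rw [hb]
    refine ((Runs.of_run rfl).seq (runs_binop M F U VS hU o _ _)).mono ?_
    unfold cost
    omega
  induction φ with
  | top =>
    intro F VS
    have h : Runs (evalBody (sym Letter.top)) _ _ _ := runs_topVec M F U VS hU []
    refine (Rounds.one (m := base M (sym Letter.top :: F) U [] VS []) rfl h).mono ?_
    simp only [CTL.encode, List.length_singleton, one_mul, cost]
    omega
  | prop p =>
    intro F VS
    -- The digits arrive in reverse order, and pushing them on `P` restores the order that `label`
    -- expects.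
    have hdig : ∀ ls : List Letter, (∀ l ∈ ls, l.val ≤ 2) → ∀ (F P : List Sym),
        Rounds .F evalBody (base M (ls.map sym ++ F) U P VS []) ls.length
          (base M F U ((ls.map sym).reverse ++ P) VS []) := by
      intro ls
      induction ls with
      | nil => intro _ F P; exact Rounds.refl
      | cons l ls ih =>
        intro hls F P
        have hb : evalBody (sym l) = push .P (sym l) := by
          have := hls l (by simp)
          simp [evalBody, this]
        refine ((Rounds.one rfl ?_).trans (ih (fun l hl => hls l (by simp [hl])) F (sym l :: P))).mono
          (t := 0 + 1 + _) (by simp; omega) |>.cast (by simp)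
        rw [hb]
        exact Runs.of_run rfl
    have h₁ := hdig (encodeNum p).reverse
      (fun l hl => le_two_of_mem_encodeNum (List.mem_reverse.1 hl)) (sym Letter.prop :: F) []
    have h₂ : Rounds .F evalBody (base M (sym Letter.prop :: F) U ((encodeNum p).map sym) VS [])
        (4 * M.word.length + n + (encodeNum p).length + 4 + (n + 1) + 1)
        (base M F U [] (vec ((CTL.prop p).eval M.e fun w p => decide (p ∈ M.lab w)) ++ VS) []) :=
      Rounds.one rfl ((runs_label M p F U VS []).seq (runs_store (base M F U [] VS []) id _ VS))
    have hF : ((CTL.prop p).encode.map sym).reverse ++ F =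
        (encodeNum p).reverse.map sym ++ (sym Letter.prop :: F) := by simp [CTL.encode]
    rw [hF]
    refine (h₁.cast ?_ |>.trans h₂).mono ?_
    · simp
    · simp only [CTL.encode, List.length_cons, List.length_reverse, cost, Nat.add_mul, Nat.mul_add]
      nlinarith [Nat.zero_le ((encodeNum p).length * (4 * M.word.length)),
        Nat.zero_le ((encodeNum p).length * (20 * n)),
        Nat.zero_le ((encodeNum p).length * (n * stepCost M)), Nat.zero_le ((encodeNum p).length * n),
        Nat.zero_le ((encodeNum p).length * stepCost M), Nat.zero_le (n * stepCost M)]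
  | neg φ ih =>
    intro F VS
    have h := (ih (sym Letter.neg :: F) VS).trans (hop Letter.neg .neg rfl _ F VS)
    simpa [CTL.encode, CTL.eval, Nat.add_mul] using h
  | or φ ψ ih₁ ih₂ =>
    intro F VS
    have h := ((ih₂ ((φ.encode.map sym).reverse ++ sym Letter.or :: F) VS).trans (ih₁ _ _)).trans
      (hop' Letter.or .or rfl _ _ F VS)
    simpa [CTL.encode, CTL.eval, Nat.add_mul, Nat.add_comm] using h
  | and φ ψ ih₁ ih₂ =>
    intro F VS
    have h := ((ih₂ ((φ.encode.map sym).reverse ++ sym Letter.and :: F) VS).trans (ih₁ _ _)).trans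
      (hop' Letter.and .and rfl _ _ F VS)
    simpa [CTL.encode, CTL.eval, Nat.add_mul, Nat.add_comm] using h
  | un Q T φ ih =>
    intro F VS
    have h := (ih (sym (Letter.un Q T) :: F) VS).trans (hop (Letter.un Q T) _ (opOf_un Q T) _ F VS)
    simpa [CTL.encode, CTL.eval, Nat.add_mul] using h
  | bin Q T φ ψ ih₁ ih₂ =>
    intro F VS
    have h := ((ih₂ ((φ.encode.map sym).reverse ++ sym (Letter.bin Q T) :: F) VS).trans (ih₁ _ _)).trans
      (hop' (Letter.bin Q T) _ (opOf_bin Q T) _ _ F VS)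
    simpa [CTL.encode, CTL.eval, Nat.add_mul, Nat.add_comm] using h

/-! #### Checks -/

theorem exec_forEach_nil {k : K} {body : Sym → Prog} {m : Mem} (hk : m.get k = []) {t : ℕ}
    {S : Fin 14 → List Sym} (h : Exec (forEach k body) m.fn t S) : S = m.fn := by
  rcases exec_loop_iff.1 h with ⟨-, -, h⟩ | ⟨h, -⟩
  · rw [h, Mem.update_fn, Mem.fn_pos, hk, List.tail_nil, ← hk, Mem.set_get_self]
  · rw [Mem.fn_pos, hk] at h
    cases h

theorem exec_forEach_cons {k : K} {body : Sym → Prog} {m : Mem} {s : Sym} {l : List Sym}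
    (hk : m.get k = s :: l) {t : ℕ} {S : Fin 14 → List Sym} (h : Exec (forEach k body) m.fn t S) :
    ∃ t₁ t₂ S₁, Exec (body s) (m.set k l).fn t₁ S₁ ∧ Exec (forEach k body) S₁ t₂ S ∧
      t = 1 + t₁ + t₂ := by
  rcases exec_loop_iff.1 h with ⟨h, -⟩ | ⟨-, h⟩
  · rw [Mem.fn_pos, hk] at h
    cases h
  · rwa [Mem.update_fn, Mem.fn_pos, hk] at h

/-- Fail unless all bits on the stack `D` are `true`. -/
def allTrue : Prog := forEach .D fun s => if s.z then skip else fail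

theorem runs_allTrue (m : Mem) (l : List Sym) (hl : ∀ s ∈ l, s.z = true) :
    Runs allTrue { m with D := l } (l.length + 1) { m with D := [] } := by
  induction l with
  | nil => exact Runs.forEach_nil rfl
  | cons s l ih =>
    refine (Runs.forEach_cons rfl ?_ (ih fun s hs => hl s (by simp [hs]))).mono (T := 1 + 0 + _)
      (by simp; omega)
    rw [if_pos (hl s (by simp))]
    exact Runs.of_run rfl

theorem all_of_exec_allTrue (m : Mem) (l : List Sym) {t : ℕ} {S : Fin 14 → List Sym}
    (h : Exec allTrue ({ m with D := l } : Mem).fn t S) :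
    (∀ s ∈ l, s.z = true) ∧ S = ({ m with D := [] } : Mem).fn := by
  induction l generalizing t with
  | nil => exact ⟨by simp, exec_forEach_nil rfl h⟩
  | cons s l ih =>
    obtain ⟨t₁, t₂, S₁, h₁, h₂, -⟩ := exec_forEach_cons (l := l) rfl h
    by_cases hs : s.z = true
    · rw [if_pos hs] at h₁
      obtain ⟨-, rfl⟩ := exec_skip_iff.1 h₁
      obtain ⟨h₃, h₄⟩ := ih h₂
      refine ⟨fun s' hs' => ?_, h₄⟩
      rcases List.mem_cons.1 hs' with rfl | hs'
      · exact hs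
      · exact h₃ s' hs'
    · rw [if_neg hs] at h₁
      exact (exec_fail_iff.1 h₁).elim

/-- Compute which worlds are reachable from the root and whether they have successors. -/
def explore : Prog :=
  fill .D {} ;;
  step (fun c => decide (c.lt = Letter.root)) ;;
  -- `y` tells that some predecessor is marked, so each round adds one layer of the search from the
  -- root.
  (stepAll fun c => c.z || c.y) ;;
  step fun c => if c.lt = Letter.absent then !c.z else c.z && c.x

/-- The worlds that are reachable from the root. -/
def reach (w : Fin n) : Bool :=
  ((fun Z w => Z w || M.pred Z w)^[n] fun w => decide (M.st w = Letter.root)) w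

/-- Exactly the worlds that are present are reachable, and they have successors. -/
def connected (w : Fin n) : Bool :=
  if M.st w = Letter.absent then !reach M w else reach M w && VecOp.succ M.e (reach M) w

theorem runs_explore (hU : U.length = n) : ∃ d : Fin n → Sym, (∀ w, (d w).z = connected M w) ∧
    Runs explore (base M F U [] VS []) ((n + 3) * (stepCost M + 1) + 4 * n + 6)
      { base M F U [] VS [] with D := (List.finRange n).map d } := by
  have h₁ := runs_fill_D (base M F U [] VS []) {} [] rfl
  have h₂ := runs_step M (fun c => decide (c.lt = Letter.root)) (fun _ => {}) F U [] VS []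
  have h₃ := runs_stepAll M (fun c => c.z || c.y)
    (stepData M (fun c => decide (c.lt = Letter.root)) (fun _ => {})) F U [] VS
  rw [hU] at h₃
  have h₄ := runs_step M (fun c => if c.lt = Letter.absent then !c.z else c.z && c.x)
    ((stepData M fun c => c.z || c.y)^[n]
      (stepData M (fun c => decide (c.lt = Letter.root)) (fun _ => {}))) F U [] VS []
  have hz : ∀ k w, (((stepData M fun c => c.z || c.y)^[k]
      (stepData M (fun c => decide (c.lt = Letter.root)) (fun _ => {}))) w).z =
      ((fun Z w => Z w || M.pred Z w)^[k] fun w => decide (M.st w = Letter.root)) w := by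
    intro k
    induction k with
    | zero => intro w; rfl
    | succ k ih =>
      intro w
      rw [Function.iterate_succ_apply', Function.iterate_succ_apply']
      simp only [stepData, stepInfo] at ih ⊢
      simp only [ih]
  refine ⟨_, fun w => ?_, ((h₁.cast ?_).seq (h₂.seq (h₃.seq h₄))).mono ?_⟩
  · have hz' : (fun w => (((stepData M fun c => c.z || c.y)^[n]
      (stepData M (fun c => decide (c.lt = Letter.root)) (fun _ => {}))) w).z) = reach M :=
      funext fun w => hz n w
    simp only [connected, ← hz']
    rfl
  · simp [base, hU]
  · have hc : stepCost M = 2 * M.word.length + n * (n + 1) + 4 * n + 6 := rfl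
    simp only [base, hU, Nat.add_mul]
    rw [show 2 * M.word.length + n * (n + 1) + 4 * n + 7 = stepCost M + 1 from rfl, ← hc]
    omega

/-- Check that the model is connected and satisfies the formula. -/
def verify : Prog :=
  explore ;; allTrue ;; forEach .F evalBody ;; unload ;;
    -- Vectors carry no status letters. A further step attaches them, so that only the value at the
    -- root is tested.
    step (fun c => !decide (c.lt = Letter.root) || c.z) ;; allTrue

variable (φ : CTL)

/-- The verifier accepts. -/
def Accepts : Prop := (∀ w, connected M w = true) ∧ ∀ w, M.st w = Letter.root →
  φ.eval M.e (fun w p => decide (p ∈ M.lab w)) w = true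

def verifyCost (l : ℕ) : ℕ := (n + 4) * (stepCost M + 1) + 10 * (n + 1) + l * (cost M + 1)

theorem runs_evaluate (hU : U.length = n) : ∃ d : Fin n → Sym,
    (∀ w, (d w).z = (!decide (M.st w = Letter.root) || φ.eval M.e (fun w p => decide (p ∈ M.lab w)) w)) ∧
    Runs (forEach .F evalBody ;; unload ;; step (fun c => !decide (c.lt = Letter.root) || c.z))
      (base M (φ.encode.map sym).reverse U [] [] []) (φ.encode.length * (cost M + 1) + n + 2 + stepCost M)
      { base M [] U [] [] [] with D := (List.finRange n).map d } := by
  have h₁ := (rounds_evalBody M U hU φ [] []).runs rfl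
  rw [List.append_nil] at h₁
  have h₂ := runs_unload (base M [] U [] [] []) (φ.eval M.e (fun w p => decide (p ∈ M.lab w))) []
  have h₃ := runs_step M (fun c => !decide (c.lt = Letter.root) || c.z)
    (fun w => { z := φ.eval M.e (fun w p => decide (p ∈ M.lab w)) w }) [] U [] [] []
  refine ⟨_, fun w => ?_, (h₁.seq (h₂.seq h₃)).mono ?_⟩
  · rfl
  · rw [← stepCost]; omega

theorem runs_verify (hU : U.length = n) (h : Accepts M φ) :
    Runs verify (base M (φ.encode.map sym).reverse U [] [] []) (verifyCost M φ.encode.length)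
      (base M [] U [] [] []) := by
  obtain ⟨d, hd, h₁⟩ := runs_explore M (φ.encode.map sym).reverse U [] hU
  obtain ⟨d', hd', h₂⟩ := runs_evaluate M U φ hU
  have h₃ := runs_allTrue (base M (φ.encode.map sym).reverse U [] [] []) ((List.finRange n).map d) (by
    intro s hs
    obtain ⟨w, -, rfl⟩ := List.mem_map.1 hs
    rw [hd, h.1])
  have h₄ := runs_allTrue (base M [] U [] [] []) ((List.finRange n).map d') (by
    intro s hs
    obtain ⟨w, -, rfl⟩ := List.mem_map.1 hs
    rw [hd']
    by_cases hw : M.st w = Letter.root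
    · simp [hw, h.2 w hw]
    · simp [hw])
  obtain ⟨t₂, ht₂, h₂⟩ := h₂
  obtain ⟨t₅, t₆, _, h₅, h₆, rfl⟩ := exec_seq_iff.1 h₂
  obtain ⟨t₇, t₈, _, h₇, h₈, rfl⟩ := exec_seq_iff.1 h₆
  obtain ⟨t₁, ht₁, h₁⟩ := h₁
  obtain ⟨t₃, ht₃, h₃⟩ := h₃
  obtain ⟨t₄, ht₄, h₄⟩ := h₄
  refine ⟨_, ?_, .seq h₁ (.seq h₃ (.seq h₅ (.seq h₇ (.seq h₈ h₄))))⟩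
  simp only [List.length_map, List.length_finRange] at ht₃ ht₄
  simp only [verifyCost, Nat.add_mul] at ht₁ ht₂ ⊢
  omega

theorem det_option_elim {o : Option Sym} {p : Prog} {f : Sym → Prog} (hp : Det p) (hf : ∀ s, Det (f s)) :
    Det (o.elim p f) := by cases o; exacts [hp, hf _]

theorem det_forEach {k : K} {body : Sym → Prog} (h : ∀ s, Det (body s)) : Det (forEach k body) :=
  fun _ => det_option_elim trivial h

theorem det_move (k k' : K) (f : Sym → Sym) : Det (move k k' f) := det_forEach fun _ => trivial

theorem det_stepBody (s : Sym) : Det (stepBody s) := by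
  refine ⟨trivial, ?_⟩
  split_ifs
  · exact fun _ => det_option_elim trivial fun _ _ => det_option_elim trivial fun _ => ⟨trivial, trivial⟩
  · exact fun _ => det_option_elim trivial fun _ => trivial
  · exact ⟨fun _ => det_option_elim trivial fun _ => trivial, det_move _ _ _⟩
  · trivial
  · exact fun _ => det_option_elim trivial fun _ => trivial

theorem det_step (g : Sym → Bool) : Det (step g) :=
  ⟨det_move _ _ _, det_forEach fun _ => ⟨trivial, trivial⟩, det_forEach det_stepBody, det_move _ _ _,
    det_move _ _ _, det_forEach fun _ _ => det_option_elim trivial fun _ => trivial⟩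

theorem det_compareDigit (l : Letter) : Det (compareDigit l) :=
  fun _ => det_option_elim trivial fun _ _ => ⟨trivial, det_option_elim trivial fun _ => trivial⟩

theorem det_labelBody (s : Sym) : Det (labelBody s) := by
  refine ⟨trivial, ?_⟩
  split_ifs
  · exact det_compareDigit _
  · exact ⟨det_compareDigit _, fun _ => det_option_elim trivial fun _ => trivial, det_move _ _ _⟩
  · trivial
  · trivial
  · exact fun _ => det_option_elim trivial fun _ => trivial
  · trivial

theorem det_label : Det label :=
  ⟨det_forEach det_labelBody, det_move _ _ _, det_forEach fun _ => trivial, det_move _ _ _⟩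

theorem det_fill (k : K) (s : Sym) : Det (fill k s) :=
  ⟨det_forEach fun _ => ⟨trivial, trivial⟩, det_move _ _ _⟩

theorem det_stepAll (g : Sym → Bool) : Det (stepAll g) :=
  ⟨det_forEach fun _ => ⟨trivial, det_step g⟩, det_move _ _ _⟩

theorem det_unload : Det unload := fun _ => det_option_elim trivial fun _ => trivial

theorem det_store (f : Bool → Bool) : Det (store f) := ⟨trivial, det_move _ _ _⟩

theorem det_binop (o : VecOp) : Det (binop o) := by
  refine ⟨det_unload, det_move _ _ _, fun _ => det_option_elim trivial fun _ _ =>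
    det_option_elim trivial fun _ => trivial, ?_, det_store _⟩
  split_ifs
  exacts [det_stepAll _, det_step _]

theorem det_topVec : Det topVec := ⟨trivial, det_fill _ _⟩

theorem det_evalBody (s : Sym) : Det (evalBody s) := by
  unfold evalBody
  split_ifs
  · trivial
  · exact det_topVec
  · exact ⟨det_label, det_store _⟩
  · cases opOf s.lt with
    | none => trivial
    | some u =>
      refine ⟨?_, det_binop _⟩
      split_ifs
      exacts [det_topVec, trivial]

/-- The stages between the checks contain no guesses and have known runs, so every execution passes
through the same states. The two occurrences of `allTrue` then yield the two conditions. -/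
theorem accepts_of_exec_verify (hU : U.length = n) {t : ℕ} {S : Fin 14 → List Sym}
    (h : Exec verify (base M (φ.encode.map sym).reverse U [] [] []).fn t S) : Accepts M φ := by
  obtain ⟨d, hd, h₁⟩ := runs_explore M (φ.encode.map sym).reverse U [] hU
  obtain ⟨d', hd', h₂⟩ := runs_evaluate M U φ hU
  obtain ⟨_, _, _, e₁, h, -⟩ := exec_seq_iff.1 h
  obtain ⟨_, _, _, e₂, h, -⟩ := exec_seq_iff.1 h
  obtain ⟨_, _, _, e₃, h, -⟩ := exec_seq_iff.1 h
  obtain ⟨_, _, _, e₄, h, -⟩ := exec_seq_iff.1 h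
  obtain ⟨_, _, _, e₅, e₆, -⟩ := exec_seq_iff.1 h
  obtain rfl := h₁.unique ⟨det_fill _ _, det_step _, det_stepAll _, det_step _⟩ e₁
  obtain ⟨h₃, rfl⟩ := all_of_exec_allTrue _ _ e₂
  obtain rfl := h₂.unique ⟨det_forEach det_evalBody, det_unload, det_step _⟩ (.seq e₃ (.seq e₄ e₅))
  obtain ⟨h₄, -⟩ := all_of_exec_allTrue _ _ e₆
  refine ⟨fun w => ?_, fun w hw => ?_⟩
  · rw [← hd]
    exact h₃ _ (List.mem_map_of_mem (List.mem_finRange w))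
  · have := h₄ _ (List.mem_map_of_mem (List.mem_finRange w))
    rw [hd'] at this
    simpa [hw] using this

end Verifier

/-! ### The verifier: resolving the decisions -/

namespace Verifier

open StackProg

/-- Check the decision `b` about the letter `l`. The state is `none` within the formula and
otherwise says whether the current world is kept. The result is the new state and the output. -/
def emit (q : Option Bool) (l : Letter) (b : Bool) : Option (Option Bool × Option Letter) :=
  match q with
  -- Everything in the formula is suppressed. Worlds and edges are excluded there, because
  -- suppressing them would still print a letter.
  | none => if b ∧ l ≠ Letter.world ∧ l ≠ Letter.edge then some (none, none) else none
  | some k =>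
    if 9 ≤ l.val then if b then some (none, none) else none
    else if l = Letter.world then some (some !b, some (if b then Letter.absent else Letter.world))
    else if l = Letter.edge then
      -- An edge may stay only if its source is kept; whether its target is kept is checked later
      -- through reachability.
      if b then some (some k, some Letter.noEdge) else if k then some (some k, some Letter.edge) else none
    -- Label digits share the fate of their world, so their decisions are forced.
    else if l.val ≤ 2 then if b = k then none else some (some k, if k then some l else none)
    else if b then none
    else some (some (if l = Letter.root then true else if l = Letter.absent then false else k), some l)

/-- Ties the checking automaton to the printing routine of the enumeration, letter by letter; a
finite check. -/
theorem toList_of_emit {q : Option Bool} {l : Letter} {b : Bool} {r : Option Bool × Option Letter}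
    (h : emit q l b = some r) : r.2.toList = RAM.printLetter l b := by
  revert q l b r
  decide

/-- Either at most one decision is allowed, or both print a letter and the letters differ. The first
difference between two sequences of decisions is thus visible in the output. -/
theorem emit_injective {q : Option Bool} {l : Letter} {b b' : Bool} {r r' : Option Bool × Option Letter}
    {o o' : List Letter} (h : emit q l b = some r) (h' : emit q l b' = some r')
    (ho : r.2.toList ++ o = r'.2.toList ++ o') : b = b' := by
  by_contra hb
  have key : ∀ (q : Option Bool) (l : Letter) (b b' : Bool), b ≠ b' → (emit q l b = none ∨ emit q l b' = none ∨
      ((emit q l b).bind (·.2)).isSome ∧ ((emit q l b').bind (·.2)).isSome ∧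
        (emit q l b).bind (·.2) ≠ (emit q l b').bind (·.2)) := by decide
  rcases key q l b b' hb with h₁ | h₁ | ⟨h₁, h₂, h₃⟩
  · rw [h] at h₁; cases h₁
  · rw [h'] at h₁; cases h₁
  · rw [h] at h₁ h₃
    rw [h'] at h₂ h₃
    obtain ⟨a, ha⟩ := Option.isSome_iff_exists.1 h₁
    obtain ⟨a', ha'⟩ := Option.isSome_iff_exists.1 h₂
    simp only [Option.bind_some] at ha ha' h₃
    rw [ha, ha'] at h₃ ho
    simp only [Option.toList_some, List.singleton_append, List.cons.injEq] at ho
    exact h₃ (by rw [ho.1])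

/-- Check all decisions. -/
def scan : Option Bool → List Letter → List Bool → Option (Option Bool × List Letter)
  | q, [], [] => some (q, [])
  | q, l :: x, b :: s =>
    (emit q l b).bind fun r => (scan r.1 x s).map fun r' => (r'.1, r.2.toList ++ r'.2)
  | _, _, _ => none

theorem scan_cons {q q' : Option Bool} {l : Letter} {x : List Letter} {b : Bool} {s : List Bool}
    {out : List Letter} : scan q (l :: x) (b :: s) = some (q', out) ↔ ∃ r out', emit q l b = some r ∧
      scan r.1 x s = some (q', out') ∧ out = r.2.toList ++ out' := by
  simp only [scan, Option.bind_eq_some_iff, Option.map_eq_some_iff, Prod.mk.injEq, Prod.exists]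
  constructor
  · rintro ⟨a, o, h, a', o', h', rfl, rfl⟩
    exact ⟨a, o, o', h, h', rfl⟩
  · rintro ⟨a, o, o', h, h', rfl⟩
    exact ⟨a, o, h, q', o', h', rfl, rfl⟩

theorem scan_eq {x : List Letter} : ∀ {q q' : Option Bool} {s : List Bool} {out : List Letter},
    scan q x s = some (q', out) → s.length = x.length ∧ out = RAM.printWord x s := by
  induction x with
  | nil =>
    intro q q' s out h
    cases s with
    | nil => cases h; exact ⟨rfl, rfl⟩
    | cons b s => cases h
  | cons l x ih =>
    intro q q' s out h
    cases s with
    | nil => cases h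
    | cons b s =>
      obtain ⟨r, out', hr, hs, rfl⟩ := scan_cons.1 h
      obtain ⟨h₁, h₂⟩ := ih hs
      refine ⟨by simp [h₁], ?_⟩
      rw [h₂, toList_of_emit hr]
      rfl

theorem scan_injective {x : List Letter} : ∀ {q q₁ q₂ : Option Bool} {s s' : List Bool} {out : List Letter},
    scan q x s = some (q₁, out) → scan q x s' = some (q₂, out) → s = s' := by
  induction x with
  | nil =>
    intro q q₁ q₂ s s' out h h'
    have := (scan_eq h).1
    have := (scan_eq h').1
    simp_all
  | cons l x ih =>
    intro q q₁ q₂ s s' out h h'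
    cases s with
    | nil => cases h
    | cons b s =>
      cases s' with
      | nil => cases h'
      | cons b' s' =>
        obtain ⟨r, o, hr, hs, rfl⟩ := scan_cons.1 h
        obtain ⟨r', o', hr', hs', ho⟩ := scan_cons.1 h'
        obtain rfl := emit_injective hr hr' ho
        rw [hr] at hr'
        cases hr'
        rw [List.append_cancel_left_eq] at ho
        subst ho
        rw [ih hs hs']

/-! #### The program -/

def encState (q : Option Bool) : Sym := { z := q.isSome, x := q.getD false }

def decState (s : Sym) : Option Bool := if s.z then some s.x else none

theorem decState_encState (q : Option Bool) : decState (encState q) = q := by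
  rcases q with _ | _ | _ <;> rfl

/-- Check a decision and output the result. -/
def emitProg (l : Letter) (b : Bool) : Prog :=
  case .CUR fun o => o.elim fail fun c => (emit (decState c) l b).elim fail fun r =>
    push .CUR (encState r.1) ;; (r.2.elim skip fun l' => push .A (sym l')) ;;
      if r.1 = none then push .F (sym l) else skip

/-- Guess the decision about a letter if it is not known, check it and output the result. -/
def scanBody (s : Sym) : Prog :=
  if s.a then .guess fun b => emitProg s.lt b else emitProg s.lt s.b

variable (m : Mem) (a f : List Sym)

theorem runs_emitProg {q : Option Bool} {l : Letter} {b : Bool} {r : Option Bool × Option Letter}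
    (h : emit q l b = some r) : Runs (emitProg l b) { m with CUR := [encState q], A := a, F := f } 0
      { m with CUR := [encState r.1], A := r.2.toList.map sym ++ a,
               F := if r.1 = none then sym l :: f else f } := by
  refine Runs.case ?_
  change Runs ((emit (decState (encState q)) l b).elim _ _) _ _ _
  rw [decState_encState, h]
  rcases r with ⟨_ | k, _ | l'⟩ <;> exact Runs.of_run rfl

theorem det_emitProg (l : Letter) (b : Bool) : Det (emitProg l b) := by
  intro o
  rcases o with _ | c
  · trivial
  · change Det ((emit (decState c) l b).elim _ _)
    rcases emit (decState c) l b with _ | ⟨_ | k, _ | l'⟩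
    · trivial
    all_goals exact ⟨trivial, trivial, trivial⟩

theorem exec_emitProg {q : Option Bool} {l : Letter} {b : Bool} {t : ℕ} {S : Fin 14 → List Sym}
    (h : Exec (emitProg l b) ({ m with CUR := [encState q], A := a, F := f } : Mem).fn t S) :
    ∃ r, emit q l b = some r ∧ S = ({ m with
      CUR := [encState r.1], A := r.2.toList.map sym ++ a,
      F := if r.1 = none then sym l :: f else f } : Mem).fn := by
  rcases he : emit q l b with _ | r
  · have h := exec_case_iff.1 h
    rw [Mem.fn_pos] at h
    change Exec ((emit (decState (encState q)) l b).elim _ _) _ _ _ at h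
    rw [decState_encState, he] at h
    exact (exec_fail_iff.1 h).elim
  · exact ⟨r, rfl, (runs_emitProg m a f he).unique (det_emitProg l b) h⟩

/-- The part of a word that belongs to the formula. -/
def formulaPart (q : Option Bool) (x : List Letter) : List Letter :=
  if q = none then x else x.dropWhile fun l => decide (l.val < 9)

theorem formulaPart_cons {q : Option Bool} {l : Letter} {b : Bool} {r : Option Bool × Option Letter}
    (h : emit q l b = some r) (x : List Letter) : formulaPart q (l :: x) =
      (if r.1 = none then [l] else []) ++ formulaPart r.1 x := by
  have key : ∀ q l b, (emit q l b).all (fun r => decide (r.1 = none ↔ q = none ∨ 9 ≤ l.val)) = true := by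
    decide
  have hk := key q l b
  rw [h] at hk
  have hk : r.1 = none ↔ q = none ∨ 9 ≤ l.val := of_decide_eq_true hk
  rcases q with _ | k
  · simp [formulaPart, hk]
  · by_cases hl : 9 ≤ l.val
    · have : ¬ l.val < 9 := by omega
      simp [formulaPart, hk, hl, this]
    · have : l.val < 9 := by omega
      simp [formulaPart, hk, hl, this]

/-- The decisions `s` agree with those that are known. -/
def Agrees (zs : List Sym) (s : List Bool) : Prop :=
  List.Forall₂ (fun z b => z.a = false → z.b = b) zs s

/-- This is the only stage with guesses, so uniqueness of outcomes is unavailable. Instead the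
decisions are extracted round by round from the given execution. -/
theorem exec_scan (zs : List Sym) : ∀ {q : Option Bool} {a f : List Sym} {t : ℕ} {S : Fin 14 → List Sym},
    Exec (forEach .B scanBody) ({ m with B := zs, CUR := [encState q], A := a, F := f } : Mem).fn t S →
    ∃ s q' out, Agrees zs s ∧ scan q (zs.map Sym.lt) s = some (q', out) ∧ S = ({ m with
      B := [], CUR := [encState q'], A := (out.map sym).reverse ++ a,
      F := ((formulaPart q (zs.map Sym.lt)).map sym).reverse ++ f } : Mem).fn := by
  induction zs with
  | nil =>
    intro q a f t S h
    refine ⟨[], q, [], .nil, rfl, ?_⟩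
    rw [exec_forEach_nil rfl h]
    rcases q with _ | _ <;> simp [formulaPart]
  | cons z zs ih =>
    intro q a f t S h
    obtain ⟨t₁, t₂, S₁, h₁, h₂, -⟩ := exec_forEach_cons (l := zs) rfl h
    have : ∃ b t₁, (z.a = false → z.b = b) ∧ Exec (emitProg z.lt b)
        ({ m with B := zs, CUR := [encState q], A := a, F := f } : Mem).fn t₁ S₁ := by
      unfold scanBody at h₁
      split_ifs at h₁ with hz
      · obtain ⟨b, t₃, h₃, -⟩ := exec_guess_iff.1 h₁
        exact ⟨b, t₃, by simp [hz], h₃⟩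
      · exact ⟨z.b, t₁, fun _ => rfl, h₁⟩
    obtain ⟨b, t₁, hb, h₁⟩ := this
    obtain ⟨r, hr, rfl⟩ := exec_emitProg { m with B := zs } a f h₁
    obtain ⟨s, q', out, hs, hscan, rfl⟩ := ih h₂
    refine ⟨b :: s, q', r.2.toList ++ out, .cons hb hs, scan_cons.2 ⟨r, out, hr, hscan, rfl⟩, ?_⟩
    rw [List.map_cons, formulaPart_cons hr]
    rcases r with ⟨_ | k, _ | l'⟩ <;> simp

/-- Each letter costs one tick for the loop test and at most one for a guess; the last tick is for
the empty stack. -/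
theorem runs_scan (zs : List Sym) : ∀ {q q' : Option Bool} {a f : List Sym} {s : List Bool} {out : List Letter},
    Agrees zs s → scan q (zs.map Sym.lt) s = some (q', out) →
    Runs (forEach .B scanBody) { m with B := zs, CUR := [encState q], A := a, F := f } (2 * zs.length + 1)
      { m with B := [], CUR := [encState q'], A := (out.map sym).reverse ++ a,
               F := ((formulaPart q (zs.map Sym.lt)).map sym).reverse ++ f } := by
  induction zs with
  | nil =>
    intro q q' a f s out hs h
    cases hs
    cases h
    refine (Runs.forEach_nil rfl).cast ?_
    rcases q with _ | _ <;> simp [formulaPart]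
  | cons z zs ih =>
    intro q q' a f s out hs h
    obtain _ | ⟨hb, hs⟩ := hs
    obtain ⟨r, out', hr, hscan, rfl⟩ := scan_cons.1 h
    obtain ⟨t, ht, he⟩ := runs_emitProg { m with B := zs } a f hr
    refine ((Runs.forEach_cons (T := 1) rfl ?_ (ih (a := r.2.toList.map sym ++ a)
      (f := if r.1 = none then sym z.lt :: f else f) hs hscan)).mono ?_).cast ?_
    · unfold scanBody
      by_cases hz : z.a = true
      · rw [if_pos hz]
        exact ⟨t + 1, by omega, .guess _ he⟩
      · rw [if_neg hz, hb (by simpa using hz)]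
        exact ⟨t, by omega, he⟩
    · simp; omega
    · rw [List.map_cons, formulaPart_cons hr]
      rcases r with ⟨_ | k, _ | l'⟩ <;> simp

end Verifier

/-! ### Decisions and submodels -/

namespace Verifier

/-- Some decisions about `x` pass the check and lead to the output `out`. -/
def Scans (q : Option Bool) (x : List Letter) (q' : Option Bool) (out : List Letter) : Prop :=
  ∃ s, scan q x s = some (q', out)

theorem scans_nil {q q' : Option Bool} {out : List Letter} :
    Scans q [] q' out ↔ q' = q ∧ out = [] := by
  constructor
  · rintro ⟨s, h⟩
    cases s with
    | nil => cases h; exact ⟨rfl, rfl⟩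
    | cons b s => cases h
  · rintro ⟨rfl, rfl⟩
    exact ⟨[], rfl⟩

theorem scans_cons {q q' : Option Bool} {l : Letter} {x out : List Letter} :
    Scans q (l :: x) q' out ↔ ∃ b r out', emit q l b = some r ∧ Scans r.1 x q' out' ∧
      out = r.2.toList ++ out' := by
  constructor
  · rintro ⟨s, h⟩
    cases s with
    | nil => cases h
    | cons b s =>
      obtain ⟨r, out', hr, h, he⟩ := scan_cons.1 h
      exact ⟨b, r, out', hr, ⟨s, h⟩, he⟩
  · rintro ⟨b, r, out', hr, ⟨s, h⟩, he⟩
    exact ⟨b :: s, scan_cons.2 ⟨r, out', hr, h, he⟩⟩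

theorem scans_append {x y : List Letter} : ∀ {q q' : Option Bool} {out : List Letter},
    Scans q (x ++ y) q' out ↔ ∃ q₁ o o', Scans q x q₁ o ∧ Scans q₁ y q' o' ∧ out = o ++ o' := by
  induction x with
  | nil =>
    intro q q' out
    simp only [List.nil_append, scans_nil]
    constructor
    · intro h; exact ⟨q, [], out, ⟨rfl, rfl⟩, h, rfl⟩
    · rintro ⟨_, _, o', ⟨rfl, rfl⟩, h, rfl⟩; exact h
  | cons l x ih =>
    intro q q' out
    simp only [List.cons_append, scans_cons, ih]
    constructor
    · rintro ⟨b, r, _, hr, ⟨q₁, o, o', h, h', rfl⟩, rfl⟩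
      exact ⟨q₁, r.2.toList ++ o, o', ⟨b, r, o, hr, h, rfl⟩, h', by simp⟩
    · rintro ⟨q₁, _, o', ⟨b, r, o, hr, h, rfl⟩, h', rfl⟩
      exact ⟨b, r, o ++ o', hr, ⟨q₁, o, o', h, h', rfl⟩, by simp⟩

theorem scans_singleton {q q' : Option Bool} {l : Letter} {out : List Letter} :
    Scans q [l] q' out ↔ ∃ b r, emit q l b = some r ∧ q' = r.1 ∧ out = r.2.toList := by
  simp only [scans_cons, scans_nil]
  constructor
  · rintro ⟨b, r, _, hr, ⟨rfl, rfl⟩, rfl⟩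
    exact ⟨b, r, hr, rfl, by simp⟩
  · rintro ⟨b, r, hr, rfl, rfl⟩
    exact ⟨b, r, [], hr, ⟨rfl, rfl⟩, by simp⟩

theorem scans_digits {k : Bool} {ls : List Letter} (hls : ∀ l ∈ ls, l.val ≤ 2) :
    ∀ {q' : Option Bool} {out : List Letter},
    Scans (some k) ls q' out ↔ q' = some k ∧ out = if k then ls else [] := by
  induction ls with
  | nil => intro q' out; cases k <;> simp [scans_nil]
  | cons l ls ih =>
    intro q' out
    have hl := hls l (by simp)
    have hl' : ∀ (k b : Bool) r, emit (some k) l b = some r ↔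
        b = !k ∧ r = (some k, if k then some l else none) := by
      obtain rfl | rfl | rfl : l = 0 ∨ l = 1 ∨ l = 2 := by
        clear ih hls; revert hl; revert l; decide
      all_goals decide
    simp only [scans_cons, hl']
    constructor
    · rintro ⟨b, r, o, ⟨rfl, rfl⟩, h, rfl⟩
      obtain ⟨rfl, rfl⟩ := (ih fun l hl => hls l (by simp [hl])).1 h
      cases k <;> simp
    · rintro ⟨rfl, rfl⟩
      refine ⟨_, _, _, ⟨rfl, rfl⟩, (ih fun l hl => hls l (by simp [hl])).2 ⟨rfl, rfl⟩, ?_⟩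
      cases k <;> simp

/-- A decision about an edge letter selects whether the edge stays, and a non-edge leaves no choice.
As the columns are distinct, the selections combine to one function `e`. -/
theorem scans_row {n : ℕ} {k : Bool} (r : Fin n → Bool) (vs : List (Fin n)) (hvs : vs.Nodup) :
    ∀ {q' : Option Bool} {out : List Letter},
    Scans (some k) (vs.map fun v => if r v then Letter.edge else Letter.noEdge) q' out ↔ q' = some k ∧
      ∃ e : Fin n → Bool, (∀ v ∈ vs, e v = true → k = true ∧ r v = true) ∧
        out = vs.map fun v => if e v then Letter.edge else Letter.noEdge := by
  induction vs with
  | nil => intro q' out; simp [scans_nil]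
  | cons v vs ih =>
    intro q' out
    obtain ⟨hv, hvs⟩ := List.nodup_cons.1 hvs
    have hl : ∀ k b c p, emit (some k) (if c then Letter.edge else Letter.noEdge) b = some p ↔
        ∃ e : Bool, (e = true → k = true ∧ c = true) ∧ b = (c && !e) ∧
          p = (some k, some (if e then Letter.edge else Letter.noEdge)) := by
      decide
    simp only [List.map_cons, scans_cons, hl]
    constructor
    · rintro ⟨b, p, _, ⟨e₀, he₀, -, rfl⟩, h, rfl⟩
      obtain ⟨rfl, e, he, rfl⟩ := (ih hvs).1 h
      refine ⟨rfl, Function.update e v e₀, ?_, ?_⟩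
      · intro u hu
        rcases List.mem_cons.1 hu with rfl | hu
        · simpa using he₀
        · rw [Function.update_of_ne (fun h : u = v => hv (h ▸ hu))]
          exact he u hu
      · simp only [Function.update_self, Option.toList_some, List.singleton_append, List.cons.injEq,
          true_and]
        refine List.map_congr_left fun u hu => ?_
        rw [Function.update_of_ne (fun h : u = v => hv (h ▸ hu))]
    · rintro ⟨rfl, e, he, rfl⟩
      exact ⟨_, _, _, ⟨e v, he v (by simp), rfl, rfl⟩,
        (ih hvs).2 ⟨rfl, e, fun u hu => he u (by simp [hu]), rfl⟩, by simp⟩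

theorem CTL.encode_val (φ : CTL) : (∃ l r, φ.encode = l :: r ∧ 9 ≤ l.val) ∧
    ∀ l ∈ φ.encode, l ≠ Letter.world ∧ l ≠ Letter.edge := by
  have hnum : ∀ p, ∀ l ∈ encodeNum p, l ≠ Letter.world ∧ l ≠ Letter.edge := by
    intro p l hl
    have := le_two_of_mem_encodeNum hl
    constructor <;> rintro rfl <;> exact absurd this (by decide)
  have hun : ∀ Q T, Letter.un Q T ≠ Letter.world ∧ Letter.un Q T ≠ Letter.edge := by
    intro Q T; cases Q <;> cases T <;> decide
  have hbin : ∀ Q T, Letter.bin Q T ≠ Letter.world ∧ Letter.bin Q T ≠ Letter.edge := by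
    intro Q T; cases Q <;> cases T <;> decide
  induction φ with
  | top =>
    refine ⟨⟨_, _, rfl, by decide⟩, ?_⟩
    simp [CTL.encode, Letter.top, Letter.world, Letter.edge]
  | prop p =>
    refine ⟨⟨_, _, rfl, by decide⟩, ?_⟩
    simp only [CTL.encode, List.mem_cons]
    rintro l (rfl | h)
    exacts [by decide, hnum p l h]
  | neg φ ih =>
    refine ⟨⟨_, _, rfl, by decide⟩, ?_⟩
    simp only [CTL.encode, List.mem_cons]
    rintro l (rfl | h)
    exacts [by decide, ih.2 l h]
  | or φ ψ ih₁ ih₂ =>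
    refine ⟨⟨_, _, rfl, by decide⟩, ?_⟩
    simp only [CTL.encode, List.mem_cons, List.mem_append]
    rintro l (rfl | h | h)
    exacts [by decide, ih₁.2 l h, ih₂.2 l h]
  | and φ ψ ih₁ ih₂ =>
    refine ⟨⟨_, _, rfl, by decide⟩, ?_⟩
    simp only [CTL.encode, List.mem_cons, List.mem_append]
    rintro l (rfl | h | h)
    exacts [by decide, ih₁.2 l h, ih₂.2 l h]
  | un Q T φ ih =>
    refine ⟨⟨_, _, rfl, by have := Letter.un_val Q T; omega⟩, ?_⟩
    simp only [CTL.encode, List.mem_cons]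
    rintro l (rfl | h)
    exacts [hun Q T, ih.2 l h]
  | bin Q T φ ψ ih₁ ih₂ =>
    refine ⟨⟨_, _, rfl, by have := Letter.bin_val Q T; omega⟩, ?_⟩
    simp only [CTL.encode, List.mem_cons, List.mem_append]
    rintro l (rfl | h | h)
    exacts [hbin Q T, ih₁.2 l h, ih₂.2 l h]

theorem scans_formula {k : Bool} (φ : CTL) {q' : Option Bool} {out : List Letter} :
    Scans (some k) φ.encode q' out ↔ q' = none ∧ out = [] := by
  have hnone : ∀ x : List Letter, (∀ l ∈ x, l ≠ Letter.world ∧ l ≠ Letter.edge) →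
      (Scans none x q' out ↔ q' = none ∧ out = []) := by
    intro x
    induction x with
    | nil => intro _; exact scans_nil
    | cons l x ih =>
      intro hx
      have hl := hx l (by simp)
      have ih := ih fun l hl => hx l (by simp [hl])
      have : ∀ b r, emit none l b = some r ↔ b = true ∧ r = (none, none) := by
        intro b r; cases b <;> simp [emit, hl, eq_comm]
      simp only [scans_cons, this]
      constructor
      · rintro ⟨b, r, o, ⟨rfl, rfl⟩, h, rfl⟩
        simpa using ih.1 h
      · intro h
        exact ⟨_, _, out, ⟨rfl, rfl⟩, ih.2 h, by simp⟩
  obtain ⟨⟨l, x, hx, hl⟩, hall⟩ := CTL.encode_val φ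
  rw [hx] at hall ⊢
  have hn := hnone x fun l hl => hall l (by simp [hl])
  have : ∀ b r, emit (some k) l b = some r ↔ b = true ∧ r = (none, none) := by
    intro b r; cases b <;> simp [emit, hl, eq_comm]
  simp only [scans_cons, this]
  constructor
  · rintro ⟨b, r, o, ⟨rfl, rfl⟩, h, rfl⟩
    simpa using hn.1 h
  · intro h
    exact ⟨_, _, out, ⟨rfl, rfl⟩, hn.2 h, by simp⟩

/-! ### The outputs of the local check -/

section

variable {n : ℕ} (M : Kripke n)

/-- The part of a model with worlds `W` and edges `E`. -/
def part (W : Fin n → Bool) (E : Fin n → Fin n → Bool) : WordData n where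
  st w := if w = M.root then Letter.root else if W w then Letter.world else Letter.absent
  e := E
  lab w := if W w then (M.η w).sort (· ≤ ·) else []
  st_mem w := by split_ifs <;> simp

/-- The conditions on worlds and edges that are checked one by one. -/
structure Admissible (W : Fin n → Bool) (E : Fin n → Fin n → Bool) (w : Fin n) : Prop where
  root : w = M.root → W w = true
  mem : W w = true → w ∈ M.worlds
  edge : ∀ v, E w v = true → W w = true ∧ (w, v) ∈ M.R

/-- The root must be kept and a non-world cannot be; for other worlds both values of `k` occur. The
previous state `k₀` is forgotten. -/
theorem scans_status (w : Fin n) {k₀ : Bool} {q' : Option Bool} {out : List Letter} :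
    Scans (some k₀) [if w = M.root then Letter.root else if w ∈ M.worlds then Letter.world else Letter.absent]
      q' out ↔ ∃ k : Bool, (w = M.root → k = true) ∧ (k = true → w ∈ M.worlds) ∧ q' = some k ∧
        out = [if w = M.root then Letter.root else if k then Letter.world else Letter.absent] := by
  rw [scans_singleton]
  by_cases hr : w = M.root
  · have hw : w ∈ M.worlds := hr ▸ M.root_mem
    simp only [hr, if_true, M.root_mem, forall_true_left, implies_true, true_and]
    have : ∀ b r, emit (some k₀) Letter.root b = some r ↔ b = false ∧ r = (some true, some Letter.root) := by
      revert k₀; decide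
    simp [this]
  · by_cases hw : w ∈ M.worlds
    · simp only [hr, hw, if_true, if_false, implies_true, true_and, false_implies]
      have : ∀ b r, emit (some k₀) Letter.world b = some r ↔
          r = (some !b, some (if b then Letter.absent else Letter.world)) := by
        revert k₀; decide
      simp only [this]
      constructor
      · rintro ⟨b, r, rfl, rfl, rfl⟩
        exact ⟨!b, rfl, by cases b <;> rfl⟩
      · rintro ⟨k, rfl, rfl⟩
        exact ⟨!k, _, rfl, by simp, by cases k <;> rfl⟩
    · simp only [hr, hw, if_true, if_false, implies_true, true_and, false_implies, imp_false]
      have : ∀ b r, emit (some k₀) Letter.absent b = some r ↔ b = false ∧ r = (some false, some Letter.absent) := by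
        revert k₀; decide
      simp [this]

theorem scans_world (w : Fin n) {k₀ : Bool} {q' : Option Bool} {out : List Letter} :
    Scans (some k₀) (M.encodeWorld w) q' out ↔ ∃ (k : Bool) (e : Fin n → Bool),
      Admissible M (fun _ => k) (fun _ => e) w ∧ q' = some k ∧
      out = (part M (fun _ => k) fun _ => e).block w := by
  have hdig : ∀ l ∈ ((M.η w).sort (· ≤ ·)).flatMap encodeNum, l.val ≤ 2 := fun l hl => by
    obtain ⟨k, -, hk⟩ := List.mem_flatMap.1 hl
    exact le_two_of_mem_encodeNum hk
  have hend : ∀ k b r, emit (some k) Letter.endWorld b = some r ↔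
      b = false ∧ r = (some k, some Letter.endWorld) := by decide
  have hrow := fun k => @scans_row n k (fun v => decide ((w, v) ∈ M.R)) (List.finRange n)
    (List.nodup_finRange n)
  simp only [decide_eq_true_eq] at hrow
  rw [Kripke.encodeWorld, ← List.singleton_append, scans_append]
  simp only [scans_status, scans_append]
  constructor
  · rintro ⟨_, _, _, ⟨k, hk, hk', rfl, rfl⟩, ⟨_, _, _, h₁, ⟨_, _, _, h₂, h₃, rfl⟩, rfl⟩, rfl⟩
    obtain ⟨rfl, e, he, rfl⟩ := (hrow k).1 h₁
    obtain ⟨rfl, rfl⟩ := (scans_digits hdig).1 h₂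
    obtain ⟨b, r, h₄, rfl, rfl⟩ := scans_singleton.1 h₃
    obtain ⟨-, rfl⟩ := (hend _ _ _).1 h₄
    refine ⟨k, e, ⟨hk, hk', fun v => he v (List.mem_finRange v)⟩, rfl, ?_⟩
    cases k <;> simp [part, WordData.block, WordData.row]
  · rintro ⟨k, e, ⟨hk, hk', he⟩, rfl, rfl⟩
    refine ⟨_, _, _, ⟨k, hk, hk', rfl, rfl⟩, ⟨_, _, _, (hrow k).2 ⟨rfl, e, fun v _ => he v, rfl⟩,
      ⟨_, _, _, (scans_digits hdig).2 ⟨rfl, rfl⟩,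
        scans_singleton.2 ⟨_, _, (hend _ _ _).2 ⟨rfl, rfl⟩, rfl, rfl⟩, rfl⟩, rfl⟩, ?_⟩
    cases k <;> simp [part, WordData.block, WordData.row]

theorem part_block_congr {W W' : Fin n → Bool} {E E' : Fin n → Fin n → Bool} {w : Fin n}
    (hW : W w = W' w) (hE : E w = E' w) : (part M W E).block w = (part M W' E').block w := by
  have hrow : (part M W E).row w = (part M W' E').row w := by
    funext v
    change (if E w v then Letter.edge else Letter.noEdge) = if E' w v then Letter.edge else Letter.noEdge
    rw [hE]
  rw [WordData.block, WordData.block, hrow]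
  simp [part, hW]

/-- Admissibility at `w` involves only the values `W w` and `E w`, so choices for distinct worlds
are independent and are glued with `Function.update`. The final state is the choice for the last
world. -/
theorem scans_worlds (ws : List (Fin n)) (hws : ws.Nodup) : ∀ {k₀ : Bool} {q' : Option Bool}
    {out : List Letter}, Scans (some k₀) (ws.flatMap M.encodeWorld) q' out ↔
      ∃ (W : Fin n → Bool) (E : Fin n → Fin n → Bool), (∀ w ∈ ws, Admissible M W E w) ∧
        q' = some ((ws.map W).getLastD k₀) ∧ out = ws.flatMap (part M W E).block := by
  induction ws with
  | nil => intro k₀ q' out; simp [scans_nil]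
  | cons w ws ih =>
    intro k₀ q' out
    obtain ⟨hw, hws⟩ := List.nodup_cons.1 hws
    simp only [List.flatMap_cons, scans_append, scans_world]
    constructor
    · rintro ⟨_, _, _, ⟨k, e, h, rfl, rfl⟩, h', rfl⟩
      obtain ⟨W, E, hall, rfl, rfl⟩ := (ih hws).1 h'
      have hne : ∀ u ∈ ws, u ≠ w := fun u hu h => hw (h ▸ hu)
      refine ⟨Function.update W w k, Function.update E w e, ?_, ?_, ?_⟩
      · intro u hu
        rcases List.mem_cons.1 hu with rfl | hu
        · exact ⟨by simpa using h.root, by simpa using h.mem, by simpa using h.edge⟩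
        · have := hall u hu
          exact ⟨by simpa [Function.update_of_ne (hne u hu)] using this.root,
            by simpa [Function.update_of_ne (hne u hu)] using this.mem,
            by simpa [Function.update_of_ne (hne u hu)] using this.edge⟩
      · have : ws.map (Function.update W w k) = ws.map W :=
          List.map_congr_left fun u hu => Function.update_of_ne (hne u hu) _ _
        rw [List.map_cons, List.getLastD_cons, this, Function.update_self]
      · congr 1
        · exact part_block_congr M (by simp) (by simp)
        · refine List.flatMap_congr fun u hu => ?_
          exact part_block_congr M (by simp [Function.update_of_ne (hne u hu)])
            (by simp [Function.update_of_ne (hne u hu)])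
    · rintro ⟨W, E, h, rfl, rfl⟩
      have hw' := h w (by simp)
      exact ⟨_, _, _, ⟨W w, E w, ⟨hw'.root, hw'.mem, hw'.edge⟩, rfl, rfl⟩,
        (ih hws).2 ⟨W, E, fun u hu => h u (by simp [hu]), by rw [List.map_cons, List.getLastD_cons], rfl⟩,
        congrArg (· ++ _) (part_block_congr M rfl rfl)⟩

/-- The local rules cut out exactly the admissible parts. Targets of edges, totality and
connectedness are not local and are left to `verify`. -/
theorem scans_instance (φ : CTL) {q' : Option Bool} {out : List Letter} :
    Scans (some false) (encodeInstance M φ) q' out ↔ q' = none ∧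
      ∃ (W : Fin n → Bool) (E : Fin n → Fin n → Bool), (∀ w, Admissible M W E w) ∧
        out = (part M W E).word := by
  rw [encodeInstance, scans_append]
  simp only [Kripke.encode, scans_worlds M _ (List.nodup_finRange n)]
  constructor
  · rintro ⟨_, _, _, ⟨W, E, h, rfl, rfl⟩, h', rfl⟩
    obtain ⟨rfl, rfl⟩ := (scans_formula φ).1 h'
    exact ⟨rfl, W, E, fun w => h w (List.mem_finRange w), List.append_nil _⟩
  · rintro ⟨rfl, W, E, h, rfl⟩
    exact ⟨_, _, _, ⟨W, E, fun w _ => h w, rfl, rfl⟩, (scans_formula φ).2 ⟨rfl, rfl⟩,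
      (List.append_nil _).symm⟩

end

end Verifier

/-! ### Accepted parts of a model are connected submodels -/

namespace Verifier

/-- Everything marked after `k` rounds is reachable, by induction on `k`. Conversely `n` rounds
already give a set that contains the root and is closed under edges. -/
theorem reach_iff {n : ℕ} (D : WordData n) (w : Fin n) : reach D w = true ↔
    ∃ r, D.st r = Letter.root ∧ Relation.ReflTransGen (fun u v => D.e u v = true) r w := by
  constructor
  · have : ∀ k w, ((fun Z w => Z w || D.pred Z w)^[k] fun w => decide (D.st w = Letter.root)) w = true →
        ∃ r, D.st r = Letter.root ∧ Relation.ReflTransGen (fun u v => D.e u v = true) r w := by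
      intro k
      induction k with
      | zero => intro w h; exact ⟨w, of_decide_eq_true h, .refl⟩
      | succ k ih =>
        intro w h
        rw [Function.iterate_succ_apply', Bool.or_eq_true] at h
        rcases h with h | h
        · exact ih w h
        · simp only [WordData.pred, List.any_eq_true, Bool.and_eq_true] at h
          obtain ⟨v, -, hv, hz⟩ := h
          obtain ⟨r, hr, h⟩ := ih v hz
          exact ⟨r, hr, h.tail hv⟩
    exact this n w
  -- With the root built into the operator, the search becomes an iteration from `⊥`, so that
  -- `Monotone.iterate_bot_fixed` applies; the first round only produces the root, whence the shift
  -- by one in `hiter`.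
  · set F : (Fin n → Bool) → Fin n → Bool := fun Z w =>
      decide (D.st w = Letter.root) || (Z w || D.pred Z w) with hF
    have hmono : Monotone F := by
      intro Z Z' h w hw
      have h' : ∀ v, Z v = true → Z' v = true := fun v => h v
      change F Z w = true at hw
      change F Z' w = true
      simp only [hF, Bool.or_eq_true, WordData.pred, List.any_eq_true, Bool.and_eq_true] at hw ⊢
      exact hw.imp_right (Or.imp (h' w) fun ⟨v, hv, hv', hz⟩ => ⟨v, hv, hv', h' v hz⟩)
    have hiter : ∀ k, F^[k + 1] ⊥ =
        (fun Z w => Z w || D.pred Z w)^[k] fun w => decide (D.st w = Letter.root) := by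
      intro k
      induction k with
      | zero =>
        funext w
        have : D.pred (⊥ : Fin n → Bool) w = false := by
          simp [WordData.pred]
        change (decide (D.st w = Letter.root) || ((⊥ : Fin n → Bool) w || D.pred ⊥ w)) = _
        rw [this]
        simp
      | succ k ih =>
        have hle : ∀ w, D.st w = Letter.root → F^[k + 1] ⊥ w = true := fun w hw => by
          rw [Function.iterate_succ_apply', hF]
          simp [hw]
        rw [Function.iterate_succ_apply' F (k + 1),
          Function.iterate_succ_apply' (fun Z w => Z w || D.pred Z w) k, ← ih]
        funext w
        generalize F^[k + 1] ⊥ = Z at hle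
        change (decide (D.st w = Letter.root) || (Z w || D.pred Z w)) = (Z w || D.pred Z w)
        by_cases hw : D.st w = Letter.root
        · simp [hle w hw]
        · simp [hw]
    have hfix : F (reach D) = reach D := by
      have h := hmono.iterate_bot_fixed
      have : reach D = F^[n] ⊥ := by
        rw [← h, ← Function.iterate_succ_apply' F]
        exact (hiter n).symm
      rw [this, h]
    have hstep : ∀ w, (D.st w = Letter.root ∨ ∃ v, D.e v w = true ∧ reach D v = true) →
        reach D w = true := by
      intro w hw
      rw [← hfix]
      simp only [hF, Bool.or_eq_true, decide_eq_true_eq, WordData.pred, List.any_eq_true, Bool.and_eq_true]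
      exact hw.imp_right fun ⟨v, hv⟩ => Or.inr ⟨v, List.mem_finRange v, hv⟩
    rintro ⟨r, hr, h⟩
    induction h with
    | refl => exact hstep _ (Or.inl hr)
    | tail _ hv ih => exact hstep _ (Or.inr ⟨_, hv, ih⟩)

variable {n : ℕ} (M : Kripke n) (φ : CTL)

/-- The data of a submodel. -/
def subData (M' : Kripke n) : WordData n :=
  part M (fun w => decide (w ∈ M'.worlds)) fun w v => decide ((w, v) ∈ M'.R)

variable {M} {M' : Kripke n}

theorem subData_admissible (h : M'.IsSubmodel M) (w : Fin n) :
    Admissible M (fun w => decide (w ∈ M'.worlds)) (fun w v => decide ((w, v) ∈ M'.R)) w where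
  root hw := by rw [hw, ← h.root_eq]; exact decide_eq_true M'.root_mem
  mem hw := h.worlds_sub (of_decide_eq_true hw)
  edge v hv := ⟨decide_eq_true (M'.R_sub _ (of_decide_eq_true hv)).1, h.R_sub (of_decide_eq_true hv)⟩

theorem subData_st (h : M'.IsSubmodel M) (w : Fin n) : (subData M M').st w =
    if w = M'.root then Letter.root else if w ∈ M'.worlds then Letter.world else Letter.absent := by
  simp [subData, part, h.root_eq]

theorem subData_st_root (h : M'.IsSubmodel M) (w : Fin n) :
    (subData M M').st w = Letter.root ↔ w = M'.root := by
  rw [subData_st h]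
  split_ifs with h₁ h₂ <;> simp [h₁, Letter.world, Letter.root, Letter.absent]

theorem subData_st_absent (h : M'.IsSubmodel M) (w : Fin n) :
    (subData M M').st w = Letter.absent ↔ w ∉ M'.worlds := by
  rw [subData_st h]
  by_cases h₁ : w = M'.root
  · simp [h₁, M'.root_mem, Letter.root, Letter.absent]
  · by_cases h₂ : w ∈ M'.worlds <;> simp [h₁, h₂, Letter.world, Letter.absent]

theorem subData_lab (h : M'.IsSubmodel M) (w : Fin n) :
    (subData M M').lab w = (M'.η w).sort (· ≤ ·) := by
  by_cases hw : w ∈ M'.worlds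
  · simp [subData, part, hw, h.η_eq w hw]
  · simp [subData, part, hw, M'.η_off w hw]

theorem subData_word (h : M'.IsSubmodel M) : (subData M M').word = M'.encode := by
  refine List.flatMap_congr fun w _ => ?_
  rw [WordData.block, subData_st h, subData_lab h, Kripke.encodeWorld]
  refine congrArg _ (congrArg (· ++ _) (List.map_congr_left fun v _ => ?_))
  simp [WordData.row, subData, part]

theorem eval_subData (h : M'.IsSubmodel M) {w : Fin n} (hw : w ∈ M'.worlds) :
    φ.eval (subData M M').e (fun w p => decide (p ∈ (subData M M').lab w)) w = true ↔ M'.Sat φ w := by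
  rw [← CTL.eval_iff M' φ w hw]
  have : (fun w p => decide (p ∈ (subData M M').lab w)) = fun w p => decide (p ∈ M'.η w) := by
    funext w p
    simp [subData_lab h]
  rw [this]
  rfl

/-- In a total model a finite path from the root to `w` extends to an infinite one, so `w` lies on
an infinite path from the root if and only if it is reachable. Reachability of removed worlds is
excluded since edges stay within the worlds. -/
theorem accepts_subData_iff (h : M'.IsSubmodel M) :
    Accepts (subData M M') φ ↔ M'.IsConnectedSubmodel M ∧ M'.Models φ := by
  have he : ∀ w v, (subData M M').e w v = true ↔ (w, v) ∈ M'.R := fun w v => decide_eq_true_iff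
  have hreach : ∀ w, reach (subData M M') w = true ↔
      Relation.ReflTransGen (fun u v => (subData M M').e u v = true) M'.root w := by
    intro w
    rw [reach_iff]
    simp [subData_st_root h]
  have hmem : ∀ w, reach (subData M M') w = true → w ∈ M'.worlds := by
    intro w hw
    induction (hreach w).1 hw with
    | refl => exact M'.root_mem
    | tail _ hv _ => exact (M'.R_sub _ ((he _ _).1 hv)).2
  have hcl : ∀ w ∈ (M'.worlds : Set (Fin n)), ∀ v, (subData M M').e w v = true →
      v ∈ (M'.worlds : Set (Fin n)) := fun w _ v hv => (M'.R_sub _ ((he w v).1 hv)).2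
  have htot : ∀ w ∈ (M'.worlds : Set (Fin n)), ∃ v, (subData M M').e w v = true := fun w hw => by
    simpa only [he] using M'.total w hw
  have hpath : ∀ w, M'.paths w = edgePaths (subData M M').e w := fun w => by
    ext π; simp only [Kripke.paths, edgePaths, he]
  have hconn : (∀ w, connected (subData M M') w = true) ↔
      ∀ w ∈ M'.worlds, ∃ π ∈ M'.paths M'.root, ∃ i, π i = w := by
    simp only [hpath]
    constructor
    · intro hc w hw
      have hw' : reach (subData M M') w = true := by
        have := hc w
        rw [connected, if_neg (by rw [subData_st_absent h]; simpa using hw), Bool.and_eq_true] at this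
        exact this.1
      have hroot := M'.root_mem
      rw [hreach] at hw'
      generalize M'.root = r at hw' hroot
      -- Start with an infinite path from `w` itself and prepend the edges that lead to `w`.
      induction hw' using Relation.ReflTransGen.head_induction_on with
      | refl =>
        obtain ⟨π, hπ⟩ := exists_mem_edgePaths hcl htot hroot
        exact ⟨π, hπ, 0, hπ.1⟩
      | head huv _ ih =>
        obtain ⟨π, hπ, i, hi⟩ := ih (hcl _ hroot _ huv)
        exact ⟨_, cons_mem_edgePaths huv hπ, i + 1, hi⟩
    · intro hc
      have hall : ∀ w ∈ M'.worlds, reach (subData M M') w = true := by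
        intro w hw
        obtain ⟨π, hπ, i, rfl⟩ := hc w hw
        rw [hreach]
        clear hw
        induction i with
        | zero => rw [hπ.1]
        | succ i ih => exact ih.tail (hπ.2 i)
      intro w
      by_cases hw : w ∈ M'.worlds
      · rw [connected, if_neg (by rw [subData_st_absent h]; simpa using hw), Bool.and_eq_true,
          VecOp.succ_eq_true]
        obtain ⟨v, hv⟩ := htot w hw
        exact ⟨hall w hw, v, hv, hall v (hcl w hw v hv)⟩
      · rw [connected, if_pos ((subData_st_absent h w).2 hw), Bool.not_eq_true', Bool.eq_false_iff]
        exact fun hw' => hw (hmem w hw')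
  have hmodels : (∀ w, (subData M M').st w = Letter.root →
      φ.eval (subData M M').e (fun w p => decide (p ∈ (subData M M').lab w)) w = true) ↔ M'.Models φ := by
    simp only [subData_st_root h, forall_eq]
    exact eval_subData φ h M'.root_mem
  rw [Accepts, hconn, hmodels]
  exact and_congr_left fun _ => ⟨fun hc => ⟨h, hc⟩, fun hc => hc.connected⟩

/-- Under the connectivity check the kept worlds are exactly the reachable ones. An edge starts in a
kept world, so its target is reachable and hence kept; totality holds because kept worlds were
required to have successors. -/
theorem exists_submodel {W : Fin n → Bool} {E : Fin n → Fin n → Bool} (h : ∀ w, Admissible M W E w)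
    (hacc : ∀ w, connected (part M W E) w = true) :
    ∃ M' : Kripke n, M'.IsSubmodel M ∧ subData M M' = part M W E := by
  have hst : ∀ w, (part M W E).st w = Letter.absent ↔ W w = false := by
    intro w
    have := (h w).root
    by_cases hr : w = M.root <;> cases hw : W w <;>
      simp_all [part, Letter.root, Letter.absent, Letter.world]
  have hW : ∀ w, W w = true ↔ reach (part M W E) w = true := by
    intro w
    have := hacc w
    rw [connected] at this
    simp only [hst] at this
    cases hw : W w <;> simp_all
  have htot : ∀ w, W w = true → ∃ v, E w v = true := by
    intro w hw
    have := hacc w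
    rw [connected] at this
    simp only [hst, hw, Bool.true_eq_false, if_false, Bool.and_eq_true, VecOp.succ_eq_true] at this
    obtain ⟨-, v, hv, -⟩ := this
    exact ⟨v, hv⟩
  have hE : ∀ w v, E w v = true → W v = true := by
    intro w v hv
    obtain ⟨r, hr, hrw⟩ := (reach_iff _ _).1 ((hW w).1 ((h w).edge v hv).1)
    exact (hW v).2 ((reach_iff _ _).2 ⟨r, hr, hrw.tail hv⟩)
  refine ⟨{
    worlds := Finset.univ.filter fun w => W w = true
    R := Finset.univ.filter fun e => E e.1 e.2 = true
    η := fun w => if W w then M.η w else ∅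
    root := M.root
    root_mem := by simpa using (h M.root).root rfl
    R_sub := fun e he => by
      simp only [Finset.mem_filter, Finset.mem_univ, true_and] at he ⊢
      exact ⟨((h _).edge _ he).1, hE _ _ he⟩
    total := fun w hw => by simpa using htot w (by simpa using hw)
    η_off := fun w hw => by
      rw [if_neg]
      simpa using hw }, ⟨fun w hw => (h w).mem (by simpa using hw), ?_, fun w hw => ?_, rfl⟩, ?_⟩
  · rintro ⟨w, v⟩ hv
    exact ((h w).edge v (by simpa using hv)).2
  · exact if_pos (by simpa using hw)
  · simp [subData]

/-! #### The complete program -/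

open StackProg

/-- Move a model back and count its worlds. -/
def restore : Prog := forEach .A fun s => push .B s ;; if s.lt = Letter.endWorld then push .U s else skip

/-- Decide whether decisions for some letters can be completed. -/
def extendable : Prog :=
  move .A .B id ;;
  push .CUR (encState (some false)) ;;
  forEach .B scanBody ;;
  (case .CUR fun _ => skip) ;;
  restore ;;
  verify

theorem runs_restore (m : Mem) (l : List Sym) : ∀ b u : List Sym,
    Runs restore { m with A := l, B := b, U := u } (l.length + 1)
      { m with A := [], B := l.reverse ++ b,
               U := (l.filter fun s => decide (s.lt = Letter.endWorld)).reverse ++ u } := by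
  induction l with
  | nil => intro b u; exact Runs.forEach_nil rfl
  | cons s l ih =>
    intro b u
    by_cases hs : s.lt = Letter.endWorld
    · refine ((Runs.forEach_cons rfl (T := 0) ?_ (ih (s :: b) (s :: u))).mono (by simp; omega)).cast
        (by simp [hs])
      rw [if_pos hs]
      exact Runs.of_run rfl
    · refine ((Runs.forEach_cons rfl (T := 0) ?_ (ih (s :: b) u)).mono (by simp; omega)).cast
        (by simp [hs])
      rw [if_neg hs]
      exact Runs.of_run rfl

theorem det_restore : Det restore := det_forEach fun s => ⟨trivial, by split_ifs <;> trivial⟩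

/-- Each block has exactly one end marker. `restore` thus leaves one symbol per world on `U`, the
counter for all iterations. -/
theorem count_endWorld (D : WordData n) : (D.word.filter fun l => decide (l = Letter.endWorld)).length = n := by
  have hblock : ∀ w, ((D.block w).filter fun l => decide (l = Letter.endWorld)).length = 1 := by
    intro w
    have h₁ : D.st w ≠ Letter.endWorld := by
      rcases D.st_mem w with h | h | h <;> rw [h] <;> decide
    have h₂ : ((List.finRange n).map (D.row w)).filter (fun l => decide (l = Letter.endWorld)) = [] := by
      rw [List.filter_eq_nil_iff]
      intro l hl
      obtain ⟨v, -, rfl⟩ := List.mem_map.1 hl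
      simp only [WordData.row]
      split_ifs <;> decide
    have h₃ : ((D.lab w).flatMap encodeNum).filter (fun l => decide (l = Letter.endWorld)) = [] := by
      rw [List.filter_eq_nil_iff]
      intro l hl
      obtain ⟨k, -, hk⟩ := List.mem_flatMap.1 hl
      have := le_two_of_mem_encodeNum hk
      intro h
      rw [of_decide_eq_true h] at this
      exact absurd this (by decide)
    simp [WordData.block, h₁, h₂, h₃]
  have : ∀ ws : List (Fin n),
      ((ws.flatMap D.block).filter fun l => decide (l = Letter.endWorld)).length = ws.length := by
    intro ws
    induction ws with
    | nil => rfl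
    | cons w ws ih => simp [List.filter_append, hblock, ih, Nat.add_comm]
  simpa [WordData.word] using this (List.finRange n)

/-- The stack symbol for a letter of a query. -/
def inputSym (z : Fin 72) : Sym :=
  { lt := ⟨z.val % 24, Nat.mod_lt _ (by norm_num)⟩, a := decide (z.val / 24 = 2), b := decide (z.val / 24 = 1) }

theorem inputSym_mark (l : Letter) (o : Option Bool) :
    inputSym (RAM.mark l o) = { lt := l, a := o.isNone, b := o.getD false } := by
  have hl := l.isLt
  ext1
  · apply Fin.ext
    rcases o with _ | _ | _ <;> simp [inputSym, RAM.mark] <;> omega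
  all_goals rcases o with _ | _ | _ <;> simp [inputSym, RAM.mark] <;>
    first | omega | exact decide_eq_true (by omega) | exact decide_eq_false (by omega)

theorem map_lt_query (x : List Letter) : ∀ p, ((RAM.query x p).map inputSym).map Sym.lt = x := by
  induction x with
  | nil => intro p; rfl
  | cons l x ih => intro p; cases p <;> simp only [RAM.query, List.map_cons, inputSym_mark, ih]

theorem agrees_query (x : List Letter) : ∀ (p s : List Bool), p.length ≤ x.length →
    (Agrees ((RAM.query x p).map inputSym) s ↔ p <+: s ∧ s.length = x.length) := by
  induction x with
  | nil =>
    intro p s hp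
    obtain rfl := List.eq_nil_of_length_eq_zero (Nat.le_zero.1 hp)
    cases s <;> simp [Agrees, RAM.query]
  | cons l x ih =>
    intro p s hp
    cases s with
    | nil => cases p <;> simp [Agrees, RAM.query]
    | cons b s =>
      cases p with
      | nil =>
        have := ih [] s (by simp)
        simp only [Agrees] at this
        simp [Agrees, RAM.query, inputSym_mark, this]
      | cons c p =>
        have := ih p s (by simpa using hp)
        simp only [Agrees] at this
        simp [Agrees, RAM.query, inputSym_mark, this, and_assoc]

/-- Sequences of decisions that describe solutions. -/
def good (M : Kripke n) (φ : CTL) : Set (List Bool) :=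
  {s | ∃ M' : Kripke n, M'.IsConnectedSubmodel M ∧ M'.Models φ ∧
    scan (some false) (encodeInstance M φ) s = some (none, M'.encode)}

/-- A bound for the time of the verifier. -/
noncomputable def timeBound : Polynomial ℕ :=
  -- The summands are for reversing the input, scanning, restoring and verifying; `7 * .X + 7`
  -- bounds `stepCost` plus one, and the second line bounds the evaluation of the formula.
  (.X + 1) + (2 * .X + 1) + (.X + 1) + ((.X + 4) * (7 * .X + 7) + 10 * (.X + 1) +
    .X * ((.X + 1) * (7 * .X + 7) + 20 * (.X + 1) + 4 * .X + 1))

theorem fn_empty : (fun _ => []) = ({} : Mem).fn := by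
  funext i
  change [] = ({} : Mem).get (K.ofPos i)
  cases K.ofPos i <;> rfl

theorem formulaPart_instance (M : Kripke n) (φ : CTL) :
    formulaPart (some false) (encodeInstance M φ) = φ.encode := by
  have hM : ∀ l ∈ M.encode, l.val < 9 := by
    intro l hl
    obtain ⟨w, -, hl⟩ := List.mem_flatMap.1 hl
    simp only [Kripke.encodeWorld, List.mem_cons, List.mem_append, List.mem_map, List.mem_flatMap,
      List.not_mem_nil, or_false] at hl
    rcases hl with rfl | ⟨v, -, rfl⟩ | ⟨k, -, hk⟩ | rfl
    · split_ifs <;> decide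
    · split_ifs <;> decide
    · have := le_two_of_mem_encodeNum hk
      omega
    · decide
  obtain ⟨⟨l, r, hφ, hl⟩, -⟩ := CTL.encode_val φ
  rw [formulaPart, if_neg (by simp), encodeInstance,
    List.dropWhile_append_of_pos (fun l hl => decide_eq_true (hM l hl)), hφ, List.dropWhile_cons_of_neg]
  simpa using hl

/-- The time bound matters only for completeness. For soundness an arbitrary execution is followed
stage by stage: the scan yields decisions and an admissible part, and the acceptance of that part
makes it a submodel. -/
theorem exec_extendable_iff (M : Kripke n) (φ : CTL) (p : List Bool)
    (hp : p.length ≤ (encodeInstance M φ).length) :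
    (∃ t ≤ timeBound.eval (RAM.query (encodeInstance M φ) p).length, ∃ S, Exec extendable
      (inputStacks K.A.pos inputSym (RAM.query (encodeInstance M φ) p)) t S) ↔
    ∃ s ∈ good M φ, p <+: s ∧ s.length = (encodeInstance M φ).length := by
  set x := encodeInstance M φ with hx
  set zs := (RAM.query x p).map inputSym with hzs
  have hin : inputStacks K.A.pos inputSym (RAM.query x p) = ({ A := zs.reverse } : Mem).fn := by
    rw [inputStacks, fn_empty, Mem.update_fn, hzs, ← List.map_reverse]
    rfl
  have hlt : zs.map Sym.lt = x := map_lt_query x p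
  have h₁ : Runs (move .A .B id) { A := zs.reverse } (x.length + 1) { B := zs } :=
    ((runs_move (k := .A) (k' := .B) nofun id _).mono (by simp [Mem.get, hzs])).cast
      (by simp [Mem.get, Mem.set])
  have h₂ : Runs (push .CUR (encState (some false))) { B := zs } 0
      { B := zs, CUR := [encState (some false)] } := Runs.of_run rfl
  have h₄ : ∀ (out : List Letter), Runs (case .CUR fun _ => skip)
      { A := (out.map sym).reverse, F := (φ.encode.map sym).reverse, CUR := [encState none] } 0
      { A := (out.map sym).reverse, F := (φ.encode.map sym).reverse } := fun out => Runs.of_run rfl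
  have h₅ : ∀ (D : WordData n), Runs restore
      { A := (D.word.map sym).reverse, F := (φ.encode.map sym).reverse } (D.word.length + 1)
      (base D (φ.encode.map sym).reverse
        ((D.word.map sym).filter fun s => decide (s.lt = Letter.endWorld)) [] [] []) := fun D =>
    ((runs_restore { F := (φ.encode.map sym).reverse } (D.word.map sym).reverse [] []).mono
      (by simp)).cast (by simp [base, List.filter_reverse])
  have hU : ∀ (D : WordData n),
      ((D.word.map sym).filter fun s => decide (s.lt = Letter.endWorld)).length = n := fun D => by
    rw [List.filter_map, List.length_map]
    exact count_endWorld D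
  have hform : formulaPart (some false) x = φ.encode := formulaPart_instance M φ
  rw [hin, RAM.length_query]
  constructor
  · rintro ⟨t, -, S, h⟩
    obtain ⟨_, _, _, e₁, h, -⟩ := exec_seq_iff.1 h
    obtain ⟨_, _, _, e₂, h, -⟩ := exec_seq_iff.1 h
    obtain ⟨_, _, _, e₃, h, -⟩ := exec_seq_iff.1 h
    obtain ⟨_, _, _, e₄, h, -⟩ := exec_seq_iff.1 h
    obtain ⟨_, _, _, e₅, e₆, -⟩ := exec_seq_iff.1 h
    obtain rfl := h₁.unique (det_move _ _ _) e₁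
    obtain rfl := h₂.unique trivial e₂
    obtain ⟨s, q', out, hs, hscan, rfl⟩ := exec_scan {} zs (a := []) (f := []) e₃
    rw [hlt] at hscan
    obtain ⟨rfl, W, E, hadm, rfl⟩ := (scans_instance M φ).1 ⟨s, hscan⟩
    rw [hlt, hform, List.append_nil, List.append_nil] at e₄
    obtain rfl := (h₄ _).unique (fun _ => trivial) e₄
    obtain rfl := (h₅ _).unique det_restore e₅
    have hacc := accepts_of_exec_verify _ _ φ (hU _) e₆
    obtain ⟨M', hM', he⟩ := exists_submodel hadm hacc.1
    rw [← he] at hacc hscan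
    obtain ⟨hM'', hφ⟩ := (accepts_subData_iff φ hM').1 hacc
    rw [subData_word hM'] at hscan
    exact ⟨s, ⟨M', hM'', hφ, hscan⟩, (agrees_query x p s hp).1 hs⟩
  · rintro ⟨s, ⟨M', hM', hφ, hscan⟩, hs⟩
    have hsub := hM'.toIsSubmodel
    rw [← subData_word hsub, ← hx, ← hlt] at hscan
    have h₃ := runs_scan {} zs (a := []) (f := []) ((agrees_query x p s hp).2 hs) hscan
    rw [hlt, hform, List.append_nil, List.append_nil] at h₃
    have h₆ := runs_verify (subData M M') _ φ (hU (subData M M')) ((accepts_subData_iff φ hsub).2 ⟨hM', hφ⟩)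
    obtain ⟨t, ht, h⟩ := h₁.seq (h₂.seq (h₃.seq ((h₄ _).seq ((h₅ _).seq h₆))))
    refine ⟨t, ht.trans ?_, _, h⟩
    have hw : (subData M M').word.length ≤ x.length := by
      have := hsub.length_encode_le
      rw [subData_word hsub, hx, encodeInstance, List.length_append]
      omega
    have hf : φ.encode.length ≤ x.length := by
      rw [hx, encodeInstance, List.length_append]
      omega
    have hz : zs.length = x.length := by simp [hzs]
    have hn := (subData M M').card_le_word
    have hn' : n ≤ x.length := by nlinarith
    -- Each of `M.word.length`, `n * (n + 1)` and `n` is at most `x.length`, with coefficients 2, 1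
    -- and 4.
    have hstep : stepCost (subData M M') + 1 ≤ 7 * x.length + 7 := by
      rw [stepCost]; omega
    have hcost : cost (subData M M') + 1 ≤
        (x.length + 1) * (7 * x.length + 7) + 20 * (x.length + 1) + 4 * x.length + 1 := by
      rw [cost]; gcongr
    have hverify : verifyCost (subData M M') φ.encode.length ≤
        (x.length + 4) * (7 * x.length + 7) + 10 * (x.length + 1) +
          x.length * ((x.length + 1) * (7 * x.length + 7) + 20 * (x.length + 1) + 4 * x.length + 1) := by
      rw [verifyCost]; gcongr
    simp only [timeBound, Polynomial.eval_add, Polynomial.eval_mul, Polynomial.eval_X,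
      Polynomial.eval_one, Polynomial.eval_ofNat, hz]
    omega

end Verifier

theorem mainTheorem2 : eSubmodels ∈ DelNP 24 := by
  refine ⟨72, _, StackProg.exec_mem_NP Verifier.extendable Verifier.K.A.pos Verifier.inputSym
    Verifier.timeBound, RAM.enumProgram,
    (100 * .X + 100) * (2 * .X + 300) + 1, ?_⟩
  rintro x ⟨n, M, φ, rfl⟩
  set x := encodeInstance M φ
  obtain ⟨h₁, h₂⟩ := RAM.enumDelay_of_query (L := {z | ∃ t ≤ Verifier.timeBound.eval z.length, ∃ S,
    StackProg.Exec Verifier.extendable (StackProg.inputStacks Verifier.K.A.pos Verifier.inputSym z) t S})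
    (good := Verifier.good M φ) fun p hp => Verifier.exec_extendable_iff M φ p hp
  have heval : ((100 * .X + 100) * (2 * .X + 300) + 1 : Polynomial ℕ).eval x.length =
      (100 * x.length + 100) * (2 * x.length + 300) + 1 := by simp
  have hmem : ∀ s, s ∈ RAM.sols (Verifier.good M φ) x.length [] ↔ s ∈ Verifier.good M φ := by
    intro s
    rw [RAM.mem_sols]
    refine ⟨fun h => h.2.2, fun h => ⟨List.nil_prefix, ?_, h⟩⟩
    obtain ⟨M', -, -, h⟩ := h
    simpa using (Verifier.scan_eq h).1
  rw [heval]
  refine ⟨⟨(RAM.sols (Verifier.good M φ) x.length []).map (RAM.printWord x), ?_, fun y => ?_, ?_⟩, ?_⟩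
  -- Different good sequences print different words, because the decisions can be recovered from the
  -- output.
  · refine List.Nodup.map_on (fun s hs s' hs' h => ?_) (RAM.nodup_sols _ _ _)
    obtain ⟨M', -, -, hs⟩ := (hmem s).1 hs
    obtain ⟨M'', -, -, hs'⟩ := (hmem s').1 hs'
    rw [← (Verifier.scan_eq hs).2, ← (Verifier.scan_eq hs').2] at h
    rw [← h] at hs'
    exact Verifier.scan_injective hs hs'
  · rw [mem_eSubmodels_Sol, List.mem_map]
    constructor
    · rintro ⟨s, hs, rfl⟩
      obtain ⟨M', hM', hφ, hs⟩ := (hmem s).1 hs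
      exact ⟨M', hM', hφ, (Verifier.scan_eq hs).2.symm⟩
    -- The worlds and edges of a submodel form an admissible part, so some decisions pass the check
    -- and print its word.
    · rintro ⟨M', hM', hφ, rfl⟩
      obtain ⟨s, hs⟩ := (Verifier.scans_instance M φ).2 ⟨rfl, _, _,
        Verifier.subData_admissible hM'.toIsSubmodel, rfl⟩
      have hw := Verifier.subData_word hM'.toIsSubmodel
      rw [Verifier.subData] at hw
      rw [hw] at hs
      exact ⟨s, (hmem s).2 ⟨M', hM', hφ, hs⟩, (Verifier.scan_eq hs).2.symm⟩
  · rw [List.map_map]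
    exact h₁
  · intro c hc l hl
    obtain ⟨w, hw, hw'⟩ := h₂ c hc l hl
    exact ⟨w, by nlinarith, hw'⟩
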